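/- **Setting.** For $N,k\ge 1$ let $B^{(N)}_k$ be the set of vectors $(x_1,\dots,x_N)\in\mathbb Z_{\ge0}^N$ with $\sum_i x_i=k$ (single-row semistandard tableaux of length $k$, with $x_i$ letters $i$). For $i\in\mathbb Z/N$ (letters read mod $N$) the operator $\tilde f_i$ changes one letter $i$ into $i+1$ (for $i=0$: a letter $N$ into $1$), $\tilde e_i$ does the opposite, and both are $0$ if the letter is absent; $\varphi_i(b)=x_i$, $\varepsilon_i(b)=x_{i+1}$. On $b_1\otimes b_2$, $\tilde e_i$ acts on $b_1$ if $\varphi_i(b_1)\ge\varepsilon_i(b_2)$ and otherwise on $b_2$; $\tilde f_i$ acts on $b_1$ if $\varphi_i(b_1)>\varepsilon_i(b_2)$ and otherwise on $b_2$. The combinatorial $R$ matrix is the unique bijection $B^{(N)}_k\otimes B^{(N)}_l\to B^{(N)}_l\otimes B^{(N)}_k$ that commutes with all $\tilde e_i,\tilde f_i$. Fix $M\ge1$ and put $B_k=B^{(M+1)}_k$ with $R$ matrix $R$, $B'_k=B^{(M)}_k$ with $R$ matrix $R'$, and $u_k=(k,0,\dots,0)\in B_k$. Let $\theta,\kappa\ge1$.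 A state is a family $p=(p_n)_{n\in\mathbb Z}$, $p_n\in B_\theta$, with $p_n=u_\theta$ for all but finitely many $n$. Its time evolution $T_\kappa(p)=p'$ is given by $R(v_n\otimes p_n)=p'_n\otimes v_{n+1}$ for all $n$, where $v_n\in B_\kappa$ and $v_n=u_\kappa$ for all but finitely many $n$. For $b\in B'_l$ with letters $m_1\le\dots\le m_l$ let $w(b)$ be the word $m_l+1,\dots,m_1+1$. For $a\in\mathbb Z$, $L\ge0$, $b\in B'_i$, $c\in B'_j$ let $\iota^{a,L}_{i,j}(b\otimes c)$ be the state obtained as follows: write the word $w(b)\,1^L\,w(c)$ on $\mathbb Z$ from position $a$ on, write $1$ everywhere else, and let cell $n$ contain the letters at the positions $n\theta,\dots,n\theta+\theta-1$. The state $\iota^a_l(b)$ is defined likewise from the word $w(b)$; it is a soliton of amplitude $l$. The pair $(a,L)$ has separation at least $D$ if $\lfloor (a+i+L)/\theta\rfloor-\lfloor (a+i-1)/\theta\rfloor\ge D$ (the number of cells from the last letter of the first soliton to the first letter of the second). The coordinate of a state $p$ different from the vacuum is $x(p)=(n+1)\theta-s$, where $n$ is the first cell with $p_n\ne u_\theta$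 and $s$ is the number of letters $\neq1$ in it. The velocity of $p$ under $T_\kappa$ is $x(T_\kappa(p))-x(p)$. A map $S:B'_i\otimes B'_j\to B'_j\otimes B'_i$ is called the scattering matrix for separation $D$ if for all $b\in B'_i$, $c\in B'_j$ and all $(a,L)$ of separation at least $D$ the following holds: for every $D'$, for all sufficiently large $t$, there is $(a',L')$ of separation at least $D'$ (with respect to $j,i$) such that $$T_\kappa^t\bigl(\iota^{a,L}_{i,j}(b\otimes c)\bigr)=\iota^{a',L'}_{j,i}\bigl(S(b\otimes c)\bigr).$$ **Theorem.** For every $l$ there is a $D$, depending only on $l$, such that for all $M\ge1$, $1\le k<l$, $\theta\ge1$, $\kappa\ge1$: (I) If $\min(l,\kappa)>\max(k,\theta)$, then $R':B'_l\otimes B'_k\to B'_k\otimes B'_l$ is a scattering matrix for separation $D$, and it is the only one: the larger soliton overtakes the smaller one. (II) If $\min(l,\theta)>\max(k,\kappa)$, then $R':B'_k\otimes B'_l\to B'_l\otimes B'_k$ is a scattering matrix for separation $D$, and it is the only one: the smaller soliton overtakes the larger one. (III) Otherwise there is no scattering: there is an integer $v>0$ such that every soliton of amplitude $l$ and every soliton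 of amplitude $k$ has velocity $v$ under $T_\kappa$, and, for $(i,j)=(l,k)$ and for $(i,j)=(k,l)$, $$T_\kappa^t\bigl(\iota^{a,L}_{i,j}(b\otimes c)\bigr)=\iota^{a+tv,L}_{i,j}(b\otimes c)\qquad(t\ge0)$$ for all $b\in B'_i$, $c\in B'_j$ and all $(a,L)$ of separation at least $D$. -/

import Mathlib

/-- The crystal of single-row semistandard tableaux of length `k` on `N` letters, an element being
given by the multiplicities of its letters.  The letters `1, …, N` are indexed by `0, …, N - 1`.
For `M` an integer, `Crystal (M + 1) k` is `B_k` (type `A^{(1)}_M`) and `Crystal M k` is `B'_k`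
(type `A^{(1)}_{M-1}`). -/
def Crystal (N k : ℕ) : Type := {x : Fin N → ℕ // ∑ i, x i = k}

namespace Crystal

/-- The number of letters with index `i` in `b`. -/
def mult {N k : ℕ} (b : Crystal N k) (i : Fin N) : ℕ := b.1 i

/-- The highest weight element `u_k`, the row that consists of the first letter only. -/
def vac (N k : ℕ) [NeZero N] : Crystal N k := ⟨Pi.single 0 k, by simp⟩

/-- Replace one letter `a` by the letter `c`; the result is `none` (the `0` of crystal theory) if
`b` does not contain `a`. -/
def move {N k : ℕ} (a c : Fin N) (b : Crystal N k) : Option (Crystal N k) :=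
  if h : 0 < b.1 a then
    some ⟨fun m => (b.1 m - if m = a then 1 else 0) + if m = c then 1 else 0, by
      have h1 : ∑ m, ((b.1 m - if m = a then 1 else 0) + if m = a then 1 else 0) = k := by
        refine Eq.trans (Finset.sum_congr rfl fun m _ => ?_) b.2
        split_ifs with hm
        · subst hm; omega
        · simp
      rw [Finset.sum_add_distrib] at h1 ⊢
      simpa using h1⟩
  else none

/-- Kashiwara operator `f̃_i`, `i ∈ {0, …, N - 1}`: for `i ≥ 1` it changes a letter `i` into `i + 1`,
and `f̃_0` changes a letter `N` into `1` (in the index set of the letters: `i - 1` into `i`,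
cyclically). -/
def f {N k : ℕ} [NeZero N] (i : Fin N) (b : Crystal N k) : Option (Crystal N k) := move (i - 1) i b

/-- Kashiwara operator `ẽ_i`, opposite to `f̃_i`. -/
def e {N k : ℕ} [NeZero N] (i : Fin N) (b : Crystal N k) : Option (Crystal N k) := move i (i - 1) b

/-- `ε_i(b)`, the number of letters of `b` on which `ẽ_i` can act. -/
def eps {N k : ℕ} (i : Fin N) (b : Crystal N k) : ℕ := b.mult i

/-- `φ_i(b)`, the number of letters of `b` on which `f̃_i` can act. -/
def phi {N k : ℕ} [NeZero N] (i : Fin N) (b : Crystal N k) : ℕ := b.mult (i - 1)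

/-- `ẽ_i` on the tensor product. -/
def tensorE {N k l : ℕ} [NeZero N] (i : Fin N) (b : Crystal N k × Crystal N l) :
    Option (Crystal N k × Crystal N l) :=
  if eps i b.2 ≤ phi i b.1 then (e i b.1).map fun x => (x, b.2)
  else (e i b.2).map fun y => (b.1, y)

/-- `f̃_i` on the tensor product. -/
def tensorF {N k l : ℕ} [NeZero N] (i : Fin N) (b : Crystal N k × Crystal N l) :
    Option (Crystal N k × Crystal N l) :=
  if eps i b.2 < phi i b.1 then (f i b.1).map fun x => (x, b.2)
  else (f i b.2).map fun y => (b.1, y)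

/-- `R` is an isomorphism of crystals `B_k ⊗ B_l → B_l ⊗ B_k`: a bijection that commutes with all
Kashiwara operators. -/
def IsIso {N k l : ℕ} [NeZero N] (R : Crystal N k × Crystal N l → Crystal N l × Crystal N k) :
    Prop :=
  Function.Bijective R ∧
    ∀ i b, tensorE i (R b) = (tensorE i b).map R ∧ tensorF i (R b) = (tensorF i b).map R

open Classical in
/-- The combinatorial `R` matrix `B_k ⊗ B_l → B_l ⊗ B_k`: the isomorphism of crystals (which exists
and is unique; the `else` branch never occurs). -/
noncomputable def combR {N : ℕ} [NeZero N] (k l : ℕ) :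
    Crystal N k × Crystal N l → Crystal N l × Crystal N k :=
  if h : ∃ R : Crystal N k × Crystal N l → Crystal N l × Crystal N k, IsIso R then h.choose
  else Prod.swap

/-- The word `m_k + 1, …, m_1 + 1` in the letters of `A^{(1)}_M` attached to the tableau
`m_1 ≤ … ≤ m_k` in `B'_k`. -/
def word {M k : ℕ} (b : Crystal M k) : List (Fin (M + 1)) :=
  (((List.finRange M).flatMap fun i => List.replicate (b.mult i) i).reverse).map Fin.succ

end Crystal

/-- A state of the automaton, `⋯ ⊗ B_θ ⊗ B_θ ⊗ ⋯` on the two-sided infinite lattice. -/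
abbrev BoxState (M θ : ℕ) : Type := ℤ → Crystal (M + 1) θ

/-- The `B_1`-array on `ℤ` that carries the word `w` from position `a` on, and the letter `1`
(index `0`) everywhere else. -/
def letterAt {M : ℕ} (a : ℤ) (w : List (Fin (M + 1))) (x : ℤ) : Fin (M + 1) :=
  if a ≤ x then w.getD (x - a).toNat 0 else 0

/-- The map that groups a `B_1`-array into cells of capacity `θ`, cell `n` receiving the positions
`n θ, …, n θ + θ - 1`, and sorts the letters in each cell. -/
def groupCells {M : ℕ} (θ : ℕ) (w : ℤ → Fin (M + 1)) : BoxState M θ := fun n =>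
  ⟨fun i => (Finset.univ.filter fun j : Fin θ => w (n * θ + (j : ℕ)) = i).card, by
    have h := Finset.card_eq_sum_card_fiberwise (s := (Finset.univ : Finset (Fin θ)))
      (t := (Finset.univ : Finset (Fin (M + 1)))) (f := fun j : Fin θ => w (n * θ + (j : ℕ)))
      (fun _ _ => Finset.mem_coe.2 (Finset.mem_univ _))
    simpa using h.symm⟩

/-- The one-soliton state with label `b ∈ B'_l` (amplitude `l`) that starts at position `a`. -/
def oneSoliton {M l : ℕ} (θ : ℕ) (a : ℤ) (b : Crystal M l) : BoxState M θ :=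
  groupCells θ (letterAt a b.word)

/-- The state `ι_{i,j}(b ⊗ c)`, `b ∈ B'_i`, `c ∈ B'_j`: the first soliton starts at position `a`,
and `L` letters `1` stand between the two solitons. -/
def twoSoliton {M i j : ℕ} (θ : ℕ) (a : ℤ) (L : ℕ) (b : Crystal M i) (c : Crystal M j) :
    BoxState M θ :=
  groupCells θ (letterAt a (b.word ++ List.replicate L 0 ++ c.word))

/-- The two solitons of `twoSoliton θ a L b c`, where the first has amplitude `i`, are at a distance
of at least `D` cells: the first ball of the second one (at position `a + i + L`) lies at least `D`
cells to the right of the last ball of the first one (at position `a + i - 1`). -/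
def SeparatedBy (D θ i : ℕ) (a : ℤ) (L : ℕ) : Prop :=
  (D : ℤ) ≤ (a + i + L) / (θ : ℤ) - (a + i - 1) / (θ : ℤ)

/-- `p` is a two-soliton state with label `b ⊗ c` and distance at least `D`. -/
def IsAsymptotic {M i j θ : ℕ} (D : ℕ) (bc : Crystal M i × Crystal M j) (p : BoxState M θ) :
    Prop :=
  ∃ (a : ℤ) (L : ℕ), SeparatedBy D θ i a L ∧ p = twoSoliton θ a L bc.1 bc.2

/-- `p'` results from `p` by sending a carrier of capacity `κ` through the lattice from left to
right: `R : v_n ⊗ p_n ↦ p'_n ⊗ v_{n+1}` for all `n`, where the carrier is in the state `u_κ` far to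
the left and far to the right. -/
def IsEvolution {M θ : ℕ} (κ : ℕ) (p p' : BoxState M θ) : Prop :=
  ∃ v : ℤ → Crystal (M + 1) κ,
    {n | v n ≠ Crystal.vac (M + 1) κ}.Finite ∧
      ∀ n, Crystal.combR κ θ (v n, p n) = (p' n, v (n + 1))

open Classical in
/-- The time evolution `T_κ`.  (Every state with finitely many cells different from `u_θ` has exactly
one image; the value for other states is irrelevant.) -/
noncomputable def timeEvolution {M θ : ℕ} (κ : ℕ) (p : BoxState M θ) : BoxState M θ :=
  if h : ∃ p', IsEvolution κ p p' then h.choose else p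

/-- `S` describes the scattering, under `T_κ` on cells of capacity `θ`, of a soliton of amplitude `i`
on the left with a soliton of amplitude `j` on the right: if the state with label `b ⊗ c` has
distance at least `D`, then the solitons finally emerge in the opposite order with label
`S (b ⊗ c)`, and their distance tends to infinity. -/
def IsScatteringMatrix {M i j : ℕ} (θ κ D : ℕ)
    (S : Crystal M i × Crystal M j → Crystal M j × Crystal M i) : Prop :=
  ∀ (bc : Crystal M i × Crystal M j) (p : BoxState M θ), IsAsymptotic D bc p →
    ∀ D' : ℕ, ∃ t₀ : ℕ, ∀ t ≥ t₀, IsAsymptotic D' (S bc) ((timeEvolution κ)^[t] p)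

/-- `x` is the coordinate of the state `p`: if `n` is the first cell different from `u_θ` and `s` the
number of letters other than `1` in it, then `x = (n + 1) θ - s`. -/
def IsCoordinate {M θ : ℕ} (p : BoxState M θ) (x : ℤ) : Prop :=
  ∃ n : ℤ, (∀ j < n, p j = Crystal.vac (M + 1) θ) ∧ p n ≠ Crystal.vac (M + 1) θ ∧
    x = (n + 1) * θ - (θ - (p n).mult 0 : ℤ)

/-- Every soliton of amplitude `l` (alone on the lattice) has velocity `v` under `T_κ`. -/
def HasVelocity (M θ κ l : ℕ) (v : ℤ) : Prop :=
  ∀ (b : Crystal M l) (a x : ℤ), IsCoordinate (oneSoliton θ a b) x →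
    IsCoordinate (timeEvolution κ (oneSoliton θ a b)) (x + v)

/-- Two solitons of amplitudes `i` (left) and `j` (right) at distance at least `D` do not interact:
both keep their labels and move with the constant velocity `v` forever. -/
def NoScattering (M θ κ D i j : ℕ) (v : ℤ) : Prop :=
  ∀ (b : Crystal M i) (c : Crystal M j) (a : ℤ) (L : ℕ), SeparatedBy D θ i a L →
    ∀ t : ℕ, (timeEvolution κ)^[t] (twoSoliton θ a L b c) = twoSoliton θ (a + t * v) L b c

/-! The evolutions `T_κ` for all capacities `κ` commute with one another (Yang–Baxter) and are
injective on states with finitely many nonempty cells. Call two states related if suitable products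
of evolutions send them to the same state (`FiniteState.Related`); this is an equivalence relation,
and it is enough to prove scattering up to this relation.

A soliton is described by its label and a phase `X`, measured on a scale that grows by `min θ i` per
cell for amplitude `i`. As long as two solitons are apart, `T_κ` adds `min κ i` and `min κ j` to
their phases (`IsApart.evolve`). Since `i ≠ j`, comparing different `κ` moves one phase while the
other stays, so all states with given labels and a given order of the solitons are related
(`IsApart.related`).

Hence one explicit collision suffices to relate the two orders. It is computed on an inhomogeneous
lattice whose cells in front of cell 3 hold `k + l` letters, where each soliton fits into a single
cell. With a carrier of capacity `k` the collision in one cell is the queue algorithm for `R'`, up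
to the winding `h` of that queue, which is absorbed by the phases (`IsCollision.combR_eq`,
`IsCollision.evolution_collide`). The evolutions still act on the wide lattice when the solitons
have moved to cells `≥ 3`, where it agrees with the homogeneous one; as carriers run from left to
right, the relation passes to the homogeneous lattice (`Agree.related`, `related_scattered`).

Relatedness turns into dynamics when the final order is the one in which the distance grows: the
evolutions that witness the relation commute with `T_κ^t` and cancel by injectivity, so `T_κ^t` of
the given state is exactly a separated pair for large `t` (`eventually_pair`). Which soliton is
faster decides between (I) and (II), and the two statements rest on the same relation. In case (III)
both solitons advance by the same number of positions per step, so a separated pair stays separated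
and only free motion is needed. The uniqueness of the scattering matrix holds because a state with
separated solitons determines their labels (`IsAsymptotic.unique`).

The existence of `R` comes from the queue algorithm; its uniqueness and the Yang–Baxter equation
come from connectedness of tensor products, in the form that one fixed sequence of raising operators
sends every element to the same element. -/

/-! ### Raising operators, tensor products and uniqueness of morphisms -/

/-- A family of partial raising operators on a set, with the string lengths `ε` and `φ`. -/
structure RaisingCrystal (I X : Type*) where
  e : I → X → Option X
  eps : I → X → ℕ
  phi : I → X → ℕ
  e_eq_none : ∀ i x, e i x = none ↔ eps i x = 0
  eps_e : ∀ i x y, e i x = some y → eps i x = eps i y + 1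
  phi_e : ∀ i x y, e i x = some y → phi i y = phi i x + 1
  e_inj : ∀ i x y z, e i x = some z → e i y = some z → x = y

namespace RaisingCrystal

variable {I X Y Z : Type*}

/-- The tensor product rule. -/
def tensor (C : RaisingCrystal I X) (D : RaisingCrystal I Y) : RaisingCrystal I (X × Y) where
  e i p := if D.eps i p.2 ≤ C.phi i p.1 then (C.e i p.1).map fun x => (x, p.2)
    else (D.e i p.2).map fun y => (p.1, y)
  eps i p := C.eps i p.1 + (D.eps i p.2 - C.phi i p.1)
  phi i p := D.phi i p.2 + (C.phi i p.1 - D.eps i p.2)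
  e_eq_none i p := by
    split_ifs with h
    · simp only [Option.map_eq_none_iff, C.e_eq_none]; omega
    · simp only [Option.map_eq_none_iff, D.e_eq_none]; omega
  eps_e i p q := by
    split_ifs with h
    · simp only [Option.map_eq_some_iff]
      rintro ⟨x, hx, rfl⟩
      have := C.eps_e _ _ _ hx; have := C.phi_e _ _ _ hx
      dsimp only; omega
    · simp only [Option.map_eq_some_iff]
      rintro ⟨x, hx, rfl⟩
      have := D.eps_e _ _ _ hx; have := D.phi_e _ _ _ hx
      dsimp only; omega
  phi_e i p q := by
    split_ifs with h
    · simp only [Option.map_eq_some_iff]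
      rintro ⟨x, hx, rfl⟩
      have := C.eps_e _ _ _ hx; have := C.phi_e _ _ _ hx
      dsimp only; omega
    · simp only [Option.map_eq_some_iff]
      rintro ⟨x, hx, rfl⟩
      have := D.eps_e _ _ _ hx; have := D.phi_e _ _ _ hx
      dsimp only; omega
  e_inj i p q r := by
    obtain ⟨p1, p2⟩ := p
    obtain ⟨q1, q2⟩ := q
    dsimp only
    split_ifs with h h' h' <;> simp only [Option.map_eq_some_iff] <;>
      rintro ⟨x, hx, rfl⟩ ⟨y, hy, hxy⟩ <;> simp only [Prod.mk.injEq] at hxy <;>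
      obtain ⟨rfl, rfl⟩ := hxy
    · rw [C.e_inj _ _ _ _ hx hy]
    -- The mixed cases cannot occur: raising one factor moves `φ` or `ε` by one, which contradicts
    -- the choice of factor made for the other preimage.
    · have := C.phi_e _ _ _ hx; have := D.eps_e _ _ _ hy; omega
    · have := C.phi_e _ _ _ hy; have := D.eps_e _ _ _ hx; omega
    · rw [D.e_inj _ _ _ _ hx hy]

/-- A map that commutes with the raising operators and preserves the string lengths. -/
structure IsHom (C : RaisingCrystal I X) (D : RaisingCrystal I Y) (F : X → Y) : Prop where
  e : ∀ i x, D.e i (F x) = (C.e i x).map F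
  eps : ∀ i x, D.eps i (F x) = C.eps i x
  phi : ∀ i x, D.phi i (F x) = C.phi i x

variable {C : RaisingCrystal I X} {D : RaisingCrystal I Y} {E : RaisingCrystal I Z}

theorem IsHom.comp {F : X → Y} {G : Y → Z} (hG : IsHom D E G) (hF : IsHom C D F) :
    IsHom C E (G ∘ F) where
  e i x := by simp [hG.e, hF.e]
  eps i x := by simp [hG.eps, hF.eps]
  phi i x := by simp [hG.phi, hF.phi]

theorem IsHom.prodMap_id {F : X → Y} (hF : IsHom C D F) :
    IsHom (C.tensor E) (D.tensor E) (Prod.map F id) where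
  e i x := by
    simp only [tensor, Prod.map, hF.e, hF.phi, id]
    split_ifs <;> simp [Option.map_map, Function.comp_def]
  eps i x := by simp [tensor, hF.eps, hF.phi]
  phi i x := by simp [tensor, hF.phi]

theorem IsHom.id_prodMap {F : X → Y} (hF : IsHom C D F) :
    IsHom (E.tensor C) (E.tensor D) (Prod.map id F) where
  e i x := by
    simp only [tensor, Prod.map, hF.e, hF.eps, id]
    split_ifs <;> simp [Option.map_map, Function.comp_def]
  eps i x := by simp [tensor, hF.eps]
  phi i x := by simp [tensor, hF.eps, hF.phi]

theorem isHom_assoc (C : RaisingCrystal I X) (D : RaisingCrystal I Y) (E : RaisingCrystal I Z) :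
    IsHom ((C.tensor D).tensor E) (C.tensor (D.tensor E)) (Equiv.prodAssoc X Y Z) where
  e i x := by
    obtain ⟨⟨x, y⟩, z⟩ := x
    simp only [tensor, Equiv.prodAssoc_apply]
    split_ifs <;> first
      | omega
      | simp [Option.map_map, Function.comp_def]
  eps i x := by
    simp only [tensor, Equiv.prodAssoc_apply]; omega
  phi i x := by
    simp only [tensor, Equiv.prodAssoc_apply]; omega

theorem IsHom.symm {F : X ≃ Y} (hF : IsHom C D F) : IsHom D C F.symm where
  e i y := by
    have := hF.e i (F.symm y)
    rw [F.apply_symm_apply] at this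
    rw [this, Option.map_map]
    simp
  eps i y := by simpa using (hF.eps i (F.symm y)).symm
  phi i y := by simpa using (hF.phi i (F.symm y)).symm

/-- The raising operator, made total by fixing the elements on which it vanishes. -/
def raise (C : RaisingCrystal I X) (i : I) (x : X) : X := (C.e i x).getD x

/-- Apply the raising operators in the list one after the other, each of them `n` times. -/
def sweep (C : RaisingCrystal I X) (n : ℕ) (L : List I) (x : X) : X :=
  L.foldl (fun x i => (C.raise i)^[n] x) x

theorem sweep_append (n : ℕ) (L L' : List I) (x : X) :
    C.sweep n (L ++ L') x = C.sweep n L' (C.sweep n L x) := by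
  simp [sweep, List.foldl_append]

theorem map_raise {F : X → Y} (hF : ∀ i x, D.e i (F x) = (C.e i x).map F) (i : I) (x : X) :
    F (C.raise i x) = D.raise i (F x) := by
  simp only [raise, hF]
  cases C.e i x <;> simp

theorem map_sweep {F : X → Y} (hF : ∀ i x, D.e i (F x) = (C.e i x).map F) (n : ℕ) (L : List I)
    (x : X) : F (C.sweep n L x) = D.sweep n L (F x) := by
  induction L generalizing x with
  | nil => rfl
  | cons i L ih =>
    have h : F ((C.raise i)^[n] x) = (D.raise i)^[n] (F x) :=
      Function.Semiconj.iterate_right (f := F) (fun x => map_raise hF i x) n x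
    simpa [sweep, h] using ih ((C.raise i)^[n] x)

/-- Both maps send `c` to `d`. Equality then travels backwards along the sweep, because `e` is
injective where it does not vanish and a vanishing step changes nothing. -/
theorem eq_of_sweep_eq {F G : X → Y} (hF : ∀ i x, D.e i (F x) = (C.e i x).map F)
    (hG : ∀ i x, D.e i (G x) = (C.e i x).map G) {n : ℕ} {L : List I} {c : X} {d : Y}
    (hc : ∀ x, C.sweep n L x = c) (hd : ∀ y, D.sweep n L y = d) : F = G := by
  have top : ∀ {H : X → Y}, (∀ i x, D.e i (H x) = (C.e i x).map H) → H c = d := by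
    intro H hH
    rw [← hc c, map_sweep hH, hd]
  have one : ∀ i x, F (C.raise i x) = G (C.raise i x) → F x = G x := by
    intro i x h
    unfold raise at h
    rcases hx : C.e i x with _ | y
    · simpa [hx] using h
    · rw [hx, Option.getD_some] at h
      refine D.e_inj i _ _ (F y) ?_ ?_
      · rw [hF, hx]; rfl
      · rw [hG, hx, h]; rfl
  have iter : ∀ n i x, F ((C.raise i)^[n] x) = G ((C.raise i)^[n] x) → F x = G x := by
    intro n i
    induction n with
    | zero => exact fun x h => h
    | succ n ih => exact fun x h => one i x (ih _ h)
  have all : ∀ (L : List I) x, F (C.sweep n L x) = G (C.sweep n L x) → F x = G x := by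
    intro L
    induction L with
    | nil => exact fun x h => h
    | cons i L ih => exact fun x h => iter n i x (ih _ h)
  funext x
  exact all L x (by rw [hc, top hF, top hG])

theorem eps_iterate_raise (i : I) (n : ℕ) (x : X) :
    C.eps i ((C.raise i)^[n] x) = C.eps i x - n := by
  induction n with
  | zero => rfl
  | succ n ih =>
    rw [Function.iterate_succ_apply']
    unfold raise at ih ⊢
    rcases h : C.e i ((fun x => (C.e i x).getD x)^[n] x) with _ | y
    · rw [C.e_eq_none] at h; simp only [Option.getD_none]; omega
    · have := C.eps_e _ _ _ h; simp only [Option.getD_some]; omega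

theorem iterate_raise_of_le {i : I} {x : X} {m n : ℕ} (hm : C.eps i x ≤ m) (hmn : m ≤ n) :
    (C.raise i)^[n] x = (C.raise i)^[m] x := by
  induction n, hmn using Nat.le_induction with
  | base => rfl
  | succ n hn ih =>
    rw [Function.iterate_succ_apply', ih]
    have : C.e i ((C.raise i)^[m] x) = none := by
      rw [C.e_eq_none, eps_iterate_raise]; omega
    rw [raise, this]; rfl

/-- The last clause records the order in which the factors are raised: if `φ` of the first factor is
zero, the first factor is touched only after the second one is exhausted. -/
theorem iterate_raise_tensor (C : RaisingCrystal I X) (D : RaisingCrystal I Y) (i : I) (n : ℕ)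
    (x : X) (y : Y) : ∃ j k, j ≤ n ∧ k ≤ n ∧
      ((C.tensor D).raise i)^[n] (x, y) = ((C.raise i)^[j] x, (D.raise i)^[k] y) ∧
      (C.phi i x = 0 → j = 0 ∨ D.eps i ((D.raise i)^[k] y) = 0) := by
  induction n with
  | zero => exact ⟨0, 0, le_rfl, le_rfl, rfl, fun _ => .inl rfl⟩
  | succ n ih =>
    obtain ⟨j, k, hj, hk, h, h'⟩ := ih
    rw [Function.iterate_succ_apply', h]
    by_cases hc : D.eps i ((D.raise i)^[k] y) ≤ C.phi i ((C.raise i)^[j] x)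
    · refine ⟨j + 1, k, by omega, by omega, ?_, fun hx => ?_⟩
      · rw [Function.iterate_succ_apply']
        simp only [raise, tensor] at hc ⊢
        rw [if_pos hc]
        rcases C.e i ((fun x => (C.e i x).getD x)^[j] x) with _ | z <;> simp
      · right
        rcases h' hx with rfl | h0
        · simpa [hx] using hc
        · exact h0
    · refine ⟨j, k + 1, by omega, by omega, ?_, fun hx => ?_⟩
      · rw [Function.iterate_succ_apply' (D.raise i)]
        simp only [raise, tensor] at hc ⊢
        rw [if_neg hc]
        rcases D.e i ((fun x => (D.e i x).getD x)^[k] y) with _ | z <;> simp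
      · rcases h' hx with rfl | h0
        · exact .inl rfl
        · exact absurd (h0 ▸ Nat.zero_le _) hc

/-- Exhausting the string of the product exhausts in particular the string of the first factor, and
further raising has no effect on it. -/
theorem iterate_raise_tensor_fst {i : I} {n : ℕ} {x : X} {y : Y}
    (hn : (C.tensor D).eps i (x, y) ≤ n) :
    (((C.tensor D).raise i)^[n] (x, y)).1 = (C.raise i)^[n] x := by
  obtain ⟨j, k, hj, hk, h, -⟩ := iterate_raise_tensor C D i n x y
  have h0 := eps_iterate_raise (C := C.tensor D) i n (x, y)
  rw [h] at h0 ⊢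
  simp only [tensor] at h0 hn
  rw [eps_iterate_raise] at h0
  exact (iterate_raise_of_le (by omega) hj).symm

theorem iterate_raise_tensor_of_phi {i : I} {n : ℕ} {x : X} {y : Y}
    (hn : (C.tensor D).eps i (x, y) ≤ n) (hx : C.phi i x = 0) :
    ((C.tensor D).raise i)^[n] (x, y) = ((C.raise i)^[n] x, (D.raise i)^[n] y) := by
  obtain ⟨j, k, hj, hk, h, h'⟩ := iterate_raise_tensor C D i n x y
  have h0 := eps_iterate_raise (C := C.tensor D) i n (x, y)
  rw [h] at h0 ⊢
  simp only [tensor] at h0 hn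
  have hD : D.eps i ((D.raise i)^[k] y) = 0 := by
    rcases h' hx with rfl | h1
    · simp only [Function.iterate_zero, id, hx] at h0; omega
    · exact h1
  rw [eps_iterate_raise] at h0 hD
  rw [iterate_raise_of_le (C := C) (by omega) hj, iterate_raise_of_le (C := D) (by omega) hk]

theorem sweep_tensor_fst {n : ℕ} (hn : ∀ i p, (C.tensor D).eps i p ≤ n) (L : List I) (p : X × Y) :
    ((C.tensor D).sweep n L p).1 = C.sweep n L p.1 := by
  induction L generalizing p with
  | nil => rfl
  | cons i L ih =>
    have h := ih (((C.tensor D).raise i)^[n] p)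
    rw [iterate_raise_tensor_fst (y := p.2) (hn _ _)] at h
    exact h

/-- The string lengths `φ` of the operators in the list vanish at the moment of their application. -/
def PhiVanish (C : RaisingCrystal I X) (n : ℕ) : List I → X → Prop
  | [], _ => True
  | i :: L, x => C.phi i x = 0 ∧ PhiVanish C n L ((C.raise i)^[n] x)

theorem sweep_tensor_of_phiVanish {n : ℕ} (hn : ∀ i p, (C.tensor D).eps i p ≤ n) {L : List I}
    {x : X} (hx : C.PhiVanish n L x) (y : Y) :
    (C.tensor D).sweep n L (x, y) = (C.sweep n L x, D.sweep n L y) := by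
  induction L generalizing x y with
  | nil => rfl
  | cons i L ih =>
    have h := ih hx.2 ((D.raise i)^[n] y)
    rw [← iterate_raise_tensor_of_phi (hn _ _) hx.1] at h
    exact h

/-- If the list `L` sweeps `X` to `c` with vanishing `φ` when it starts at `c`, and `L'` sweeps `Y`
to `d`, then `L ++ L'` sweeps `X ⊗ Y` to `c ⊗ d`, provided that `L'` is a power of `L`. -/
theorem sweep_tensor_const {n : ℕ} (hn : ∀ i p, (C.tensor D).eps i p ≤ n) {L L' : List I}
    {c : X} {d : Y} (hc : ∀ x, C.sweep n L x = c) (hL' : C.sweep n L' c = c)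
    (hphi : C.PhiVanish n L' c) (hd : ∀ y, D.sweep n L' y = d) (p : X × Y) :
    (C.tensor D).sweep n (L ++ L') p = (c, d) := by
  rw [sweep_append]
  have h : (C.tensor D).sweep n L p = (c, ((C.tensor D).sweep n L p).2) :=
    Prod.ext (by rw [sweep_tensor_fst hn, hc]) rfl
  rw [h, sweep_tensor_of_phiVanish hn hphi, hL', hd]

theorem PhiVanish.append {n : ℕ} {L L' : List I} {x : X} (h : C.PhiVanish n L x)
    (h' : C.PhiVanish n L' (C.sweep n L x)) : C.PhiVanish n (L ++ L') x := by
  induction L generalizing x with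
  | nil => exact h'
  | cons i L ih => exact ⟨h.1, ih h.2 h'⟩

end RaisingCrystal

/-! ### Single-row crystals: every element is swept to the same element -/

namespace Crystal

variable {N k l : ℕ}

theorem ext {b b' : Crystal N k} (h : ∀ i, b.mult i = b'.mult i) : b = b' := Subtype.ext (funext h)

theorem sum_mult (b : Crystal N k) : ∑ i, b.mult i = k := b.2

@[simp] theorem mult_mk (f : Fin N → ℕ) (h : ∑ i, f i = k) :
    mult (⟨f, h⟩ : Crystal N k) = f := rfl

theorem mult_le (b : Crystal N k) (i : Fin N) : b.mult i ≤ k :=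
  (Finset.single_le_sum (f := b.mult) (fun _ _ => Nat.zero_le _) (Finset.mem_univ i)).trans_eq
    b.sum_mult

theorem move_eq_none_iff {a c : Fin N} {b : Crystal N k} : move a c b = none ↔ b.mult a = 0 := by
  constructor
  · intro h
    by_contra h0
    have hd : move a c b = some _ := dif_pos (Nat.pos_of_ne_zero h0)
    rw [h] at hd
    cases hd
  · intro h
    exact dif_neg (show ¬ 0 < b.mult a by omega)

theorem move_eq_some_iff {a c : Fin N} {b b' : Crystal N k} :
    move a c b = some b' ↔ 0 < b.mult a ∧
      ∀ m, b'.mult m + (if m = a then 1 else 0) = b.mult m + (if m = c then 1 else 0) := by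
  by_cases h : 0 < b.mult a
  · obtain ⟨z, hz, hzm⟩ : ∃ z, move a c b = some z ∧
        ∀ m, z.mult m = (b.mult m - if m = a then 1 else 0) + if m = c then 1 else 0 :=
      ⟨_, dif_pos h, fun m => rfl⟩
    have hzm' : ∀ m, z.mult m + (if m = a then 1 else 0) =
        b.mult m + (if m = c then 1 else 0) := by
      intro m
      have := hzm m
      by_cases hm : m = a
      · subst hm; rw [if_pos rfl] at this ⊢; omega
      · rw [if_neg hm] at this ⊢; omega
    rw [hz, Option.some.injEq]
    constructor
    · rintro rfl
      exact ⟨h, hzm'⟩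
    · rintro ⟨-, h'⟩
      exact ext fun m => by have := h' m; have := hzm' m; omega
  · rw [move_eq_none_iff.2 (by omega)]
    simp [h]

theorem sub_one_ne [NeZero N] (hN : 2 ≤ N) (i : Fin N) : i - 1 ≠ i := by
  obtain ⟨n, rfl⟩ : ∃ n, N = n + 2 := ⟨N - 2, by omega⟩
  intro h
  simp at h

/-- The crystal `B_k` with at least two letters. -/
def raising (N k : ℕ) [NeZero N] (hN : 2 ≤ N) : RaisingCrystal (Fin N) (Crystal N k) where
  e := e
  eps := eps
  phi := phi
  e_eq_none i x := move_eq_none_iff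
  eps_e i x y h := by
    have := (move_eq_some_iff.1 h).2 i
    simp only [if_true, (sub_one_ne hN i).symm, if_false] at this
    exact this.symm
  phi_e i x y h := by
    have := (move_eq_some_iff.1 h).2 (i - 1)
    simp only [if_true, sub_one_ne hN i, if_false] at this
    exact this
  e_inj i x y z hx hy := by
    have hx := (move_eq_some_iff.1 hx).2
    have hy := (move_eq_some_iff.1 hy).2
    exact ext fun m => by have := hx m; have := hy m; omega

theorem tensorE_eq [NeZero N] (hN : 2 ≤ N) (i : Fin N) (b : Crystal N k × Crystal N l) :
    tensorE i b = ((raising N k hN).tensor (raising N l hN)).e i b := rfl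

theorem iterate_raise_apply [NeZero N] (hN : 2 ≤ N) (i : Fin N) (n : ℕ) (b : Crystal N k)
    (m : Fin N) : (((raising N k hN).raise i)^[n] b).mult m + (if m = i then min n (b.mult i) else 0) =
      b.mult m + if m = i - 1 then min n (b.mult i) else 0 := by
  induction n with
  | zero => simp
  | succ n ih =>
    rw [Function.iterate_succ_apply']
    set z := ((raising N k hN).raise i)^[n] b with hz
    have hzi : z.mult i = b.mult i - n :=
      RaisingCrystal.eps_iterate_raise (C := raising N k hN) i n b
    rcases h : (raising N k hN).e i z with _ | y
    · have h0 : z.mult i = 0 := ((raising N k hN).e_eq_none i z).1 h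
      rw [RaisingCrystal.raise, h, Option.getD_none]
      rw [min_eq_right (show b.mult i ≤ n + 1 by omega), min_eq_right (show b.mult i ≤ n by omega)] at *
      exact ih
    · rw [RaisingCrystal.raise, h, Option.getD_some]
      obtain ⟨h1, h2⟩ := move_eq_some_iff.1 h
      have := h2 m
      split_ifs at * <;> omega

/-- The letter treated by step `t` of a sweep. -/
def sweepLetter (N : ℕ) [NeZero N] (t : ℕ) : Fin N :=
  ⟨N - 1 - t, by have := NeZero.pos N; omega⟩

/-- The letters in decreasing order. -/
def sweepList (N : ℕ) [NeZero N] : List (Fin N) := (List.range N).map (sweepLetter N)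

/-- The row that consists of the letter `i` only. -/
def const (N k : ℕ) (i : Fin N) : Crystal N k := ⟨Pi.single i k, by simp⟩

theorem eq_const {b : Crystal N k} {i : Fin N} (h : ∀ m ≠ i, b.mult m = 0) : b = const N k i := by
  have hi : b.mult i = k := by
    have := b.sum_mult
    rwa [Finset.sum_eq_single i (fun m _ hm => h m hm) (by simp)] at this
  refine ext fun m => ?_
  by_cases hm : m = i
  · subst hm; simp [const, hi]
  · simp [const, hm, h m hm]

theorem val_sub_one [NeZero N] (i : Fin N) (hi : i.1 ≠ 0) : (i - 1).1 = i.1 - 1 :=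
  Fin.val_sub_one_of_ne_zero (fun h => hi (by simp [h]))

theorem val_sub_one_of_zero [NeZero N] (i : Fin N) (hi : i.1 = 0) : (i - 1).1 = N - 1 := by
  obtain ⟨n, rfl⟩ : ∃ n, N = n + 1 := ⟨N - 1, by have := NeZero.pos N; omega⟩
  have : i = 0 := Fin.ext hi
  subst this
  simp

theorem sweep_range_apply [NeZero N] (hN : 2 ≤ N) {n : ℕ} (hn : k ≤ n) (b : Crystal N k) (t : ℕ)
    (ht : t ≤ N - 1) (m : Fin N) (hm : N - t ≤ m.1) :
    ((raising N k hN).sweep n ((List.range t).map (sweepLetter N)) b).mult m = 0 := by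
  induction t with
  | zero => have := m.2; omega
  | succ t ih =>
    rw [List.range_succ, List.map_append, RaisingCrystal.sweep_append]
    set z := (raising N k hN).sweep n ((List.range t).map (sweepLetter N)) b with hz
    have h := iterate_raise_apply hN (sweepLetter N t) n z m
    have hle := mult_le z (sweepLetter N t)
    have hv := val_sub_one (sweepLetter N t) (by simp only [sweepLetter]; omega)
    have hv' : (sweepLetter N t).1 = N - 1 - t := rfl
    rw [min_eq_right (hle.trans hn)] at h
    have hm1 : m ≠ sweepLetter N t - 1 := by
      intro h'; rw [h', hv, hv'] at hm; omega
    rw [if_neg hm1] at h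
    change (((raising N k hN).raise (sweepLetter N t))^[n] z).mult m = 0
    by_cases hm2 : m = sweepLetter N t
    · subst hm2; simp only [if_true] at h; omega
    · have := ih (by omega) (by have : m.1 ≠ N - 1 - t := fun h' => hm2 (Fin.ext h'); omega)
      rw [if_neg hm2] at h; omega

theorem raise_const [NeZero N] (hN : 2 ≤ N) {n : ℕ} (hn : k ≤ n) (i : Fin N) :
    ((raising N k hN).raise i)^[n] (const N k i) = const N k (i - 1) := by
  refine eq_const fun m hm => ?_
  have h := iterate_raise_apply hN i n (const N k i) m
  rw [if_neg hm] at h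
  by_cases hi : m = i
  · subst hi
    simp [const, hn] at h; exact h
  · simpa [const, hi] using h

/-- Raising the letters `N - 1, …, 1` to the end collects all letters in `0`. The additional last
step at `0` moves them to the letter `0 - 1`, so that the sweep can be repeated from where it ends.
-/
theorem sweepList_sweep [NeZero N] (hN : 2 ≤ N) {n : ℕ} (hn : k ≤ n) (b : Crystal N k) :
    (raising N k hN).sweep n (sweepList N) b = const N k (0 - 1) := by
  have h0 : (raising N k hN).sweep n ((List.range (N - 1)).map (sweepLetter N)) b =
      const N k 0 := by
    refine eq_const fun m hm => sweep_range_apply hN hn b (N - 1) le_rfl m ?_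
    have : m.1 ≠ 0 := fun h => hm (Fin.ext (by simpa using h))
    omega
  have h1 : sweepLetter N (N - 1) = 0 := Fin.ext (by simp [sweepLetter])
  unfold sweepList
  obtain ⟨n', hn'⟩ : ∃ n', N = n' + 1 := ⟨N - 1, by omega⟩
  have h2 : List.range N = List.range (N - 1) ++ [N - 1] := by
    rw [← List.range_succ]; congr 1; omega
  rw [h2, List.map_append, RaisingCrystal.sweep_append, h0]
  change ((raising N k hN).raise (sweepLetter N (N - 1)))^[n] _ = _
  rw [h1, raise_const hN hn]

theorem phi_const [NeZero N] (hN : 2 ≤ N) (i : Fin N) :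
    (raising N k hN).phi i (const N k i) = 0 := by
  simp [raising, phi, const, sub_one_ne hN i]

/-- On the second round the row always consists of the letter that is about to be raised, so there
is no letter just below it and `φ` vanishes. -/
theorem phiVanish_sweepList [NeZero N] (hN : 2 ≤ N) {n : ℕ} (hn : k ≤ n) :
    (raising N k hN).PhiVanish n (sweepList N) (const N k (0 - 1)) := by
  have key : ∀ t ≤ N, (raising N k hN).PhiVanish n ((List.range t).map (sweepLetter N))
        (const N k (0 - 1)) ∧
      (t < N → (raising N k hN).sweep n ((List.range t).map (sweepLetter N)) (const N k (0 - 1)) =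
        const N k (sweepLetter N t)) := by
    intro t
    induction t with
    | zero =>
      refine fun _ => ⟨trivial, fun _ => ?_⟩
      change const N k (0 - 1) = _
      congr 1
      exact Fin.ext (by rw [val_sub_one_of_zero _ (by simp)]; simp [sweepLetter])
    | succ t ih =>
      intro ht
      obtain ⟨h1, h2⟩ := ih (by omega)
      have h2 := h2 (by omega)
      rw [List.range_succ, List.map_append]
      refine ⟨h1.append ?_, fun ht' => ?_⟩
      · rw [h2]; exact ⟨phi_const hN _, trivial⟩
      · rw [RaisingCrystal.sweep_append, h2]
        change ((raising N k hN).raise (sweepLetter N t))^[n] _ = _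
        rw [raise_const hN hn]
        congr 1
        refine Fin.ext ?_
        rw [val_sub_one _ (by simp only [sweepLetter]; omega)]
        simp only [sweepLetter]; omega
  exact (key N le_rfl).1

theorem tensor_eps_le [NeZero N] (hN : 2 ≤ N) (i : Fin N) (p : Crystal N k × Crystal N l) :
    ((raising N k hN).tensor (raising N l hN)).eps i p ≤ k + l := by
  have h1 := mult_le p.1 i
  have h2 := mult_le p.2 i
  simp only [RaisingCrystal.tensor, raising, eps]
  omega

/-- The first round brings the first factor to its end point. During the second round this factor
runs around a closed cycle with `φ = 0`, so the second factor is swept as if it were alone. -/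
theorem sweep_pair [NeZero N] (hN : 2 ≤ N) {n : ℕ} (hn : k + l ≤ n)
    (p : Crystal N k × Crystal N l) :
    ((raising N k hN).tensor (raising N l hN)).sweep n (sweepList N ++ sweepList N) p =
      (const N k (0 - 1), const N l (0 - 1)) :=
  RaisingCrystal.sweep_tensor_const (fun i p => (tensor_eps_le hN i p).trans hn)
    (sweepList_sweep hN (by omega)) (sweepList_sweep hN (by omega) _)
    (phiVanish_sweepList hN (by omega)) (sweepList_sweep hN (by omega)) p

theorem sweep_triple [NeZero N] (hN : 2 ≤ N) {j n : ℕ} (hn : j + (k + l) ≤ n)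
    (p : Crystal N j × Crystal N k × Crystal N l) :
    ((raising N j hN).tensor ((raising N k hN).tensor (raising N l hN))).sweep n
      (sweepList N ++ (sweepList N ++ sweepList N)) p =
      (const N j (0 - 1), const N k (0 - 1), const N l (0 - 1)) := by
  have h1 := sweepList_sweep (k := j) hN (n := n) (by omega)
  refine RaisingCrystal.sweep_tensor_const (fun i p => ?_) h1 ?_ ?_ (sweep_pair hN (by omega)) p
  · have h1 := mult_le p.1 i
    have h2 := tensor_eps_le hN i p.2
    have : ((raising N j hN).tensor ((raising N k hN).tensor (raising N l hN))).eps i p =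
      p.1.mult i + (((raising N k hN).tensor (raising N l hN)).eps i p.2 - p.1.mult (i - 1)) := rfl
    omega
  · rw [RaisingCrystal.sweep_append, h1]
  · refine (phiVanish_sweepList hN (by omega)).append ?_
    rw [h1]
    exact phiVanish_sweepList hN (by omega)

/-- Isomorphisms are unique. -/
theorem IsIso.unique [NeZero N] {R R' : Crystal N k × Crystal N l → Crystal N l × Crystal N k}
    (hR : IsIso R) (hR' : IsIso R') : R = R' := by
  by_cases hN : 2 ≤ N
  · refine RaisingCrystal.eq_of_sweep_eq (C := (raising N k hN).tensor (raising N l hN))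
      (D := (raising N l hN).tensor (raising N k hN)) (n := k + l)
      (fun i x => (hR.2 i x).1) (fun i x => (hR'.2 i x).1) (sweep_pair hN le_rfl)
      (sweep_pair hN (by omega))
  -- For one letter `i - 1 = i` and the raising structure is not available, but the crystals have
  -- only one element.
  · obtain rfl : N = 1 := by have := NeZero.pos N; omega
    funext p
    have : ∀ j, Subsingleton (Crystal 1 j) := fun j => ⟨fun a b => by
      rw [eq_const (b := a) (i := 0) (fun m hm => absurd (Subsingleton.elim _ _) hm),
        eq_const (b := b) (i := 0) (fun m hm => absurd (Subsingleton.elim _ _) hm)]⟩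
    exact Subsingleton.elim _ _

/-! ### The queue algorithm -/

/-- `q` is a periodic solution of the queue recursion for the letters of `y` that look for smaller
letters of `x`. -/
def IsQueue [NeZero N] (x y q : Fin N → ℕ) : Prop := ∀ i, q (i - 1) = (q i - x i) + y i

theorem sum_sub_one [NeZero N] (q : Fin N → ℕ) : ∑ i, q (i - 1) = ∑ i, q i :=
  Equiv.sum_comp (Equiv.subRight (1 : Fin N)) q

theorem IsQueue.sum_min [NeZero N] {x y q : Fin N → ℕ} (h : IsQueue x y q) :
    ∑ i, min (x i) (q i) = ∑ i, y i := by
  have h1 : ∑ i, (q (i - 1) + min (x i) (q i)) = ∑ i, (q i + y i) :=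
    Finset.sum_congr rfl fun i _ => by have := h i; omega
  rw [Finset.sum_add_distrib, Finset.sum_add_distrib, sum_sub_one] at h1
  omega

/-- A supersolution of least total is a solution: one application of the recursion to a strict
supersolution would give another one with a smaller total. -/
theorem exists_isQueue [NeZero N] {x y : Fin N → ℕ} (h : ∑ i, y i ≤ ∑ i, x i) :
    ∃ q, IsQueue x y q := by
  classical
  let P : ℕ → Prop := fun s => ∃ q : Fin N → ℕ, (∀ i, (q i - x i) + y i ≤ q (i - 1)) ∧ ∑ i, q i = s
  have hP : ∃ s, P s := by
    -- This supersolution satisfies the recursion with equality except at `i = 0`, where the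
    -- assumption on the totals is needed.
    refine ⟨_, fun i => ∑ j ∈ Finset.univ.filter (· ≤ i), x j +
      ∑ j ∈ Finset.univ.filter (i < ·), y j, fun i => ?_, rfl⟩
    have hx : Finset.univ.filter (· ≤ i) = insert i (Finset.univ.filter (· < i)) := by
      ext j; simp [le_iff_eq_or_lt]
    have hy : Finset.univ.filter (i ≤ ·) = insert i (Finset.univ.filter (i < ·)) := by
      ext j; simp [le_iff_eq_or_lt, eq_comm]
    have hlhs : ∑ j ∈ Finset.univ.filter (· ≤ i), x j +
        ∑ j ∈ Finset.univ.filter (i < ·), y j - x i + y i =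
        ∑ j ∈ Finset.univ.filter (· < i), x j + ∑ j ∈ Finset.univ.filter (i ≤ ·), y j := by
      rw [hx, hy, Finset.sum_insert (by simp), Finset.sum_insert (by simp)]; ring_nf; omega
    dsimp only
    rw [hlhs]
    by_cases hi : i.1 = 0
    · have h1 : Finset.univ.filter (· < i) = ∅ := by
        ext j; simp [Fin.lt_def, hi]
      have h2 : Finset.univ.filter (i ≤ ·) = Finset.univ := by
        ext j; simp [Fin.le_def, hi]
      have h3 : Finset.univ.filter (· ≤ i - 1) = Finset.univ := by
        ext j; simp only [Fin.le_def, val_sub_one_of_zero i hi]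
        simp only [Finset.mem_filter, Finset.mem_univ, true_and, iff_true]
        have := j.2
        omega
      rw [h1, h2, h3]; simp only [Finset.sum_empty]; omega
    · have h1 : Finset.univ.filter (· < i) = Finset.univ.filter (· ≤ i - 1) := by
        ext j
        simp only [Fin.le_def, val_sub_one i hi, Fin.lt_def, Finset.mem_filter, Finset.mem_univ,
          true_and]
        omega
      have h2 : Finset.univ.filter (i ≤ ·) = Finset.univ.filter (i - 1 < ·) := by
        ext j
        simp only [Fin.le_def, val_sub_one i hi, Fin.lt_def, Finset.mem_filter, Finset.mem_univ,
          true_and]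
        omega
      rw [h1, h2]
  obtain ⟨q, hq, hs⟩ := Nat.find_spec hP
  by_contra hne
  refine Nat.find_min hP (m := ∑ i, ((q (i + 1) - x (i + 1)) + y (i + 1))) ?_
    ⟨fun i => (q (i + 1) - x (i + 1)) + y (i + 1), fun i => ?_, rfl⟩
  · rw [← hs]
    have hle : ∀ i, (q (i + 1) - x (i + 1)) + y (i + 1) ≤ q i := fun i => by
      simpa using hq (i + 1)
    refine Finset.sum_lt_sum (fun i _ => hle i) ?_
    by_contra h'
    push Not at h'
    refine hne ⟨q, fun i => ?_⟩
    have h1 := h' (i - 1) (Finset.mem_univ _)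
    have h2 := hle (i - 1)
    simp only [sub_add_cancel] at h1 h2
    omega
  · have := hq (i + 1)
    simp only [add_sub_cancel_right] at this
    simp only [sub_add_cancel]
    omega

/-- A positive maximal difference of two solutions propagates around the circle and forces `x ≤ q`
everywhere. Then `min x q = x`, and `IsQueue.sum_min` makes the totals of `x` and `y` equal. -/
theorem IsQueue.unique [NeZero N] {x y q q' : Fin N → ℕ} (h : IsQueue x y q) (h' : IsQueue x y q')
    (hs : ∑ i, y i < ∑ i, x i) : q = q' := by
  have mono : ∀ q q' : Fin N → ℕ, IsQueue x y q → IsQueue x y q' → ∀ i, q i ≤ q' i := by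
    intro q q' h h'
    obtain ⟨i0, -, hi0⟩ := Finset.exists_max_image Finset.univ (fun i => (q i : ℤ) - q' i)
      Finset.univ_nonempty
    set d : ℤ := (q i0 : ℤ) - q' i0 with hd
    by_contra! hc
    obtain ⟨j, hj⟩ := hc
    have hdpos : 0 < d := by have := hi0 j (Finset.mem_univ _); omega
    have step : ∀ i, ((q (i - 1) : ℤ) - q' (i - 1) = d) → ((q i : ℤ) - q' i = d) ∧ x i ≤ q i := by
      intro i hi
      have h1 := h i
      have h2 := h' i
      have h3 := hi0 i (Finset.mem_univ _)
      omega
    have all : ∀ n : ℕ, ((q (i0 + Fin.ofNat N n) : ℤ) - q' (i0 + Fin.ofNat N n) = d) := by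
      intro n
      induction n with
      | zero =>
        have : Fin.ofNat N 0 = 0 := rfl
        rw [this, add_zero]
      | succ n ih =>
        refine (step _ ?_).1
        have : Fin.ofNat N (n + 1) = Fin.ofNat N n + 1 := by
          ext; simp [Fin.val_add]
        rwa [this, ← add_assoc, add_sub_cancel_right]
    have all' : ∀ i, ((q i : ℤ) - q' i = d) := by
      intro i
      have h0 := all (i - i0).1
      have : Fin.ofNat N (i - i0).1 = i - i0 := by
        ext; simp
      rwa [this, add_sub_cancel] at h0
    have hx : ∀ i, x i ≤ q i := fun i => (step i (all' _)).2
    have h1 := h.sum_min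
    simp only [hx, min_eq_left] at h1
    omega
  funext i
  exact le_antisymm (mono _ _ h h' i) (mono _ _ h' h i)

/-- The combinatorial `R` matrix for `l ≤ k`, by the queue algorithm. -/
noncomputable def queueR [NeZero N] (h : l ≤ k) (p : Crystal N k × Crystal N l) :
    Crystal N l × Crystal N k :=
  let hq := exists_isQueue (x := p.1.mult) (y := p.2.mult) (by rw [(sum_mult p.1), (sum_mult p.2)]; exact h)
  (⟨fun i => min (p.1.mult i) (hq.choose i), by rw [hq.choose_spec.sum_min, (sum_mult p.2)]⟩,
    ⟨fun i => p.1.mult i + p.2.mult i - min (p.1.mult i) (hq.choose i), by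
      have h1 : ∑ i, (p.1.mult i + p.2.mult i - min (p.1.mult i) (hq.choose i)) +
          ∑ i, min (p.1.mult i) (hq.choose i) = ∑ i, p.1.mult i + ∑ i, p.2.mult i := by
        rw [← Finset.sum_add_distrib, ← Finset.sum_add_distrib]
        exact Finset.sum_congr rfl fun i _ => by omega
      rw [hq.choose_spec.sum_min, (sum_mult p.2), (sum_mult p.1)] at h1
      exact Nat.add_right_cancel h1⟩)

theorem queueR_eq_iff [NeZero N] (h : l < k) {p : Crystal N k × Crystal N l}
    {p' : Crystal N l × Crystal N k} : queueR h.le p = p' ↔ ∃ q, IsQueue p.1.mult p.2.mult q ∧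
      ∀ i, p'.1.mult i = min (p.1.mult i) (q i) ∧ p'.1.mult i + p'.2.mult i = p.1.mult i + p.2.mult i := by
  have hq := exists_isQueue (x := p.1.mult) (y := p.2.mult) (by rw [(sum_mult p.1), (sum_mult p.2)]; exact h.le)
  constructor
  · rintro rfl
    exact ⟨hq.choose, hq.choose_spec, fun i => ⟨rfl, by
      have : min (p.1.mult i) (hq.choose i) ≤ p.1.mult i := min_le_left _ _
      simp only [queueR, mult_mk]; omega⟩⟩
  · rintro ⟨q, h1, h2⟩
    have : hq.choose = q := hq.choose_spec.unique h1 (by rw [(sum_mult p.1), (sum_mult p.2)]; exact h)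
    refine Prod.ext (ext fun i => ?_) (ext fun i => ?_)
    · simp only [queueR, mult_mk, this, (h2 i).1]
    · have := h2 i
      simp only [queueR, mult_mk, ‹hq.choose = q›]; omega

end Crystal

/-! ### Existence of the `R` matrix and the Yang–Baxter equation -/

namespace Crystal

variable {N k l : ℕ}

theorem tensorE_eq_some_iff [NeZero N] {i : Fin N} {p p' : Crystal N k × Crystal N l} :
    tensorE i p = some p' ↔
      (p.2.mult i ≤ p.1.mult (i - 1) ∧ 0 < p.1.mult i ∧
        (∀ m, p'.1.mult m + (if m = i then 1 else 0) = p.1.mult m + if m = i - 1 then 1 else 0) ∧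
        ∀ m, p'.2.mult m = p.2.mult m) ∨
      (p.1.mult (i - 1) < p.2.mult i ∧
        (∀ m, p'.2.mult m + (if m = i then 1 else 0) = p.2.mult m + if m = i - 1 then 1 else 0) ∧
        ∀ m, p'.1.mult m = p.1.mult m) := by
  obtain ⟨x, y⟩ := p
  obtain ⟨x', y'⟩ := p'
  unfold tensorE
  split_ifs with h
  · change y.mult i ≤ x.mult (i - 1) at h
    simp only [Option.map_eq_some_iff, Prod.mk.injEq, h, true_and, not_lt.2 h, false_and, or_false]
    constructor
    · rintro ⟨z, hz, rfl, rfl⟩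
      have := move_eq_some_iff.1 hz
      exact ⟨this.1, this.2, fun _ => rfl⟩
    · rintro ⟨h1, h2, h3⟩
      exact ⟨x', move_eq_some_iff.2 ⟨h1, h2⟩, rfl, (ext h3).symm⟩
  · change ¬ y.mult i ≤ x.mult (i - 1) at h
    simp only [Option.map_eq_some_iff, Prod.mk.injEq, h, false_and, not_le.1 h, true_and, false_or]
    constructor
    · rintro ⟨z, hz, rfl, rfl⟩
      have := move_eq_some_iff.1 hz
      exact ⟨this.2, fun _ => rfl⟩
    · rintro ⟨h2, h3⟩
      exact ⟨y', move_eq_some_iff.2 ⟨by omega, h2⟩, (ext h3).symm, rfl⟩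

theorem tensorF_eq_some_iff [NeZero N] {i : Fin N} {p p' : Crystal N k × Crystal N l} :
    tensorF i p = some p' ↔
      (p.2.mult i < p.1.mult (i - 1) ∧
        (∀ m, p'.1.mult m + (if m = i - 1 then 1 else 0) = p.1.mult m + if m = i then 1 else 0) ∧
        ∀ m, p'.2.mult m = p.2.mult m) ∨
      (p.1.mult (i - 1) ≤ p.2.mult i ∧ 0 < p.2.mult (i - 1) ∧
        (∀ m, p'.2.mult m + (if m = i - 1 then 1 else 0) = p.2.mult m + if m = i then 1 else 0) ∧
        ∀ m, p'.1.mult m = p.1.mult m) := by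
  obtain ⟨x, y⟩ := p
  obtain ⟨x', y'⟩ := p'
  unfold tensorF
  split_ifs with h
  · change y.mult i < x.mult (i - 1) at h
    simp only [Option.map_eq_some_iff, Prod.mk.injEq, h, true_and, not_le.2 h, false_and, or_false]
    constructor
    · rintro ⟨z, hz, rfl, rfl⟩
      have := move_eq_some_iff.1 hz
      exact ⟨this.2, fun _ => rfl⟩
    · rintro ⟨h2, h3⟩
      exact ⟨x', move_eq_some_iff.2 ⟨by omega, h2⟩, rfl, (ext h3).symm⟩
  · change ¬ y.mult i < x.mult (i - 1) at h
    simp only [Option.map_eq_some_iff, Prod.mk.injEq, h, false_and, not_lt.1 h, true_and, false_or]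
    constructor
    · rintro ⟨z, hz, rfl, rfl⟩
      have := move_eq_some_iff.1 hz
      exact ⟨this.1, this.2, fun _ => rfl⟩
    · rintro ⟨h1, h2, h3⟩
      exact ⟨y', move_eq_some_iff.2 ⟨h1, h2⟩, (ext h3).symm, rfl⟩

theorem tensorE_eq_none_iff [NeZero N] {i : Fin N} {p : Crystal N k × Crystal N l} :
    tensorE i p = none ↔ p.2.mult i ≤ p.1.mult (i - 1) ∧ p.1.mult i = 0 := by
  unfold tensorE
  split_ifs with h
  · change p.2.mult i ≤ p.1.mult (i - 1) at h
    rw [Option.map_eq_none_iff]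
    refine move_eq_none_iff.trans ?_
    omega
  · change ¬ p.2.mult i ≤ p.1.mult (i - 1) at h
    rw [Option.map_eq_none_iff]
    refine move_eq_none_iff.trans ?_
    omega

theorem tensorF_eq_none_iff [NeZero N] {i : Fin N} {p : Crystal N k × Crystal N l} :
    tensorF i p = none ↔ p.1.mult (i - 1) ≤ p.2.mult i ∧ p.2.mult (i - 1) = 0 := by
  unfold tensorF
  split_ifs with h
  · change p.2.mult i < p.1.mult (i - 1) at h
    rw [Option.map_eq_none_iff]
    refine move_eq_none_iff.trans ?_
    omega
  · change ¬ p.2.mult i < p.1.mult (i - 1) at h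
    rw [Option.map_eq_none_iff]
    refine move_eq_none_iff.trans ?_
    omega

theorem tensorF_eq_some_iff_tensorE [NeZero N] (hN : 2 ≤ N) {i : Fin N}
    {p p' : Crystal N k × Crystal N l} : tensorF i p = some p' ↔ tensorE i p' = some p := by
  have hi := sub_one_ne hN i
  rw [tensorE_eq_some_iff, tensorF_eq_some_iff]
  constructor
  · rintro (⟨h1, h2, h3⟩ | ⟨h1, h2, h3, h4⟩)
    · have a1 := h2 i
      have a2 := h2 (i - 1)
      simp only [if_true, hi, hi.symm, if_false] at a1 a2
      exact .inl ⟨by rw [h3]; omega, by omega, fun m => (h2 m).symm, fun m => (h3 m).symm⟩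
    · have a1 := h3 i
      have a2 := h3 (i - 1)
      simp only [if_true, hi, hi.symm, if_false] at a1 a2
      exact .inr ⟨by rw [h4]; omega, fun m => (h3 m).symm, fun m => (h4 m).symm⟩
  · rintro (⟨h1, h2, h3, h4⟩ | ⟨h1, h2, h3⟩)
    · have a1 := h3 i
      have a2 := h3 (i - 1)
      simp only [if_true, hi, hi.symm, if_false] at a1 a2
      exact .inl ⟨by rw [h4]; omega, fun m => (h3 m).symm, fun m => (h4 m).symm⟩
    · have a1 := h2 i
      have a2 := h2 (i - 1)
      simp only [if_true, hi, hi.symm, if_false] at a1 a2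
      exact .inr ⟨by rw [h3]; omega, by omega, fun m => (h2 m).symm, fun m => (h3 m).symm⟩

theorem isIso_of_tensorE [NeZero N] (hN : 2 ≤ N)
    {R : Crystal N k × Crystal N l → Crystal N l × Crystal N k} (hR : Function.Bijective R)
    (h : ∀ i b, tensorE i (R b) = (tensorE i b).map R) : IsIso R := by
  refine ⟨hR, fun i b => ⟨h i b, ?_⟩⟩
  refine Option.ext fun c => ?_
  simp only [Option.map_eq_some_iff, tensorF_eq_some_iff_tensorE hN]
  obtain ⟨c, rfl⟩ := hR.2 c
  rw [h]
  simp only [Option.map_eq_some_iff]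
  constructor
  · rintro ⟨b', hb, hb'⟩
    exact ⟨c, by rw [hb, hR.1 hb'], rfl⟩
  · rintro ⟨c', hc, hc'⟩
    rw [hR.1 hc'] at hc
    exact ⟨b, hc, rfl⟩

theorem IsIso.symm [NeZero N] {R : Crystal N k × Crystal N l ≃ Crystal N l × Crystal N k}
    (h : IsIso R) : IsIso R.symm := by
  refine ⟨R.symm.bijective, fun i b => ?_⟩
  obtain ⟨h1, h2⟩ := h.2 i (R.symm b)
  rw [R.apply_symm_apply] at h1 h2
  rw [h1, h2, Option.map_map, Option.map_map]
  simp

-- Raising at `i` changes the queue at `i - 1` only: if it acts on the first factor, the queue there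
-- grows by one exactly when all letters `i` of that factor are served; if it acts on the second
-- factor, it shrinks by one. Uniqueness of the queue identifies the new queue, and the letters
-- other than `i` and `i - 1` are not affected.
set_option maxHeartbeats 1600000 in
theorem queueR_tensorE [NeZero N] (hN : 2 ≤ N) (h : l < k) (i : Fin N)
    (p : Crystal N k × Crystal N l) :
    tensorE i (queueR h.le p) = (tensorE i p).map (queueR h.le) := by
  have hi := sub_one_ne hN i
  obtain ⟨q, hq, hp'⟩ := (queueR_eq_iff h (p := p)).1 rfl
  set p' := queueR h.le p with hp'def
  have hqi := hq i
  have h1 := hp' i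
  have h2 := hp' (i - 1)
  rcases hE : tensorE i p with _ | p1
  · rw [tensorE_eq_none_iff] at hE
    rw [Option.map_none, tensorE_eq_none_iff]
    omega
  rw [Option.map_some]
  rw [tensorE_eq_some_iff] at hE
  have hm1 : ∀ m : Fin N, m - 1 = i - 1 ↔ m = i := fun m => sub_left_inj
  have ih' := sub_one_ne hN (i - 1)
  obtain ⟨q1, hq1, hq1', hout⟩ : ∃ q1 : Fin N → ℕ, IsQueue p1.1.mult p1.2.mult q1 ∧
      (∀ m ≠ i - 1, q1 m = q m) ∧
      ((p.2.mult i ≤ p.1.mult (i - 1) ∧ q1 (i - 1) = q (i - 1) + if p.1.mult i ≤ q i then 1 else 0) ∨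
        (p.1.mult (i - 1) < p.2.mult i ∧ q1 (i - 1) + 1 = q (i - 1))) := by
    rcases hE with ⟨a1, a2, a3, a4⟩ | ⟨a1, a2, a3⟩
    · refine ⟨fun m => q m + if m = i - 1 then (if p.1.mult i ≤ q i then 1 else 0) else 0,
        fun m => ?_, fun m hm => by simp [hm], .inl ⟨a1, by simp⟩⟩
      have b1 := hq m
      have b2 := a3 m
      have b3 := a4 m
      simp only [hm1]
      by_cases e1 : m = i
      · subst e1
        simp only [if_true, hi.symm, if_false] at b2 ⊢
        split_ifs <;> omega
      · by_cases e2 : m = i - 1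
        · subst e2
          simp only [if_true, hi, if_false] at b2 ⊢
          split_ifs <;> omega
        · simp only [e1, e2, if_false] at b2 ⊢
          omega
    · refine ⟨fun m => q m - if m = i - 1 then 1 else 0, fun m => ?_, fun m hm => by simp [hm],
        .inr ⟨a1, by simp; omega⟩⟩
      have b1 := hq m
      have b2 := a2 m
      have b3 := a3 m
      simp only [hm1]
      by_cases e1 : m = i
      · subst e1
        simp only [if_true, hi.symm, if_false] at b2 ⊢
        omega
      · by_cases e2 : m = i - 1
        · subst e2
          simp only [if_true, hi, if_false] at b2 ⊢
          omega
        · simp only [e1, e2, if_false] at b2 ⊢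
          omega
  obtain ⟨q1', hq1u, hp1⟩ := (queueR_eq_iff h (p := p1)).1 rfl
  obtain rfl : q1' = q1 := hq1u.unique hq1 (by rw [(sum_mult p1.1), (sum_mult p1.2)]; exact h)
  set p1' := queueR h.le p1
  have c1 := hp1 i
  have c2 := hp1 (i - 1)
  have c3 := hq1' i hi.symm
  rw [tensorE_eq_some_iff]
  rcases hE with ⟨a1, a2, a3, a4⟩ | ⟨a1, a2, a3⟩
  · have d1 := a3 i
    have d2 := a3 (i - 1)
    have d3 := a4 i
    have d4 := a4 (i - 1)
    simp only [if_true, hi, hi.symm, if_false] at d1 d2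
    by_cases hc : p.1.mult i ≤ q i
    · rw [if_pos hc] at hout
      refine .inl ⟨by omega, by omega, fun m => ?_, fun m => ?_⟩ <;>
        (have e1 := hp' m; have e2 := hp1 m; have e3 := a3 m; have e4 := a4 m
         by_cases m1 : m = i
         · subst m1
           (try simp only [if_true, hi.symm, if_false]); omega
         · by_cases m2 : m = i - 1
           · subst m2
             (try simp only [if_true, hi, if_false]); omega
           · have e5 := hq1' m m2
             (try simp only [m1, m2, if_false] at e3 e4 ⊢); omega)
    · rw [if_neg hc] at hout
      refine .inr ⟨by omega, fun m => ?_, fun m => ?_⟩ <;>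
        (have e1 := hp' m; have e2 := hp1 m; have e3 := a3 m; have e4 := a4 m
         by_cases m1 : m = i
         · subst m1
           (try simp only [if_true, hi.symm, if_false]); omega
         · by_cases m2 : m = i - 1
           · subst m2
             (try simp only [if_true, hi, if_false]); omega
           · have e5 := hq1' m m2
             (try simp only [m1, m2, if_false] at e3 e4 ⊢); omega)
  · have d1 := a2 i
    have d2 := a2 (i - 1)
    have d3 := a3 i
    have d4 := a3 (i - 1)
    simp only [if_true, hi, hi.symm, if_false] at d1 d2
    by_cases hc : q i ≤ p.1.mult i
    · refine .inr ⟨by omega, fun m => ?_, fun m => ?_⟩ <;>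
        (have e1 := hp' m; have e2 := hp1 m; have e3 := a2 m; have e4 := a3 m
         by_cases m1 : m = i
         · subst m1
           (try simp only [if_true, hi.symm, if_false]); omega
         · by_cases m2 : m = i - 1
           · subst m2
             (try simp only [if_true, hi, if_false]); omega
           · have e5 := hq1' m m2
             (try simp only [m1, m2, if_false] at e3 e4 ⊢); omega)
    · refine .inr ⟨by omega, fun m => ?_, fun m => ?_⟩ <;>
        (have e1 := hp' m; have e2 := hp1 m; have e3 := a2 m; have e4 := a3 m
         by_cases m1 : m = i
         · subst m1
           (try simp only [if_true, hi.symm, if_false]); omega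
         · by_cases m2 : m = i - 1
           · subst m2
             (try simp only [if_true, hi, if_false]); omega
           · have e5 := hq1' m m2
             (try simp only [m1, m2, if_false] at e3 e4 ⊢); omega)

instance (N k : ℕ) : Finite (Crystal N k) :=
  Finite.of_injective (β := Fin N → Fin (k + 1))
    (fun b i => ⟨b.mult i, Nat.lt_succ_of_le (mult_le b i)⟩)
    fun b b' h => ext fun i => by simpa using congrArg Fin.val (congrFun h i)

/-- The inverse is again a queue algorithm, with the cyclic order of the letters reversed and the
same queue shifted by one letter. Its uniqueness recovers `q` from the image, and `q` with the image
recovers the source. -/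
theorem queueR_injective [NeZero N] (h : l < k) :
    Function.Injective (queueR (N := N) h.le) := by
  intro p r hpr
  obtain ⟨q, hq, h1⟩ := (queueR_eq_iff h (p := p)).1 rfl
  obtain ⟨q', hq', h2⟩ := (queueR_eq_iff h (p := r)).1 rfl
  rw [← hpr] at h2
  set s := queueR h.le p
  have key : ∀ (p : Crystal N k × Crystal N l) (q : Fin N → ℕ), IsQueue p.1.mult p.2.mult q →
      (∀ i, s.1.mult i = min (p.1.mult i) (q i) ∧ s.1.mult i + s.2.mult i = p.1.mult i + p.2.mult i) →
      IsQueue (fun i => s.2.mult (-i)) (fun i => s.1.mult (-i)) (fun i => q (-i - 1)) := by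
    intro p q hq h1 i
    have h3 := hq (-i)
    have h4 := h1 (-i)
    have : -(i - 1) - 1 = -i := by abel
    simp only [this]
    omega
  have hu := (key p q hq h1).unique (key r q' hq' h2) (by
    have e1 : ∑ i, s.1.mult (-i) = l :=
      (Equiv.sum_comp (Equiv.neg (Fin N)) s.1.mult).trans s.1.sum_mult
    have e2 : ∑ i, s.2.mult (-i) = k :=
      (Equiv.sum_comp (Equiv.neg (Fin N)) s.2.mult).trans s.2.sum_mult
    rwa [e1, e2])
  have hqq : q = q' := by
    funext i
    have := congrFun hu (-i - 1)
    simpa using this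
  subst hqq
  have hall : ∀ i, p.1.mult i = r.1.mult i ∧ p.2.mult i = r.2.mult i := fun i => by
    have := h1 i; have := h2 i; have := hq i; have := hq' i; omega
  exact Prod.ext (ext fun i => (hall i).1) (ext fun i => (hall i).2)

theorem queueR_bijective [NeZero N] (h : l < k) : Function.Bijective (queueR (N := N) h.le) := by
  have e : Crystal N l × Crystal N k ≃ Crystal N k × Crystal N l := Equiv.prodComm _ _
  refine ⟨queueR_injective h, ?_⟩
  have : Function.Surjective (e ∘ queueR h.le) :=
    Finite.surjective_of_injective (e.injective.comp (queueR_injective h))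
  intro y
  obtain ⟨x, hx⟩ := this (e y)
  exact ⟨x, e.injective hx⟩

theorem isIso_of_one {R : Crystal 1 k × Crystal 1 l → Crystal 1 l × Crystal 1 k}
    (hR : Function.Bijective R) : IsIso R := by
  have hs : ∀ j, Subsingleton (Crystal 1 j) := fun j => ⟨fun a b => by
    rw [eq_const (b := a) (i := 0) (fun m hm => absurd (Subsingleton.elim _ _) hm),
      eq_const (b := b) (i := 0) (fun m hm => absurd (Subsingleton.elim _ _) hm)]⟩
  have hv : ∀ j (b : Crystal 1 j) (i : Fin 1), b.mult i = j := fun j b i => by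
    have := b.sum_mult; simpa [Subsingleton.elim i 0] using this
  have hopt : ∀ {α : Type} [Subsingleton α] (a b : Option α), (a = none ↔ b = none) → a = b := by
    intro α _ a b h
    rcases a with _ | a <;> rcases b with _ | b
    · rfl
    · simp at h
    · simp at h
    · rw [Subsingleton.elim a b]
  refine ⟨hR, fun i b => ⟨hopt _ _ ?_, hopt _ _ ?_⟩⟩
  · simp only [tensorE_eq_none_iff, Option.map_eq_none_iff, hv]; omega
  · simp only [tensorF_eq_none_iff, Option.map_eq_none_iff, hv]; omega

theorem queueR_isIso [NeZero N] (h : l < k) : IsIso (queueR (N := N) h.le) := by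
  by_cases hN : 2 ≤ N
  · exact isIso_of_tensorE hN (queueR_bijective h) (queueR_tensorE hN h)
  · have : N = 1 := by have := NeZero.pos N; omega
    subst this
    exact isIso_of_one (queueR_bijective h)

theorem isIso_id [NeZero N] : IsIso (id : Crystal N k × Crystal N k → _) :=
  ⟨Function.bijective_id, fun i b => by simp⟩

theorem exists_isIso [NeZero N] (k l : ℕ) :
    ∃ R : Crystal N k × Crystal N l → Crystal N l × Crystal N k, IsIso R := by
  rcases lt_trichotomy k l with h | rfl | h
  · exact ⟨_, IsIso.symm (R := Equiv.ofBijective _ (queueR_bijective h)) (queueR_isIso h)⟩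
  · exact ⟨id, isIso_id⟩
  · exact ⟨_, queueR_isIso h⟩

theorem combR_isIso [NeZero N] (k l : ℕ) : IsIso (combR (N := N) k l) := by
  unfold combR
  rw [dif_pos (exists_isIso k l)]
  exact (exists_isIso k l).choose_spec

theorem combR_self [NeZero N] (p : Crystal N k × Crystal N k) : combR k k p = p :=
  congrFun ((combR_isIso k k).unique isIso_id) p

theorem combR_combR [NeZero N] (p : Crystal N k × Crystal N l) : combR l k (combR k l p) = p := by
  have h := combR_isIso (N := N) k l
  have h' := IsIso.symm (R := Equiv.ofBijective _ h.1) h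
  rw [(combR_isIso l k).unique h']
  exact Equiv.ofBijective_symm_apply_apply _ h.1 p

theorem combR_eq_comm [NeZero N] {p : Crystal N k × Crystal N l} {p' : Crystal N l × Crystal N k} :
    combR k l p = p' ↔ combR l k p' = p :=
  ⟨fun h => by rw [← h, combR_combR], fun h => by rw [← h, combR_combR]⟩

theorem combR_eq_iff_of_lt [NeZero N] (h : l < k) {p : Crystal N k × Crystal N l}
    {p' : Crystal N l × Crystal N k} : combR k l p = p' ↔ ∃ q, IsQueue p.1.mult p.2.mult q ∧
      ∀ i, p'.1.mult i = min (p.1.mult i) (q i) ∧ p'.1.mult i + p'.2.mult i = p.1.mult i + p.2.mult i := by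
  rw [(combR_isIso k l).unique (queueR_isIso h), queueR_eq_iff h]

/-- For `k = l` the queue need not be unique, but the totals force all letters of the first row to
be served, so every queue gives the identity, which is then `combR`. -/
theorem combR_eq_of_isQueue [NeZero N] (h : l ≤ k) {p : Crystal N k × Crystal N l}
    {p' : Crystal N l × Crystal N k} {q : Fin N → ℕ} (hq : IsQueue p.1.mult p.2.mult q)
    (hp : ∀ i, p'.1.mult i = min (p.1.mult i) (q i) ∧ p'.1.mult i + p'.2.mult i = p.1.mult i + p.2.mult i) :
    combR k l p = p' := by
  rcases h.lt_or_eq with h | rfl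
  · exact (combR_eq_iff_of_lt h).2 ⟨q, hq, hp⟩
  · rw [combR_self]
    have h1 : ∀ i ∈ Finset.univ, min (p.1.mult i) (q i) = p.1.mult i :=
      (Finset.sum_eq_sum_iff_of_le fun i _ => min_le_left _ _).1
        (by rw [hq.sum_min, (sum_mult p.1), (sum_mult p.2)])
    refine Prod.ext (ext fun i => ?_) (ext fun i => ?_)
    · rw [(hp i).1, h1 i (Finset.mem_univ i)]
    · have := hp i; have := h1 i (Finset.mem_univ i); omega

theorem combR_weight [NeZero N] (p : Crystal N k × Crystal N l) (i : Fin N) :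
    (combR k l p).1.mult i + (combR k l p).2.mult i = p.1.mult i + p.2.mult i := by
  rcases lt_trichotomy k l with h | rfl | h
  · obtain ⟨q, -, hp⟩ := (combR_eq_iff_of_lt h).1 (combR_eq_comm.1 (rfl : combR k l p = _))
    exact (hp i).2.symm
  · rw [combR_self]
  · obtain ⟨q, -, hp⟩ := (combR_eq_iff_of_lt h).1 (rfl : combR k l p = _)
    exact (hp i).2

/-- `ε` is the number of times that `e` can be applied, hence preserved; `φ - ε` depends only on the
weight, hence `φ` is preserved too. -/
theorem combR_isHom [NeZero N] (hN : 2 ≤ N) (k l : ℕ) :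
    RaisingCrystal.IsHom ((raising N k hN).tensor (raising N l hN))
      ((raising N l hN).tensor (raising N k hN)) (combR k l) := by
  have he := fun i p => ((combR_isIso (N := N) k l).2 i p).1
  have heps : ∀ (i : Fin N) (n : ℕ) (p : Crystal N k × Crystal N l),
      ((raising N k hN).tensor (raising N l hN)).eps i p = n →
      ((raising N l hN).tensor (raising N k hN)).eps i (combR k l p) = n := by
    intro i n
    induction n with
    | zero =>
      intro p hp
      rw [← RaisingCrystal.e_eq_none, ← tensorE_eq] at hp ⊢
      rw [he, hp]; rfl
    | succ n ih =>
      intro p hp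
      rcases hx : tensorE i p with _ | y
      · rw [tensorE_eq hN, RaisingCrystal.e_eq_none] at hx; omega
      · have h1 := RaisingCrystal.eps_e ((raising N k hN).tensor (raising N l hN)) _ _ _ hx
        have h2 : tensorE i (combR k l p) = some (combR k l y) := by rw [he, hx]; rfl
        rw [RaisingCrystal.eps_e ((raising N l hN).tensor (raising N k hN)) _ _ _ h2, ih y (by omega)]
  refine ⟨he, fun i p => heps i _ p rfl, fun i p => ?_⟩
  have h1 := heps i _ p rfl
  have h2 := combR_weight p i
  have h3 := combR_weight p (i - 1)
  simp only [RaisingCrystal.tensor, raising, eps, phi] at h1 ⊢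
  omega

/-- The Yang–Baxter equation. -/
theorem yangBaxter [NeZero N] (hN : 2 ≤ N) {a b c : ℕ} (x : Crystal N a) (y : Crystal N b)
    (z : Crystal N c) :
    let s := combR a b (x, y)
    let t := combR a c (s.2, z)
    let r := combR b c (s.1, t.1)
    let s' := combR b c (y, z)
    let t' := combR a c (x, s'.1)
    let r' := combR a b (t'.2, s'.2)
    (r.1, r.2, t.2) = (t'.1, r'.1, r'.2) := by
  set A := raising N a hN
  set B := raising N b hN
  set D := raising N c hN
  have h1 := (((RaisingCrystal.isHom_assoc D B A).comp (combR_isHom hN b c).prodMap_id).comp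
    (RaisingCrystal.isHom_assoc B D A).symm).comp (((combR_isHom hN a c).id_prodMap).comp
      (((RaisingCrystal.isHom_assoc B A D).comp (combR_isHom hN a b).prodMap_id).comp (RaisingCrystal.isHom_assoc A B D).symm))
  have h2 := ((combR_isHom hN a b).id_prodMap).comp
    ((((RaisingCrystal.isHom_assoc D A B).comp (combR_isHom hN a c).prodMap_id).comp
    (RaisingCrystal.isHom_assoc A D B).symm).comp ((combR_isHom hN b c).id_prodMap))
  -- Both sides are morphisms between threefold tensor products in which everything is swept to one
  -- element.
  have := RaisingCrystal.eq_of_sweep_eq (n := a + (b + c)) h1.e h2.e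
    (sweep_triple hN le_rfl) (sweep_triple hN (by omega))
  exact congrFun this (x, y, z)

end Crystal

/-! ### The vacuum -/

namespace Crystal

variable {N k l : ℕ} [NeZero N]

theorem eq_vac_iff {b : Crystal N k} : b = vac N k ↔ ∀ m ≠ 0, b.mult m = 0 := by
  constructor
  · rintro rfl m hm
    exact Pi.single_eq_of_ne hm _
  · exact fun h => eq_const h

theorem combR_fst_snd_eq_vac_iff {p : Crystal N k × Crystal N l} :
    ((combR k l p).1 = vac N l ∧ (combR k l p).2 = vac N k) ↔
      (p.1 = vac N k ∧ p.2 = vac N l) := by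
  simp only [eq_vac_iff]
  constructor
  · rintro ⟨h1, h2⟩
    refine ⟨fun m hm => ?_, fun m hm => ?_⟩ <;>
    · have := combR_weight p m; have := h1 m hm; have := h2 m hm; omega
  · rintro ⟨h1, h2⟩
    refine ⟨fun m hm => ?_, fun m hm => ?_⟩ <;>
    · have := combR_weight p m; have := h1 m hm; have := h2 m hm; omega

theorem combR_vac (k l : ℕ) : combR k l (vac N k, vac N l) = (vac N l, vac N k) := by
  obtain ⟨h1, h2⟩ := combR_fst_snd_eq_vac_iff.2 (⟨rfl, rfl⟩ :
    (vac N k, vac N l).1 = vac N k ∧ (vac N k, vac N l).2 = vac N l)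
  exact Prod.ext h1 h2

theorem mult_vac_zero : (vac N k).mult 0 = k := by
  change (Pi.single 0 k : Fin N → ℕ) 0 = k
  exact Pi.single_eq_same _ _

theorem eq_vac_of_mult_zero {b : Crystal N k} (h : k ≤ b.mult 0) : b = vac N k := by
  rw [eq_vac_iff]
  intro m hm
  have h1 := Finset.add_le_sum (f := b.mult) (fun _ _ => Nat.zero_le _) (Finset.mem_univ 0)
    (Finset.mem_univ m) hm.symm
  rw [b.sum_mult] at h1
  omega

/-- A carrier that is not empty drops at least one ball into an empty cell. This is why a carrier
becomes empty again behind a finite state. -/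
theorem mult_zero_lt_combR_vac (hl : 1 ≤ l) {x : Crystal N k} (hx : x ≠ vac N k) :
    x.mult 0 < (combR k l (x, vac N l)).2.mult 0 := by
  by_contra hlt
  have hw := combR_weight (x, vac N l) 0
  have hvac : (combR k l (x, vac N l)).1 = vac N l := by
    refine eq_vac_of_mult_zero ?_
    have := mult_vac_zero (N := N) (k := l)
    dsimp only at hw
    omega
  refine hx (eq_vac_iff.2 ?_)
  rcases lt_trichotomy l k with h | rfl | h
  · obtain ⟨q, hq, hp⟩ := (combR_eq_iff_of_lt h).1 (rfl : combR k l (x, vac N l) = _)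
    rw [hvac] at hp
    dsimp only at hq hp
    have hv : ∀ m ≠ 0, (vac N l).mult m = 0 := eq_vac_iff.1 rfl
    -- Suppose that no ball is dropped. The `l ≥ 1` letters of the cell enter the queue at the top
    -- letter; an unserved queue stays positive down to the letter `0`, so the carrier contains no
    -- ball on the way.
    have key : ∀ (j : ℕ) (m : Fin N), m.1 + 1 + j = N → 0 < q m ∧ (m ≠ 0 → x.mult m = 0) := by
      intro j
      induction j with
      | zero =>
        intro m hm
        have h0 : m = 0 - 1 := Fin.ext (by rw [val_sub_one_of_zero _ (by simp)]; omega)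
        have h1 := hq 0
        rw [mult_vac_zero, ← h0] at h1
        refine ⟨by omega, fun hm0 => ?_⟩
        have := (hp m).1
        have := hv m hm0
        omega
      | succ j ih =>
        intro m hm
        have hm1 : (m + 1).1 = m.1 + 1 := by
          rw [Fin.val_add_one_of_lt']; omega
        have hne : m + 1 ≠ 0 := fun h => by
          have := congrArg Fin.val h; rw [hm1] at this; simp at this
        obtain ⟨i1, i2⟩ := ih (m + 1) (by omega)
        have h1 := hq (m + 1)
        rw [add_sub_cancel_right, i2 hne, hv _ hne] at h1
        refine ⟨by omega, fun hm0 => ?_⟩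
        have := (hp m).1
        have := hv m hm0
        omega
    intro m hm
    exact (key (N - 1 - m.1) m (by have := m.2; omega)).2 hm
  · rw [combR_self] at hvac
    exact eq_vac_iff.1 hvac
  · obtain ⟨q, -, hp⟩ := (combR_eq_iff_of_lt h).1 (combR_eq_comm.1 (rfl : combR k l (x, vac N l) = _))
    intro m hm
    have h1 := (hp m).1
    rw [hvac] at h1
    have hv : (vac N l).mult m = 0 := eq_vac_iff.1 rfl m hm
    dsimp only at h1
    omega

end Crystal

/-! ### Evolutions on inhomogeneous lattices -/

/-- A state on a lattice whose cell `n` has capacity `Θ n`. -/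
abbrev LatticeState (M : ℕ) (Θ : ℤ → ℕ) : Type := (n : ℤ) → Crystal (M + 1) (Θ n)

/-- Time evolution by a carrier of capacity `κ` on a lattice with arbitrary capacities. -/
def IsLatticeEvolution {M : ℕ} {Θ : ℤ → ℕ} (κ : ℕ) (p p' : LatticeState M Θ) : Prop :=
  ∃ v : ℤ → Crystal (M + 1) κ,
    {n | v n ≠ Crystal.vac (M + 1) κ}.Finite ∧
      ∀ n, Crystal.combR κ (Θ n) (v n, p n) = (p' n, v (n + 1))

namespace IsLatticeEvolution

open Crystal

variable {M : ℕ} {Θ : ℤ → ℕ} {κ κ' : ℕ} {p p' q q' : LatticeState M Θ}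

theorem _root_.Set.Finite.exists_forall_le_not {s : Set ℤ} (hs : s.Finite) :
    (∃ A, ∀ n ≤ A, n ∉ s) ∧ ∃ B, ∀ n ≥ B, n ∉ s := by
  obtain ⟨a, ha⟩ := hs.bddBelow
  obtain ⟨b, hb⟩ := hs.bddAbove
  exact ⟨⟨a - 1, fun n hn h => by have := ha h; omega⟩,
    ⟨b + 1, fun n hn h => by have := hb h; omega⟩⟩

theorem _root_.Set.finite_of_forall_not {s : Set ℤ} {A B : ℤ} (hA : ∀ n ≤ A, n ∉ s)
    (hB : ∀ n ≥ B, n ∉ s) : s.Finite :=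
  (Set.finite_Ioo A B).subset fun n hn =>
    ⟨not_le.1 fun h => hA n h hn, not_le.1 fun h => hB n h hn⟩

/-- The carrier is empty far to the left, and from there on it is determined cell by cell. -/
theorem unique (h : IsLatticeEvolution κ p q) (h' : IsLatticeEvolution κ p q') : q = q' := by
  obtain ⟨v, hv, h⟩ := h
  obtain ⟨w, hw, h'⟩ := h'
  obtain ⟨A, hA⟩ := hv.exists_forall_le_not.1
  obtain ⟨B, hB⟩ := hw.exists_forall_le_not.1
  have step : ∀ n, v n = w n → q n = q' n ∧ v (n + 1) = w (n + 1) := by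
    intro n hn
    have := (h n).symm.trans ((congrArg _ (by rw [hn])).trans (h' n))
    exact Prod.ext_iff.1 this
  have all : ∀ n, v n = w n := by
    intro n
    rcases le_total n (min A B) with hn | hn
    · have h1 := hA n (by omega)
      have h2 := hB n (by omega)
      simp only [Set.mem_ofPred_eq, not_not] at h1 h2
      rw [h1, h2]
    · induction n, hn using Int.leInduction with
      | base =>
        have h1 := hA (min A B) (by omega)
        have h2 := hB (min A B) (by omega)
        simp only [Set.mem_ofPred_eq, not_not] at h1 h2
        rw [h1, h2]
      | succ n hn ih => exact (step n ih).2
  exact funext fun n => (step n (all n)).1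

/-- `R` is bijective, so the carrier can be run backwards from the far right, where it is empty. -/
theorem injective (h : IsLatticeEvolution κ p q) (h' : IsLatticeEvolution κ p' q) : p = p' := by
  obtain ⟨v, hv, h⟩ := h
  obtain ⟨w, hw, h'⟩ := h'
  obtain ⟨A, hA⟩ := hv.exists_forall_le_not.2
  obtain ⟨B, hB⟩ := hw.exists_forall_le_not.2
  have step : ∀ n, v (n + 1) = w (n + 1) → v n = w n ∧ p n = p' n := by
    intro n hn
    have h1 := h n
    rw [hn, ← h' n] at h1
    exact Prod.ext_iff.1 ((combR_isIso κ (Θ n)).1.1 h1)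
  have all : ∀ n, v n = w n := by
    intro n
    rcases le_total (max A B) n with hn | hn
    · have h1 := hA n (by omega)
      have h2 := hB n (by omega)
      simp only [Set.mem_ofPred_eq, not_not] at h1 h2
      rw [h1, h2]
    · induction n, hn using Int.leInductionDown with
      | base =>
        have h1 := hA (max A B) (by omega)
        have h2 := hB (max A B) (by omega)
        simp only [Set.mem_ofPred_eq, not_not] at h1 h2
        rw [h1, h2]
      | pred n hn ih =>
        refine (step (n - 1) ?_).1
        rwa [sub_add_cancel]
  exact funext fun n => (step n (all (n + 1))).2

theorem finite (h : IsLatticeEvolution κ p q) (hp : {n | p n ≠ vac (M + 1) (Θ n)}.Finite) :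
    {n | q n ≠ vac (M + 1) (Θ n)}.Finite := by
  obtain ⟨v, hv, h⟩ := h
  obtain ⟨⟨A, hA⟩, ⟨B, hB⟩⟩ := hv.exists_forall_le_not
  obtain ⟨⟨A', hA'⟩, ⟨B', hB'⟩⟩ := hp.exists_forall_le_not
  have key : ∀ n, v n = vac _ _ → p n = vac _ _ → q n = vac _ _ := by
    intro n h1 h2
    have h3 := h n
    rw [h1, h2, combR_vac] at h3
    exact (Prod.ext_iff.1 h3).1.symm
  simp only [Set.mem_ofPred_eq, not_not] at hA hB hA' hB'
  exact Set.finite_of_forall_not (A := min A A') (B := max B B')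
    (fun n hn => not_not.2 (key n (hA n (by omega)) (hA' n (by omega))))
    (fun n hn => not_not.2 (key n (hB n (by omega)) (hB' n (by omega))))

/-- The two carriers are exchanged by `R` in front of every cell; the Yang–Baxter equation says that
the exchanged carriers again fit together, and an empty pair of carriers stays empty. -/
theorem comm (hM : 1 ≤ M) (h : IsLatticeEvolution κ p q) (h' : IsLatticeEvolution κ' q q') :
    ∃ r, IsLatticeEvolution κ' p r ∧ IsLatticeEvolution κ r q' := by
  obtain ⟨v, hv, h⟩ := h
  obtain ⟨w, hw, h'⟩ := h'
  have hfin : {n | combR κ' κ (w n, v n) ≠ (vac _ _, vac _ _)}.Finite := by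
    refine (hv.union hw).subset fun n hn => ?_
    by_contra hc
    simp only [Set.mem_union, Set.mem_ofPred_eq, not_or, not_not] at hc
    rw [Set.mem_ofPred_eq, hc.1, hc.2, combR_vac] at hn
    exact hn rfl
  have key : ∀ n, ∃ r : Crystal (M + 1) (Θ n),
      combR κ' (Θ n) ((combR κ' κ (w n, v n)).2, p n) =
        (r, (combR κ' κ (w (n + 1), v (n + 1))).2) ∧
      combR κ (Θ n) ((combR κ' κ (w n, v n)).1, r) =
        (q' n, (combR κ' κ (w (n + 1), v (n + 1))).1) := by
    intro n
    have hyb := yangBaxter (show 2 ≤ M + 1 by omega) (w n) (v n) (p n)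
    simp only [h n, h' n, Prod.mk.injEq] at hyb
    obtain ⟨h1, h2, h3⟩ := hyb
    exact ⟨_, Prod.ext rfl h3, Prod.ext h1 h2⟩
  choose r hr1 hr2 using key
  refine ⟨r, ⟨fun n => (combR κ' κ (w n, v n)).2, hfin.subset fun n hn h => hn ?_, hr1⟩,
    ⟨fun n => (combR κ' κ (w n, v n)).1, hfin.subset fun n hn h => hn ?_, hr2⟩⟩
  · change (combR κ' κ (w n, v n)).2 = _
    rw [h]
  · change (combR κ' κ (w n, v n)).1 = _
    rw [h]

end IsLatticeEvolution

open Crystal in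
theorem exists_isLatticeEvolution {M : ℕ} {Θ : ℤ → ℕ} (hΘ : ∀ n, 1 ≤ Θ n) (κ : ℕ)
    {p : LatticeState M Θ} (hp : {n | p n ≠ vac (M + 1) (Θ n)}.Finite) :
    ∃ p', IsLatticeEvolution κ p p' := by
  obtain ⟨⟨A, hA⟩, ⟨B, hB⟩⟩ := hp.exists_forall_le_not
  simp only [Set.mem_ofPred_eq, not_not] at hA hB
  let u : ℕ → Crystal (M + 1) κ := fun j =>
    Nat.rec (vac _ _) (fun j x => (combR κ (Θ (A + j)) (x, p (A + j))).2) j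
  let v : ℤ → Crystal (M + 1) κ := fun n => u (n - A).toNat
  have hv : ∀ n, v (n + 1) = (combR κ (Θ n) (v n, p n)).2 := by
    intro n
    rcases lt_or_ge n A with hn | hn
    · have h1 : v n = vac _ _ := by
        change u _ = _; rw [Int.toNat_of_nonpos (by omega)]; rfl
      have h2 : v (n + 1) = vac _ _ := by
        change u _ = _; rw [Int.toNat_of_nonpos (by omega)]; rfl
      rw [h1, h2, hA n hn.le, combR_vac]
    · obtain ⟨j, rfl⟩ : ∃ j : ℕ, n = A + j := ⟨(n - A).toNat, by omega⟩
      change u _ = (combR κ _ (u _, _)).2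
      have e1 : (A + j + 1 - A).toNat = j + 1 := by omega
      have e2 : (A + j - A).toNat = j := by omega
      rw [e1, e2]
  -- Behind the last nonempty cell the carrier loses a ball at each cell until it is empty, so at
  -- most `κ` further cells are needed.
  have grow : ∀ j : ℕ, min j κ ≤ (v (B + j)).mult 0 := by
    intro j
    induction j with
    | zero => simp
    | succ j ih =>
      push_cast
      rw [← add_assoc, hv, hB (B + j) (by omega)]
      rcases eq_or_ne (v (B + j)) (vac (M + 1) κ) with hvac | hvac
      · rw [hvac, combR_vac]
        have := mult_vac_zero (N := M + 1) (k := κ)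
        dsimp only; omega
      · have := mult_zero_lt_combR_vac (hΘ (B + j)) hvac
        omega
  refine ⟨fun n => (combR κ (Θ n) (v n, p n)).1, v,
    Set.finite_of_forall_not (A := A) (B := B + κ) (fun n hn => ?_) (fun n hn => ?_),
    fun n => Prod.ext rfl (hv n).symm⟩
  · refine not_not.2 ?_
    change u _ = _
    rw [Int.toNat_of_nonpos (by omega)]
    rfl
  · refine not_not.2 (eq_vac_of_mult_zero ?_)
    have := grow (n - B).toNat
    have e : B + ((n - B).toNat : ℤ) = n := by omega
    rw [e] at this
    omega

/-! ### The commuting evolutions and the relation that they generate -/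

/-- The states with finitely many cells different from the vacuum. -/
def FiniteState (M : ℕ) (Θ : ℤ → ℕ) : Type :=
  {p : LatticeState M Θ // {n | p n ≠ Crystal.vac (M + 1) (Θ n)}.Finite}

namespace FiniteState

variable {M : ℕ} {Θ : ℤ → ℕ} (hΘ : ∀ n, 1 ≤ Θ n) {κ κ' : ℕ} {p q r : FiniteState M Θ}

/-- The time evolution on finite states. -/
noncomputable def evolve (κ : ℕ) (p : FiniteState M Θ) : FiniteState M Θ :=
  ⟨(exists_isLatticeEvolution hΘ κ p.2).choose,
    (exists_isLatticeEvolution hΘ κ p.2).choose_spec.finite p.2⟩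

theorem isLatticeEvolution_evolve (κ : ℕ) (p : FiniteState M Θ) :
    IsLatticeEvolution κ p.1 (evolve hΘ κ p).1 :=
  (exists_isLatticeEvolution hΘ κ p.2).choose_spec

theorem evolve_eq (h : IsLatticeEvolution κ p.1 q.1) : evolve hΘ κ p = q :=
  Subtype.ext ((isLatticeEvolution_evolve hΘ κ p).unique h)

theorem evolve_injective (κ : ℕ) : Function.Injective (evolve (M := M) hΘ κ) := fun p q h =>
  Subtype.ext ((isLatticeEvolution_evolve hΘ κ p).injective
    (by rw [h]; exact isLatticeEvolution_evolve hΘ κ q))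

theorem evolve_comm (hM : 1 ≤ M) (κ κ' : ℕ) (p : FiniteState M Θ) :
    evolve hΘ κ (evolve hΘ κ' p) = evolve hΘ κ' (evolve hΘ κ p) := by
  obtain ⟨r, h1, h2⟩ := (isLatticeEvolution_evolve hΘ κ p).comm hM
    (isLatticeEvolution_evolve hΘ κ' (evolve hΘ κ p))
  have h3 := (isLatticeEvolution_evolve hΘ κ' p).unique h1
  exact evolve_eq hΘ (by rw [h3]; exact h2)

/-- Apply the time evolutions in the list one after the other. -/
noncomputable def evolveList (O : List ℕ) (p : FiniteState M Θ) : FiniteState M Θ :=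
  O.foldl (fun p κ => evolve hΘ κ p) p

theorem evolveList_append (O O' : List ℕ) (p : FiniteState M Θ) :
    evolveList hΘ (O ++ O') p = evolveList hΘ O' (evolveList hΘ O p) := by
  simp [evolveList, List.foldl_append]

theorem evolveList_injective (O : List ℕ) :
    Function.Injective (evolveList (M := M) hΘ O) := by
  induction O with
  | nil => exact fun _ _ h => h
  | cons κ O ih => exact fun p q h => evolve_injective hΘ κ (ih h)

theorem evolveList_evolve (hM : 1 ≤ M) (O : List ℕ) (κ : ℕ) (p : FiniteState M Θ) :
    evolveList hΘ O (evolve hΘ κ p) = evolve hΘ κ (evolveList hΘ O p) := by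
  induction O generalizing p with
  | nil => rfl
  | cons κ' O ih =>
    change evolveList hΘ O (evolve hΘ κ' (evolve hΘ κ p)) = _
    rw [evolve_comm hΘ hM, ih]; rfl

theorem evolveList_iterate (hM : 1 ≤ M) (O : List ℕ) (κ t : ℕ) (p : FiniteState M Θ) :
    evolveList hΘ O ((evolve hΘ κ)^[t] p) = (evolve hΘ κ)^[t] (evolveList hΘ O p) :=
  Function.Semiconj.iterate_right (f := evolveList hΘ O)
    (fun x => evolveList_evolve hΘ hM O κ x) t p

theorem evolveList_comm (hM : 1 ≤ M) (O O' : List ℕ) (p : FiniteState M Θ) :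
    evolveList hΘ O (evolveList hΘ O' p) = evolveList hΘ O' (evolveList hΘ O p) := by
  induction O' generalizing p with
  | nil => rfl
  | cons κ O' ih =>
    change evolveList hΘ O (evolveList hΘ O' (evolve hΘ κ p)) =
      evolveList hΘ O' (evolve hΘ κ (evolveList hΘ O p))
    rw [ih, evolveList_evolve hΘ hM]

/-- Two states are related if suitable products of time evolutions map them to the same state. -/
def Related (p q : FiniteState M Θ) : Prop :=
  ∃ O O' : List ℕ, evolveList hΘ O p = evolveList hΘ O' q

theorem Related.refl (p : FiniteState M Θ) : Related hΘ p p := ⟨[], [], rfl⟩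

variable {hΘ}

theorem Related.symm (h : Related hΘ p q) : Related hΘ q p := by
  obtain ⟨O, O', h⟩ := h
  exact ⟨O', O, h.symm⟩

theorem Related.trans (hM : 1 ≤ M) (h : Related hΘ p q) (h' : Related hΘ q r) :
    Related hΘ p r := by
  obtain ⟨O1, O2, h⟩ := h
  obtain ⟨O3, O4, h'⟩ := h'
  refine ⟨O1 ++ O3, O4 ++ O2, ?_⟩
  -- Commutativity lets the two pairs of products be completed to a common image of the outer
  -- states.
  rw [evolveList_append, evolveList_append, h, ← h', evolveList_comm hΘ hM]

theorem Related.of_evolve (κ κ' : ℕ) (h : evolve hΘ κ p = evolve hΘ κ' q) : Related hΘ p q :=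
  ⟨[κ], [κ'], h⟩

end FiniteState

/-- On a homogeneous lattice the evolution is that of the box-ball system. -/
theorem timeEvolution_eq {M θ : ℕ} {κ : ℕ} {p p' : BoxState M θ}
    (h : IsLatticeEvolution (Θ := fun _ => θ) κ p p') : timeEvolution κ p = p' := by
  have h1 : ∃ p', IsEvolution κ p p' := ⟨p', h⟩
  unfold timeEvolution
  rw [dif_pos h1]
  have h2 : IsLatticeEvolution (Θ := fun _ => θ) κ p h1.choose := h1.choose_spec
  exact h2.unique h

theorem timeEvolution_iterate {M θ : ℕ} (hθ : 1 ≤ θ) (κ t : ℕ)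
    (p : FiniteState M fun _ => θ) :
    (timeEvolution κ)^[t] (p.1 : BoxState M θ) =
      (((FiniteState.evolve (fun _ => hθ) κ)^[t] p).1 : BoxState M θ) := by
  induction t with
  | zero => rfl
  | succ t ih =>
    rw [Function.iterate_succ_apply', Function.iterate_succ_apply', ih]
    exact timeEvolution_eq (FiniteState.isLatticeEvolution_evolve _ κ _)

/-! ### The word of a soliton and its motion past one cell -/

/-- Of the letters of a word of length `l` that occupy the last `P` positions, the number of those at the positions in `[s, t)`. -/
def seg (l P s t : ℤ) : ℤ := max 0 (min P (l - s) - max 0 (l - t))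

theorem seg_add {l P s t u : ℤ} (h0 : 0 ≤ P) (hst : s ≤ t) (htu : t ≤ u) :
    seg l P s t + seg l P t u = seg l P s u := by
  unfold seg; omega

theorem seg_nonneg (l P s t : ℤ) : 0 ≤ seg l P s t := le_max_left _ _

theorem seg_mono {l P Q s t : ℤ} (h : P ≤ Q) : seg l P s t ≤ seg l Q s t := by
  unfold seg; omega

theorem seg_zero (l s t : ℤ) : seg l 0 s t = 0 := by
  unfold seg; omega

theorem seg_of_le_zero {l P s t : ℤ} (hP : P ≤ l) (ht : t ≤ 0) : seg l P s t = 0 := by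
  unfold seg; omega

theorem seg_of_length_le {l P s t : ℤ} (hs : l ≤ s) : seg l P s t = 0 := by
  unfold seg; omega

theorem seg_full {l P s t : ℤ} (h0 : 0 ≤ P) (hP : P ≤ l) (hs : s ≤ 0) (ht : l ≤ t) :
    seg l P s t = P := by
  unfold seg; omega

theorem seg_le_sub {l P s t : ℤ} (hst : s ≤ t) : seg l P s t ≤ t - s := by
  unfold seg; omega

theorem seg_le {l P s t : ℤ} (h0 : 0 ≤ P) : seg l P s t ≤ P := by
  unfold seg; omega

theorem seg_congr {l P s t s' t' : ℤ} (h0 : 0 ≤ P) (hP : P ≤ l)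
    (hs : s = s' ∨ s ≤ 0 ∧ s' ≤ 0) (ht : t = t' ∨ l ≤ t ∧ l ≤ t') :
    seg l P s t = seg l P s' t' := by
  unfold seg; omega

/-- The queue equation for one colour when the carrier holds the letters at `[s - c, s)` and the
cell those at `[s, s + w)`. The letters of the colour form the block `[l - Q, l - P)` of the word.
-/
theorem seg_collision {l P Q s w c θ : ℤ} (h0 : 0 ≤ P) (hPQ : P ≤ Q) (hQ : Q ≤ l)
    (hw : w = min θ l) (hwc : w ≤ c) (hcl : c ≤ l) (hθ : 0 ≤ θ) :
    seg l Q (s - c) (s - c + w) - seg l P (s - c) (s - c + w) =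
      min (seg l Q (s - c) s - seg l P (s - c) s)
        (max (seg l l s (s + w)) (θ - seg l l (s - c) (s - c + w)) +
          seg l Q (s - c) (s - c + w) - seg l Q s (s + w)) := by
  have hl : 0 ≤ l := by omega
  have e1 := seg_add (l := l) h0 (show s - c ≤ s - c + w by omega) (show s - c + w ≤ s by omega)
  have e2 := seg_add (l := l) (h0.trans hPQ) (show s - c ≤ s - c + w by omega)
    (show s - c + w ≤ s by omega)
  have m1 := seg_mono (l := l) (s := s - c + w) (t := s) hPQ
  have m2 := seg_mono (l := l) (s := s) (t := s + w) hQ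
  have m3 := seg_nonneg l P (s - c) (s - c + w)
  -- Either the block of the colour avoids the part `[s - c + w, s)` that is not put into the cell,
  -- and the minimum is its first entry. Or it meets this part; then no smaller colour occurs in the
  -- new cell, no larger one in the old cell, and the queue is the second entry.
  by_cases hcase : c = w ∨ l - s + c - w ≤ P ∨ Q ≤ l - s
  · have : seg l Q (s - c + w) s = seg l P (s - c + w) s := by
      clear e1 e2 m1 m2 m3; unfold seg; omega
    omega
  · push Not at hcase
    have a1 : seg l P (s - c) (s - c + w) = 0 := by clear e1 e2 m1 m2 m3; unfold seg; omega
    have a2 : seg l Q s (s + w) = seg l l s (s + w) := by clear e1 e2 m1 m2 m3 a1; unfold seg; omega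
    have a3 : θ ≤ seg l l (s - c) (s - c + w) + seg l l s (s + w) := by
      clear e1 e2 m1 m2 m3 a1 a2; unfold seg; omega
    omega

namespace Crystal

/-- The counting function of balls `F` (where `F i` is the number of balls of the first `i` colours)
is a possible content of a cell of capacity `κ`. -/
structure IsBallCount (M κ : ℕ) (F : ℕ → ℤ) : Prop where
  zero : F 0 = 0
  mono : ∀ i < M, F i ≤ F (i + 1)
  le : F M ≤ κ

/-- The tableau with given multiplicities. -/
def ofMult {N k : ℕ} (x : Fin N → ℕ) (h : ∑ i, x i = k) : Crystal N k := ⟨x, h⟩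

theorem mult_ofMult {N k : ℕ} (x : Fin N → ℕ) (h : ∑ i, x i = k) (i : Fin N) :
    (ofMult x h).mult i = x i := rfl

/-- The cell of capacity `κ` with `m i` balls of colour `i`. -/
def ofBalls {M : ℕ} (κ : ℕ) (m : Fin M → ℕ) : Crystal (M + 1) κ :=
  if h : ∑ i, m i ≤ κ then
    ofMult (Fin.cons (κ - ∑ i, m i) m) (by
      rw [Fin.sum_univ_succ]; simp only [Fin.cons_zero, Fin.cons_succ]; omega)
  else vac _ _

/-- The cell of capacity `κ` with `F (i + 1) - F i` balls of colour `i`. -/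
def ofCount {M : ℕ} (κ : ℕ) (F : ℕ → ℤ) : Crystal (M + 1) κ :=
  ofBalls κ fun i : Fin M => (F (i + 1) - F i).toNat

variable {M κ θ : ℕ} {F F' G G' : ℕ → ℤ}

theorem IsBallCount.sum (hF : IsBallCount M κ F) :
    ((∑ i : Fin M, (F (i + 1) - F i).toNat : ℕ) : ℤ) = F M := by
  have h1 : ∀ i : Fin M, (((F (i + 1) - F i).toNat : ℕ) : ℤ) = F (i + 1) - F i := fun i => by
    have := hF.mono i i.2; omega
  rw [Nat.cast_sum, Finset.sum_congr rfl fun i _ => h1 i,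
    Fin.sum_univ_eq_sum_range (fun i => F (i + 1) - F i) M, Finset.sum_range_sub, hF.zero, sub_zero]

theorem IsBallCount.mult_succ (hF : IsBallCount M κ F) (i : Fin M) :
    (((ofCount κ F : Crystal (M + 1) κ).mult i.succ : ℕ) : ℤ) = F (i + 1) - F i := by
  have h1 := hF.sum
  have h2 := hF.le
  have h3 := hF.mono i i.2
  rw [ofCount, ofBalls, dif_pos (by omega), mult_ofMult, Fin.cons_succ]
  omega

theorem IsBallCount.mult_zero (hF : IsBallCount M κ F) :
    (((ofCount κ F : Crystal (M + 1) κ).mult 0 : ℕ) : ℤ) = κ - F M := by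
  have h1 := hF.sum
  have h2 := hF.le
  rw [ofCount, ofBalls, dif_pos (by omega), mult_ofMult, Fin.cons_zero]
  omega

theorem ofCount_congr (h : ∀ i ≤ M, F i = G i) :
    (ofCount κ F : Crystal (M + 1) κ) = ofCount κ G := by
  have : (fun i : Fin M => (F (i + 1) - F i).toNat) = fun i : Fin M => (G (i + 1) - G i).toNat := by
    funext i
    rw [h i i.2.le, h (i + 1) i.2]
  exact congrArg (ofBalls κ) this

theorem ext_succ {b b' : Crystal (M + 1) κ} (h : ∀ i : Fin M, b.mult i.succ = b'.mult i.succ) :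
    b = b' := by
  refine ext (Fin.cases ?_ h)
  have h1 := b.sum_mult
  have h2 := b'.sum_mult
  rw [Fin.sum_univ_succ] at h1 h2
  rw [Finset.sum_congr rfl fun i _ => h i] at h1
  omega

theorem ofCount_eq_vac (h : ∀ i ≤ M, F i = 0) : (ofCount κ F : Crystal (M + 1) κ) = vac _ _ := by
  have hF : IsBallCount M κ F := ⟨h 0 (Nat.zero_le _), fun i hi => by
    rw [h i hi.le, h (i + 1) hi], by rw [h M le_rfl]; omega⟩
  refine eq_vac_iff.2 fun m hm => ?_
  obtain ⟨i, rfl⟩ := Fin.exists_succ_eq.2 hm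
  have := hF.mult_succ i
  rw [h i i.2.le, h (i + 1) i.2] at this
  omega

/-- With `h` the length of the queue at the letter 1, conservation of letters makes the queue at
every letter equal to `h + G' - G`. Thus the recursion turns into one equation per colour and one
for the letter 1. -/
theorem combR_ofCount (hθ : θ ≤ κ) (hF : IsBallCount M κ F) (hG : IsBallCount M θ G)
    (hG' : IsBallCount M θ G') (hF' : IsBallCount M κ F') (hsum : ∀ i ≤ M, F i + G i = G' i + F' i)
    {h : ℤ} (hstep : ∀ i < M, G' (i + 1) - G' i = min (F (i + 1) - F i) (h + G' (i + 1) - G (i + 1)))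
    (hwrap : θ - G' M = min (κ - F M) h) :
    combR κ θ ((ofCount κ F, ofCount θ G) : Crystal (M + 1) κ × Crystal (M + 1) θ) =
      (ofCount θ G', ofCount κ F') := by
  let g : ℕ → ℤ := fun i => h + G' i - G i
  have g0 : g 0 = h := by simp only [g, hG'.zero, hG.zero]; ring
  have hpos : ∀ i ≤ M, 0 ≤ g i := by
    intro i hi
    rcases i with _ | i
    · have := hG'.le; rw [g0]; omega
    · have := hG'.mono i hi
      have := hstep i hi
      simp only [g]; omega
  let q : Fin (M + 1) → ℕ := fun i => if i.1 = 0 then (g 0).toNat else (g i.1).toNat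
  have hq : ∀ i : Fin (M + 1), ((q i : ℕ) : ℤ) = g i.1 := fun i => by
    have := hpos i.1 (by have := i.2; omega)
    have := hpos 0 (Nat.zero_le _)
    simp only [q]
    split_ifs with h
    · rw [h]; omega
    · omega
  refine combR_eq_of_isQueue hθ (q := q) (fun i => ?_) (fun i => ?_)
  · dsimp only
    refine Fin.cases ?_ (fun i => ?_) i
    · have h1 := hq (0 - 1)
      have h2 := hq 0
      rw [val_sub_one_of_zero _ (by simp)] at h1
      simp only [Nat.add_sub_cancel, Fin.val_zero, g0] at h1 h2
      have h3 := hF.mult_zero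
      have h4 := hG.mult_zero
      simp only [g] at h1
      omega
    · have h1 := hq (i.succ - 1)
      have h2 := hq i.succ
      rw [val_sub_one _ (by simp)] at h1
      simp only [Nat.add_sub_cancel, Fin.val_succ] at h1 h2
      have h3 := hF.mult_succ i
      have h4 := hG.mult_succ i
      have := hstep i i.2
      simp only [g] at h1 h2
      omega
  · dsimp only
    refine Fin.cases ?_ (fun i => ?_) i
    · have h2 := hq 0
      simp only [Fin.val_zero, g0] at h2
      have h3 := hF.mult_zero
      have h4 := hG.mult_zero
      have h5 := hF'.mult_zero
      have h6 := hG'.mult_zero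
      have := hsum M le_rfl
      omega
    · have h2 := hq i.succ
      simp only [Fin.val_succ] at h2
      have h3 := hF.mult_succ i
      have h4 := hG.mult_succ i
      have h5 := hF'.mult_succ i
      have h6 := hG'.mult_succ i
      have := hstep i i.2
      have := hsum i i.2.le
      have := hsum (i + 1) i.2
      simp only [g] at h2
      omega

/-- The number of letters of `b` with index less than `i`. -/
def below {k : ℕ} (b : Crystal M k) (i : ℕ) : ℤ :=
  ∑ j ∈ Finset.univ.filter (fun j : Fin M => j.1 < i), (b.mult j : ℤ)

variable {k : ℕ}

theorem below_zero (b : Crystal M k) : b.below 0 = 0 := by simp [below]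

theorem below_self (b : Crystal M k) : b.below M = k := by
  have h1 : Finset.univ.filter (fun j : Fin M => j.1 < M) = Finset.univ := by
    ext j; simp
  rw [below, h1]
  exact_mod_cast b.sum_mult

theorem below_succ (b : Crystal M k) (i : Fin M) : b.below (i + 1) = b.below i + b.mult i := by
  have h1 : Finset.univ.filter (fun j : Fin M => j.1 < i + 1) =
      insert i (Finset.univ.filter fun j : Fin M => j.1 < i) := by
    ext j
    simp only [Finset.mem_filter, Finset.mem_univ, true_and, Finset.mem_insert, Fin.ext_iff]
    omega
  rw [below, h1, Finset.sum_insert (by simp), below]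
  ring

theorem below_mono (b : Crystal M k) : Monotone b.below := fun i j h =>
  Finset.sum_le_sum_of_subset_of_nonneg
    (fun x hx => by simp only [Finset.mem_filter, Finset.mem_univ, true_and] at hx ⊢; omega)
    fun _ _ _ => Int.natCast_nonneg _

theorem below_nonneg (b : Crystal M k) (i : ℕ) : 0 ≤ b.below i := by
  rw [← b.below_zero]; exact b.below_mono (Nat.zero_le i)

theorem below_le (b : Crystal M k) (i : ℕ) : b.below i ≤ k := by
  rw [← b.below_self]
  refine Finset.sum_le_sum_of_subset_of_nonneg (fun x hx => ?_) fun _ _ _ => Int.natCast_nonneg _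
  simp

/-- The counting function of the letters at the positions in `[s, t)` of the word of `b`. -/
def count (b : Crystal M k) (s t : ℤ) (i : ℕ) : ℤ := seg k (b.below i) s t

theorem isBallCount_count (b : Crystal M k) {s t : ℤ} (hst : s ≤ t) (h : t - s ≤ κ ∨ k ≤ κ) :
    IsBallCount M κ (b.count s t) where
  zero := by rw [count, below_zero, seg_zero]
  mono i hi := seg_mono (b.below_mono (Nat.le_succ i))
  le := by
    rw [count, below_self]
    have := seg_le_sub (l := k) (P := k) hst
    have := seg_le (l := k) (P := k) (s := s) (t := t) (by omega)
    omega

theorem count_of_le_zero (b : Crystal M k) {s t : ℤ} (ht : t ≤ 0) (i : ℕ) : b.count s t i = 0 :=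
  seg_of_le_zero (b.below_le i) ht

theorem count_of_length_le (b : Crystal M k) {s t : ℤ} (hs : k ≤ s) (i : ℕ) : b.count s t i = 0 :=
  seg_of_length_le hs

theorem count_full (b : Crystal M k) {s t : ℤ} (hs : s ≤ 0) (ht : k ≤ t) (i : ℕ) :
    b.count s t i = b.below i :=
  seg_full (b.below_nonneg i) (b.below_le i) hs ht

theorem count_congr (b : Crystal M k) {s t s' t' : ℤ} (hs : s = s' ∨ s ≤ 0 ∧ s' ≤ 0)
    (ht : t = t' ∨ k ≤ t ∧ k ≤ t') (i : ℕ) : b.count s t i = b.count s' t' i :=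
  seg_congr (b.below_nonneg i) (b.below_le i) hs ht

theorem combR_count_of_le (b : Crystal M k) (hθ : θ ≤ κ) (s : ℤ) :
    combR κ θ ((ofCount κ (b.count (s - min κ k) s), ofCount θ (b.count s (s + min θ k))) :
        Crystal (M + 1) κ × Crystal (M + 1) θ) =
      (ofCount θ (b.count (s - min κ k) (s - min κ k + min θ k)),
        ofCount κ (b.count (s - min κ k + min θ k) (s + min θ k))) := by
  refine combR_ofCount hθ (b.isBallCount_count (by omega) (by omega))
    (b.isBallCount_count (by omega) (by omega)) (b.isBallCount_count (by omega) (by omega))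
    (b.isBallCount_count (by omega) (by omega)) (fun i hi => ?_)
    -- The queue at the letter 1 is the maximum of the number of balls in the old cell and the
    -- number of empty places in the new cell.
    (h := max (seg k k s (s + min θ k)) (θ - seg k k (s - min κ k) (s - min κ k + min θ k)))
    (fun i hi => seg_collision (b.below_nonneg i) (b.below_mono (Nat.le_succ i)) (b.below_le _) (by omega)
      (by omega) (by omega) (by omega)) ?_
  · simp only [count]
    have h0 := b.below_nonneg i
    rw [seg_add h0 (by omega) (by omega), seg_add h0 (by omega) (by omega)]
  · simp only [count, below_self]
    unfold seg
    omega

/-- Local form of the motion of a soliton. -/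
theorem combR_count (b : Crystal M k) (κ θ : ℕ) (s : ℤ) :
    combR κ θ ((ofCount κ (b.count (s - min κ k) s), ofCount θ (b.count s (s + min θ k))) :
        Crystal (M + 1) κ × Crystal (M + 1) θ) =
      (ofCount θ (b.count (s - min κ k) (s - min κ k + min θ k)),
        ofCount κ (b.count (s - min κ k + min θ k) (s + min θ k))) := by
  rcases le_total θ κ with h | h
  · exact combR_count_of_le b h s
  -- For `κ ≤ θ` the inverse of `R` is used: carrier and cell exchange their roles, and the word is
  -- cut at the shifted position.
  · rw [combR_eq_comm]
    have := combR_count_of_le b h (s - min κ k + min θ k)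
    rwa [show s - ((min κ k : ℕ) : ℤ) + ((min θ k : ℕ) : ℤ) - ((min θ k : ℕ) : ℤ) = s - (min κ k : ℕ) by ring,
      show s - ((min κ k : ℕ) : ℤ) + ((min θ k : ℕ) : ℤ) + ((min κ k : ℕ) : ℤ) = s + (min θ k : ℕ) by ring,
      sub_add_cancel] at this

end Crystal

open Crystal

/-! ### Phases and free motion of two solitons -/

/-- `S` is the progress of a soliton of amplitude `i` measured in its own letters: it increases by
the number of its letters that fit into a cell. -/
def IsScale (Θ : ℤ → ℕ) (i : ℕ) (S : ℤ → ℤ) : Prop := ∀ n, S (n + 1) = S n + (min (Θ n) i : ℕ)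

namespace IsScale

variable {Θ : ℤ → ℕ} {i j : ℕ} {S S' : ℤ → ℤ}

theorem add_le (hS : IsScale Θ i S) (hΘ : ∀ n, 1 ≤ Θ n) (hi : 1 ≤ i) {m n : ℤ} (h : m ≤ n) :
    S m + (n - m) ≤ S n := by
  induction n, h using Int.leInduction with
  | base => omega
  | succ n hn ih =>
    have := hS n
    have := hΘ n
    omega

theorem mono (hS : IsScale Θ i S) (hΘ : ∀ n, 1 ≤ Θ n) (hi : 1 ≤ i) {m n : ℤ} (h : m ≤ n) :
    S m ≤ S n := by
  have := hS.add_le hΘ hi h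
  omega

theorem exists_forall_le (hS : IsScale Θ i S) (hΘ : ∀ n, 1 ≤ Θ n) (hi : 1 ≤ i) (X : ℤ) :
    ∃ A, ∀ n ≤ A, S n ≤ X := by
  refine ⟨min 0 (X - S 0), fun n hn => ?_⟩
  have := hS.add_le hΘ hi (show n ≤ 0 by omega)
  omega

theorem exists_forall_ge (hS : IsScale Θ i S) (hΘ : ∀ n, 1 ≤ Θ n) (hi : 1 ≤ i) (X : ℤ) :
    ∃ B, ∀ n ≥ B, X ≤ S n := by
  refine ⟨max 0 (X - S 0), fun n hn => ?_⟩
  have := hS.add_le hΘ hi (show 0 ≤ n by omega)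
  omega

theorem le_add (hS : IsScale Θ i S) (n : ℤ) : S n ≤ S (n + 1) ∧ S (n + 1) - S n ≤ Θ n := by
  have := hS n
  omega

end IsScale

/-- Solutions of the local equations give an evolution. -/
theorem isLatticeEvolution_of_count {M : ℕ} {Θ : ℤ → ℕ} {κ : ℕ} {F G G' : ℤ → ℕ → ℤ}
    (hA : ∃ A, ∀ n ≤ A, ∀ x ≤ M, F n x = 0) (hB : ∃ B, ∀ n ≥ B, ∀ x ≤ M, F n x = 0)
    (h : ∀ n, combR κ (Θ n) (ofCount κ (F n), ofCount (Θ n) (G n)) =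
      ((ofCount (Θ n) (G' n), ofCount κ (F (n + 1))) : Crystal (M + 1) _ × Crystal (M + 1) _)) :
    IsLatticeEvolution (M := M) κ (fun n => ofCount (Θ n) (G n)) fun n => ofCount (Θ n) (G' n) := by
  obtain ⟨A, hA⟩ := hA
  obtain ⟨B, hB⟩ := hB
  exact ⟨fun n => ofCount κ (F n), Set.finite_of_forall_not (A := A) (B := B)
    (fun n hn => not_not.2 (ofCount_eq_vac (hA n hn)))
    (fun n hn => not_not.2 (ofCount_eq_vac (hB n hn))), h⟩

section

variable {M i j : ℕ} {Θ : ℤ → ℕ} {S S' : ℤ → ℤ}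

theorem combR_soliton (hS : IsScale Θ i S) (b : Crystal M i) (κ : ℕ) (X n : ℤ) :
    combR κ (Θ n) ((ofCount κ (b.count (S n - X - (min κ i : ℕ)) (S n - X)),
        ofCount (Θ n) (b.count (S n - X) (S (n + 1) - X))) : Crystal (M + 1) κ × Crystal (M + 1) _) =
      (ofCount (Θ n) (b.count (S n - (X + (min κ i : ℕ))) (S (n + 1) - (X + (min κ i : ℕ)))),
        ofCount κ (b.count (S (n + 1) - X - (min κ i : ℕ)) (S (n + 1) - X))) := by
  have h := combR_count b κ (Θ n) (S n - X)
  have h1 := hS n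
  rwa [show S n - X + ((min (Θ n) i : ℕ) : ℤ) = S (n + 1) - X by omega,
    show S n - X - ((min κ i : ℕ) : ℤ) + ((min (Θ n) i : ℕ) : ℤ) =
      S (n + 1) - X - ((min κ i : ℕ) : ℤ) by omega,
    show (ofCount (Θ n) (b.count (S n - X - ((min κ i : ℕ) : ℤ)) (S (n + 1) - X - ((min κ i : ℕ) : ℤ))) : Crystal (M + 1) _) =
      ofCount (Θ n) (b.count (S n - (X + (min κ i : ℕ))) (S (n + 1) - (X + (min κ i : ℕ)))) by
      rw [sub_sub, sub_sub]] at h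

/-- The content of the cells of a state with two solitons at phases `X` and `Y`. -/
def pairCount (S S' : ℤ → ℤ) (b : Crystal M i) (c : Crystal M j) (X Y : ℤ) (n : ℤ) (x : ℕ) : ℤ :=
  b.count (S n - X) (S (n + 1) - X) x + c.count (S' n - Y) (S' (n + 1) - Y) x

/-- The content of the carrier that moves two solitons at phases `X` and `Y` freely. -/
def pairCarrier (S S' : ℤ → ℤ) (b : Crystal M i) (c : Crystal M j) (κ : ℕ) (X Y : ℤ) (n : ℤ)
    (x : ℕ) : ℤ :=
  b.count (S n - X - (min κ i : ℕ)) (S n - X) x + c.count (S' n - Y - (min κ j : ℕ)) (S' n - Y) x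

/-- A carrier of capacity `κ` moves the two solitons freely at the cell `n`. -/
def PairLocal (M : ℕ) (Θ : ℤ → ℕ) {M' : ℕ} (S S' : ℤ → ℤ) (b : Crystal M' i) (c : Crystal M' j)
    (κ : ℕ) (X Y n : ℤ) : Prop :=
  combR κ (Θ n) (ofCount κ (pairCarrier S S' b c κ X Y n), ofCount (Θ n) (pairCount S S' b c X Y n)) =
    ((ofCount (Θ n) (pairCount S S' b c (X + (min κ i : ℕ)) (Y + (min κ j : ℕ)) n),
      ofCount κ (pairCarrier S S' b c κ X Y (n + 1))) : Crystal (M + 1) _ × Crystal (M + 1) _)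

/-- The first soliton has no letter in the cell or in the carrier here, neither before nor after the
step, so the equation is that of the second soliton alone. -/
theorem pairLocal_of_right (hS : IsScale Θ i S) (hS' : IsScale Θ j S') (b : Crystal M i)
    (c : Crystal M j) (κ : ℕ) {X Y n : ℤ} (h : S (n + 1) ≤ X ∨ X + i + (min κ i : ℕ) ≤ S n) :
    PairLocal M Θ S S' b c κ X Y n := by
  have h1 := combR_soliton hS' c κ Y n
  have h2 := hS.le_add n
  have hz : ∀ s t x, t ≤ 0 ∨ (i : ℤ) ≤ s → b.count s t x = 0 := fun s t x h =>
    h.elim (fun h => b.count_of_le_zero h x) fun h => b.count_of_length_le h x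
  have e1 : pairCarrier S S' b c κ X Y n = c.count (S' n - Y - (min κ j : ℕ)) (S' n - Y) := by
    funext x; rw [pairCarrier, hz _ _ _ (by omega), zero_add]
  have e2 : pairCount S S' b c X Y n = c.count (S' n - Y) (S' (n + 1) - Y) := by
    funext x; rw [pairCount, hz _ _ _ (by omega), zero_add]
  have e3 : pairCount S S' b c (X + (min κ i : ℕ)) (Y + (min κ j : ℕ)) n =
      c.count (S' n - (Y + (min κ j : ℕ))) (S' (n + 1) - (Y + (min κ j : ℕ))) := by
    funext x; rw [pairCount, hz _ _ _ (by omega), zero_add]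
  have e4 : pairCarrier S S' b c κ X Y (n + 1) =
      c.count (S' (n + 1) - Y - (min κ j : ℕ)) (S' (n + 1) - Y) := by
    funext x; rw [pairCarrier, hz _ _ _ (by omega), zero_add]
  rw [PairLocal, e1, e2, e3, e4, h1]

theorem pairLocal_of_left (hS : IsScale Θ i S) (hS' : IsScale Θ j S') (b : Crystal M i)
    (c : Crystal M j) (κ : ℕ) {X Y n : ℤ} (h : S' (n + 1) ≤ Y ∨ Y + j + (min κ j : ℕ) ≤ S' n) :
    PairLocal M Θ S S' b c κ X Y n := by
  have h1 := combR_soliton hS b κ X n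
  have h2 := hS'.le_add n
  have hz : ∀ s t x, t ≤ 0 ∨ (j : ℤ) ≤ s → c.count s t x = 0 := fun s t x h =>
    h.elim (fun h => c.count_of_le_zero h x) fun h => c.count_of_length_le h x
  have e1 : pairCarrier S S' b c κ X Y n = b.count (S n - X - (min κ i : ℕ)) (S n - X) := by
    funext x; rw [pairCarrier, hz _ _ _ (by omega), add_zero]
  have e2 : pairCount S S' b c X Y n = b.count (S n - X) (S (n + 1) - X) := by
    funext x; rw [pairCount, hz _ _ _ (by omega), add_zero]
  have e3 : pairCount S S' b c (X + (min κ i : ℕ)) (Y + (min κ j : ℕ)) n =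
      b.count (S n - (X + (min κ i : ℕ))) (S (n + 1) - (X + (min κ i : ℕ))) := by
    funext x; rw [pairCount, hz _ _ _ (by omega), add_zero]
  have e4 : pairCarrier S S' b c κ X Y (n + 1) =
      b.count (S (n + 1) - X - (min κ i : ℕ)) (S (n + 1) - X) := by
    funext x; rw [pairCarrier, hz _ _ _ (by omega), add_zero]
  rw [PairLocal, e1, e2, e3, e4, h1]

/-- A state with two solitons at phases `X` and `Y`. -/
def pairState (M : ℕ) (Θ : ℤ → ℕ) (S S' : ℤ → ℤ) (b : Crystal M i) (c : Crystal M j) (X Y : ℤ) :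
    LatticeState M Θ := fun n => ofCount (Θ n) (pairCount S S' b c X Y n)

theorem pairCount_eq_zero (b : Crystal M i) (c : Crystal M j) {X Y n : ℤ}
    (h : S (n + 1) ≤ X ∨ X + i ≤ S n) (h' : S' (n + 1) ≤ Y ∨ Y + j ≤ S' n) (x : ℕ) :
    pairCount S S' b c X Y n x = 0 := by
  have h1 : b.count (S n - X) (S (n + 1) - X) x = 0 :=
    h.elim (fun h => b.count_of_le_zero (by omega) x) fun h => b.count_of_length_le (by omega) x
  have h2 : c.count (S' n - Y) (S' (n + 1) - Y) x = 0 :=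
    h'.elim (fun h => c.count_of_le_zero (by omega) x) fun h => c.count_of_length_le (by omega) x
  rw [pairCount, h1, h2, add_zero]

theorem pairCarrier_eq_zero (b : Crystal M i) (c : Crystal M j) {κ : ℕ} {X Y n : ℤ}
    (h : S n ≤ X ∨ X + 2 * i ≤ S n) (h' : S' n ≤ Y ∨ Y + 2 * j ≤ S' n) (x : ℕ) :
    pairCarrier S S' b c κ X Y n x = 0 := by
  have h1 : b.count (S n - X - (min κ i : ℕ)) (S n - X) x = 0 :=
    h.elim (fun h => b.count_of_le_zero (by omega) x) fun h => b.count_of_length_le (by omega) x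
  have h2 : c.count (S' n - Y - (min κ j : ℕ)) (S' n - Y) x = 0 :=
    h'.elim (fun h => c.count_of_le_zero (by omega) x) fun h => c.count_of_length_le (by omega) x
  rw [pairCarrier, h1, h2, add_zero]

theorem pairState_finite (hΘ : ∀ n, 1 ≤ Θ n) (hi : 1 ≤ i) (hj : 1 ≤ j) (hS : IsScale Θ i S)
    (hS' : IsScale Θ j S') (b : Crystal M i) (c : Crystal M j) (X Y : ℤ) :
    {n | pairState M Θ S S' b c X Y n ≠ vac (M + 1) (Θ n)}.Finite := by
  obtain ⟨A, hA⟩ := hS.exists_forall_le hΘ hi X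
  obtain ⟨A', hA'⟩ := hS'.exists_forall_le hΘ hj Y
  obtain ⟨B, hB⟩ := hS.exists_forall_ge hΘ hi (X + i)
  obtain ⟨B', hB'⟩ := hS'.exists_forall_ge hΘ hj (Y + j)
  exact Set.finite_of_forall_not (A := min A A' - 1) (B := max B B')
    (fun n hn => not_not.2 (ofCount_eq_vac fun x _ => pairCount_eq_zero b c
      (.inl (hA _ (by omega))) (.inl (hA' _ (by omega))) x))
    (fun n hn => not_not.2 (ofCount_eq_vac fun x _ => pairCount_eq_zero b c
      (.inr (hB _ (by omega))) (.inr (hB' _ (by omega))) x))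

/-- `pairState` as a finite state. -/
def pairFinite (hΘ : ∀ n, 1 ≤ Θ n) (hi : 1 ≤ i) (hj : 1 ≤ j) (hS : IsScale Θ i S)
    (hS' : IsScale Θ j S') (b : Crystal M i) (c : Crystal M j) (X Y : ℤ) : FiniteState M Θ :=
  ⟨pairState M Θ S S' b c X Y, pairState_finite hΘ hi hj hS hS' b c X Y⟩

theorem isLatticeEvolution_pair (hΘ : ∀ n, 1 ≤ Θ n) (hi : 1 ≤ i) (hj : 1 ≤ j) (hS : IsScale Θ i S)
    (hS' : IsScale Θ j S') (b : Crystal M i) (c : Crystal M j) (κ : ℕ) (X Y : ℤ)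
    (h : ∀ n, PairLocal M Θ S S' b c κ X Y n) :
    IsLatticeEvolution κ (pairState M Θ S S' b c X Y)
      (pairState M Θ S S' b c (X + (min κ i : ℕ)) (Y + (min κ j : ℕ))) := by
  obtain ⟨A, hA⟩ := hS.exists_forall_le hΘ hi X
  obtain ⟨A', hA'⟩ := hS'.exists_forall_le hΘ hj Y
  obtain ⟨B, hB⟩ := hS.exists_forall_ge hΘ hi (X + 2 * i)
  obtain ⟨B', hB'⟩ := hS'.exists_forall_ge hΘ hj (Y + 2 * j)
  exact isLatticeEvolution_of_count (F := pairCarrier S S' b c κ X Y)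
    ⟨min A A', fun n hn x _ => pairCarrier_eq_zero b c (.inl (hA n (by omega)))
      (.inl (hA' n (by omega))) x⟩
    ⟨max B B', fun n hn x _ => pairCarrier_eq_zero b c (.inr (hB n (by omega)))
      (.inr (hB' n (by omega))) x⟩ h

/-- A condition under which two solitons of amplitudes `i` and `j` at phases `X` and `Y`, in this
order, do not interact during the next step. -/
def IsApart (S S' : ℤ → ℤ) (i : ℕ) (X Y : ℤ) : Prop := ∃ n, X + 2 * i ≤ S n ∧ S' n ≤ Y

theorem IsApart.mono {X Y X' Y' : ℤ} (h : IsApart S S' i X Y) (hX : X' ≤ X) (hY : Y ≤ Y') :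
    IsApart S S' i X' Y' := by
  obtain ⟨n, h1, h2⟩ := h
  exact ⟨n, by omega, by omega⟩

/-- The cell that witnesses the separation cuts the lattice in two: to its left the second soliton
is absent, from it on the first one is. The margin `2 * i` covers the word and its displacement by
the carrier, which is at most `i`. -/
theorem IsApart.pairLocal (hΘ : ∀ n, 1 ≤ Θ n) (hi : 1 ≤ i) (hj : 1 ≤ j) (hS : IsScale Θ i S)
    (hS' : IsScale Θ j S') (b : Crystal M i) (c : Crystal M j) (κ : ℕ) {X Y : ℤ}
    (h : IsApart S S' i X Y) (n : ℤ) : PairLocal M Θ S S' b c κ X Y n := by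
  obtain ⟨m, h1, h2⟩ := h
  rcases le_or_gt m n with hn | hn
  · have := hS.mono hΘ hi hn
    exact pairLocal_of_right hS hS' b c κ (.inr (by omega))
  · have := hS'.mono hΘ hj (show n + 1 ≤ m by omega)
    exact pairLocal_of_left hS hS' b c κ (.inl (by omega))

theorem IsApart.evolve (hΘ : ∀ n, 1 ≤ Θ n) (hi : 1 ≤ i) (hj : 1 ≤ j) (hS : IsScale Θ i S)
    (hS' : IsScale Θ j S') (b : Crystal M i) (c : Crystal M j) (κ : ℕ) {X Y : ℤ}
    (h : IsApart S S' i X Y) :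
    FiniteState.evolve hΘ κ (pairFinite hΘ hi hj hS hS' b c X Y) =
      pairFinite hΘ hi hj hS hS' b c (X + (min κ i : ℕ)) (Y + (min κ j : ℕ)) :=
  FiniteState.evolve_eq hΘ (isLatticeEvolution_pair hΘ hi hj hS hS' b c κ X Y
    (h.pairLocal hΘ hi hj hS hS' b c κ))

/-- The total displacement of a soliton of amplitude `i` under a list of time evolutions. -/
def shift (i : ℕ) (O : List ℕ) : ℤ := (O.map fun κ => ((min κ i : ℕ) : ℤ)).sum

theorem shift_cons (i κ : ℕ) (O : List ℕ) : shift i (κ :: O) = (min κ i : ℕ) + shift i O := by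
  simp [shift]

theorem shift_nonneg (i : ℕ) (O : List ℕ) : 0 ≤ shift i O := by
  induction O with
  | nil => simp [shift]
  | cons κ O ih => rw [shift_cons]; omega

theorem IsApart.evolveList (hΘ : ∀ n, 1 ≤ Θ n) (hi : 1 ≤ i) (hj : 1 ≤ j) (hS : IsScale Θ i S)
    (hS' : IsScale Θ j S') (b : Crystal M i) (c : Crystal M j) (O : List ℕ) {X Y : ℤ}
    (h : IsApart S S' i (X + shift i O) Y) :
    FiniteState.evolveList hΘ O (pairFinite hΘ hi hj hS hS' b c X Y) =
      pairFinite hΘ hi hj hS hS' b c (X + shift i O) (Y + shift j O) := by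
  induction O generalizing X Y with
  | nil => simp [shift, FiniteState.evolveList]
  | cons κ O ih =>
    change FiniteState.evolveList hΘ O (FiniteState.evolve hΘ κ _) = _
    rw [shift_cons] at h
    have := shift_nonneg i O
    rw [IsApart.evolve hΘ hi hj hS hS' b c κ (h.mono (by omega) le_rfl),
      ih (h.mono (by omega) (by omega)), shift_cons, shift_cons, add_assoc, add_assoc]

/-- Two capacities that differ by one can displace the smaller soliton equally and the larger one by
amounts that differ by one; this changes the phase of the larger soliton alone. `T_1` moves both
phases by one and thereby gives the other phase as well. -/
theorem IsApart.related_sub_one_add_one (hM : 1 ≤ M) (hΘ : ∀ n, 1 ≤ Θ n) (hi : 1 ≤ i) (hj : 1 ≤ j)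
    (hS : IsScale Θ i S) (hS' : IsScale Θ j S') (hij : i ≠ j) (b : Crystal M i) (c : Crystal M j)
    {X Y : ℤ} (h : IsApart S S' i X Y) :
    FiniteState.Related hΘ (pairFinite hΘ hi hj hS hS' b c X Y)
      (pairFinite hΘ hi hj hS hS' b c (X - 1) Y) ∧
    FiniteState.Related hΘ (pairFinite hΘ hi hj hS hS' b c X Y)
      (pairFinite hΘ hi hj hS hS' b c X (Y + 1)) := by
  have h1 : IsApart S S' i (X - 1) Y := h.mono (by omega) le_rfl
  have diag : FiniteState.Related hΘ (pairFinite hΘ hi hj hS hS' b c (X - 1) Y)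
      (pairFinite hΘ hi hj hS hS' b c X (Y + 1)) := by
    refine ⟨[1], [], ?_⟩
    change FiniteState.evolve hΘ 1 _ = pairFinite hΘ hi hj hS hS' b c X (Y + 1)
    rw [h1.evolve hΘ hi hj hS hS' b c, min_eq_left hi, min_eq_left hj]
    congr 1
    omega
  rcases lt_or_gt_of_ne hij with hlt | hlt
  · have hu : FiniteState.Related hΘ (pairFinite hΘ hi hj hS hS' b c X Y)
        (pairFinite hΘ hi hj hS hS' b c X (Y + 1)) := by
      refine .of_evolve (i + 1) i ?_
      rw [h.evolve hΘ hi hj hS hS' b c, IsApart.evolve hΘ hi hj hS hS' b c _ (h.mono le_rfl (by omega))]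
      congr 1 <;> omega
    exact ⟨hu.trans hM diag.symm, hu⟩
  · have hu : FiniteState.Related hΘ (pairFinite hΘ hi hj hS hS' b c X Y)
        (pairFinite hΘ hi hj hS hS' b c (X - 1) Y) := by
      refine .of_evolve j (j + 1) ?_
      rw [h.evolve hΘ hi hj hS hS' b c, h1.evolve hΘ hi hj hS hS' b c]
      congr 1 <;> omega
    exact ⟨hu, hu.trans hM diag⟩

theorem IsApart.related_of_le (hM : 1 ≤ M) (hΘ : ∀ n, 1 ≤ Θ n) (hi : 1 ≤ i) (hj : 1 ≤ j)
    (hS : IsScale Θ i S) (hS' : IsScale Θ j S') (hij : i ≠ j) (b : Crystal M i) (c : Crystal M j)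
    {X Y X' Y' : ℤ} (h : IsApart S S' i X Y) (hX : X' ≤ X) (hY : Y ≤ Y') :
    FiniteState.Related hΘ (pairFinite hΘ hi hj hS hS' b c X Y)
      (pairFinite hΘ hi hj hS hS' b c X' Y') := by
  have h1 : FiniteState.Related hΘ (pairFinite hΘ hi hj hS hS' b c X Y)
      (pairFinite hΘ hi hj hS hS' b c X' Y) := by
    induction X', hX using Int.leInductionDown with
    | base => exact .refl _ _
    | pred n hn ih =>
      exact ih.trans hM (IsApart.related_sub_one_add_one hM hΘ hi hj hS hS' hij b c
        (h.mono hn le_rfl)).1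
  refine h1.trans hM ?_
  induction Y', hY using Int.leInduction with
  | base => exact .refl _ _
  | succ n hn ih =>
    exact ih.trans hM (IsApart.related_sub_one_add_one hM hΘ hi hj hS hS' hij b c (h.mono hX hn)).2

/-- All states in which two solitons with given labels are apart in a given order are related. -/
theorem IsApart.related (hM : 1 ≤ M) (hΘ : ∀ n, 1 ≤ Θ n) (hi : 1 ≤ i) (hj : 1 ≤ j)
    (hS : IsScale Θ i S) (hS' : IsScale Θ j S') (hij : i ≠ j) (b : Crystal M i) (c : Crystal M j)
    {X Y X' Y' : ℤ} (h : IsApart S S' i X Y) (h' : IsApart S S' i X' Y') :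
    FiniteState.Related hΘ (pairFinite hΘ hi hj hS hS' b c X Y)
      (pairFinite hΘ hi hj hS hS' b c X' Y') :=
  (h.related_of_le hM hΘ hi hj hS hS' hij b c (min_le_left X X') (le_max_left Y Y')).trans hM
    (h'.related_of_le hM hΘ hi hj hS hS' hij b c (min_le_right X X') (le_max_right Y Y')).symm

end

/-! ### The collision on wide cells -/

namespace Crystal

variable {M k l κ θ : ℕ} {F F' G G' : ℕ → ℤ}

/-- Collision of a carrier with a cell that has enough empty space. -/
theorem combR_ofCount_wide (hκ : κ ≤ θ) (hF : IsBallCount M κ F) (hG : IsBallCount M θ G)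
    (hG' : IsBallCount M θ G') (hF' : IsBallCount M κ F') (hsum : ∀ i ≤ M, F i + G i = G' i + F' i)
    (hwide : κ - F M ≤ θ - G' M)
    (hstep : ∀ i < M, F (i + 1) - F i =
      min (G' (i + 1) - G' i) (κ - F M + F (i + 1) - F' (i + 1))) :
    combR κ θ ((ofCount κ F, ofCount θ G) : Crystal (M + 1) κ × Crystal (M + 1) θ) =
      (ofCount θ G', ofCount κ F') := by
  rw [combR_eq_comm]
  exact combR_ofCount hκ hG' hF' hF hG (fun i hi => (hsum i hi).symm) hstep (by omega)

/-- The condition says that the queue of the inverse `R` never limits the service, so that the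
contents of carrier and cell are exchanged without change. -/
theorem combR_ofCount_swap (hκ : κ ≤ θ) (hF : IsBallCount M κ F) (hG : IsBallCount M κ G)
    (h : ∀ i < M, G (i + 1) ≤ κ - F M + F i) :
    combR κ θ ((ofCount κ F, ofCount θ G) : Crystal (M + 1) κ × Crystal (M + 1) θ) =
      (ofCount θ F, ofCount κ G) :=
  combR_ofCount_wide hκ hF ⟨hG.zero, hG.mono, by have := hG.le; omega⟩
    ⟨hF.zero, hF.mono, by have := hF.le; omega⟩ hG (fun _ _ => rfl) (by omega)
    fun i hi => by have := h i hi; omega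

/-- A collision in terms of the counting functions; `h` is the winding of the queue. -/
structure IsCollision (c' : Crystal M k) (b' : Crystal M l) (b : Crystal M l) (c : Crystal M k)
    (h : ℤ) : Prop where
  nonneg : 0 ≤ h
  le : h ≤ k
  sum : ∀ i ≤ M, c'.below i + b'.below i = b.below i + c.below i
  step : ∀ i < M, c'.below (i + 1) - c'.below i =
    min (b.below (i + 1) - b.below i) (h + c'.below (i + 1) - c.below (i + 1))
  -- The `h` smallest letters of `c` and of `b'` coincide. This lets the part of the right soliton
  -- that lies one cell further on be reinterpreted as a part of `c`.
  min_eq : ∀ i ≤ M, min h (c.below i) = min h (b'.below i)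

/-- The winding `h` is the length of the queue that passes from the first letter to the last one in
the queue algorithm for the inverse map. The queue at the other letters follows from it by
conservation. -/
theorem exists_isCollision [NeZero M] (hkl : k < l) {c' : Crystal M k} {b' : Crystal M l}
    {b : Crystal M l} {c : Crystal M k} (hR : combR k l (c', b') = (b, c)) :
    ∃ h, IsCollision c' b' b c h := by
  obtain ⟨q, hq, hp⟩ := (combR_eq_iff_of_lt hkl).1 (combR_eq_comm.1 hR)
  dsimp only at hq hp
  have hM : 0 < M := Nat.pos_of_ne_zero (NeZero.ne M)
  have key : ∀ i (hi : i < M), (q ⟨i, hi⟩ : ℤ) = q (0 - 1) + c'.below (i + 1) - c.below (i + 1) := by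
    intro i
    induction i with
    | zero =>
      intro hi
      have h0 : (⟨0, hi⟩ : Fin M) = 0 := Fin.ext (by simp)
      have h1 := below_succ c' ⟨0, hi⟩
      have h2 := below_succ c ⟨0, hi⟩
      have h3 := hq ⟨0, hi⟩
      have h4 := (hp ⟨0, hi⟩).1
      dsimp only at h1 h2
      rw [below_zero] at h1 h2
      rw [h0] at h1 h2 h3 h4 ⊢
      omega
    | succ i ih =>
      intro hi
      have h0 : (⟨i + 1, hi⟩ : Fin M) - 1 = ⟨i, by omega⟩ :=
        Fin.ext (by rw [val_sub_one _ (by simp)]; simp)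
      have h1 := below_succ c' ⟨i + 1, hi⟩
      have h2 := below_succ c ⟨i + 1, hi⟩
      have h3 := hq ⟨i + 1, hi⟩
      have h4 := (hp ⟨i + 1, hi⟩).1
      have h5 := ih (by omega)
      rw [h0] at h3
      dsimp only at h1 h2
      omega
  have hnn : (0 : ℤ) ≤ q (0 - 1) := by omega
  have hsum : ∀ i ≤ M, c'.below i + b'.below i = b.below i + c.below i := by
    intro i hi
    induction i with
    | zero => simp only [below_zero]
    | succ i ih =>
      have h1 := below_succ c' ⟨i, hi⟩
      have h2 := below_succ c ⟨i, hi⟩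
      have h3 := below_succ b' ⟨i, hi⟩
      have h4 := below_succ b ⟨i, hi⟩
      have h5 := (hp ⟨i, hi⟩).2
      have h6 := ih (by omega)
      dsimp only at h1 h2 h3 h4
      omega
  have hstep : ∀ i < M, c'.below (i + 1) - c'.below i =
      min (b.below (i + 1) - b.below i) (q (0 - 1) + c'.below (i + 1) - c.below (i + 1)) := by
    intro i hi
    have h1 := below_succ c' ⟨i, hi⟩
    have h4 := below_succ b ⟨i, hi⟩
    have h5 := (hp ⟨i, hi⟩).1
    have h6 := key i hi
    dsimp only at h1 h4
    omega
  -- As long as fewer than `h` letters of `c` have occurred, the queue is long enough to serve all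
  -- letters of `b`. Together with the conservation of letters this gives `min_eq`.
  have hle : ∀ i ≤ M, c'.below i ≤ b.below i ∧
      ((q (0 - 1) : ℤ) ≤ c.below i ∨ c'.below i = b.below i) := by
    intro i hi
    induction i with
    | zero => simp [below_zero]
    | succ i ih =>
      have h1 := ih (by omega)
      have h2 := hstep i hi
      have h3 := c'.below_nonneg i
      have h4 := c.below_mono (Nat.le_succ i)
      simp only [Nat.succ_eq_add_one] at h4
      omega
  refine ⟨q (0 - 1), hnn, ?_, hsum, hstep, fun i hi => ?_⟩
  · have := (hle M le_rfl).2
    rw [below_self, below_self, below_self] at this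
    omega
  · have := hle i hi
    have := hsum i hi
    omega

namespace IsCollision

variable {c' : Crystal M k} {b' : Crystal M l} {b : Crystal M l} {c : Crystal M k} {h : ℤ}

theorem below_sub_le (H : IsCollision c' b' b c h) {i : ℕ} (hi : i < M) :
    c.below (i + 1) - h ≤ c'.below i := by
  have := H.step i hi
  omega

theorem below_le_below (H : IsCollision c' b' b c h) {i : ℕ} (hi : i ≤ M) :
    c'.below i ≤ b.below i := by
  induction i with
  | zero => simp only [below_zero]; omega
  | succ i ih =>
    have := H.step i hi
    have := ih (by omega)
    omega

theorem sub_mono (H : IsCollision c' b' b c h) {i : ℕ} (hi : i ≤ M) :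
    b.below i - c'.below i ≤ l - k := by
  induction hi using Nat.decreasingInduction with
  | self => rw [below_self, below_self]
  | of_succ i hi ih =>
    have := H.step i hi
    omega

theorem below_le_add (H : IsCollision c' b' b c h) {i : ℕ} (hi : i < M) :
    b'.below (i + 1) ≤ l - k + h + c'.below i := by
  have h1 := H.sum (i + 1) hi
  have h2 := H.below_sub_le hi
  have h3 := H.sub_mono (show i + 1 ≤ M from hi)
  omega

/-- The carrier is full of balls, so in this cell the queue at the letter 1 has length zero and
there is no winding. Leaving the `h` smallest letters of `b'` and `c` out of the cell and the
carrier makes up for the winding in `R'`. -/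
theorem combR_eq (H : IsCollision c' b' b c h) (hkl : k < l) (hθ : k + l ≤ θ) :
    combR k θ ((ofCount k (c'.count 0 k), ofCount θ (b'.count (-h) (l - h))) :
      Crystal (M + 1) k × Crystal (M + 1) θ) =
      (ofCount θ (b.count 0 l), ofCount k (c.count (-h) (k - h))) := by
  have e1 : ∀ i, c'.count 0 k i = c'.below i := c'.count_full le_rfl le_rfl
  have e2 : ∀ i, b.count 0 l i = b.below i := b.count_full le_rfl le_rfl
  have e3 : ∀ i, b'.count (-h) (l - h) i = max 0 (b'.below i - h) := fun i => by
    have := H.nonneg; have := H.le; have := b'.below_le i; have := b'.below_nonneg i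
    unfold count seg; omega
  have e4 : ∀ i, c.count (-h) (k - h) i = max 0 (c.below i - h) := fun i => by
    have := H.nonneg; have := H.le; have := c.below_le i; have := c.below_nonneg i
    unfold count seg; omega
  refine combR_ofCount_wide (by omega) (c'.isBallCount_count (by omega) (by omega))
    (b'.isBallCount_count (by omega) (by omega)) (b.isBallCount_count (by omega) (by omega))
    (c.isBallCount_count (by omega) (by omega)) (fun i hi => ?_) ?_ (fun i hi => ?_)
  · rw [e1, e2, e3, e4]
    have := H.sum i hi
    have := H.min_eq i hi
    omega
  · rw [e1, e2, below_self, below_self]; omega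
  · rw [e1, e1, e1, e2, e2, e4, below_self]
    have := H.step i hi
    have := c'.below_nonneg i
    omega

end IsCollision

end Crystal

namespace Crystal.IsCollision

variable {M k l : ℕ} {c' : Crystal M k} {b' : Crystal M l} {b : Crystal M l} {c : Crystal M k}
  {h : ℤ} {Θ : ℤ → ℕ} {S S' : ℤ → ℤ}

/-- The smaller soliton is swallowed by the larger one, from the left. -/
theorem evolution_collide (H : IsCollision c' b' b c h) (hk : 1 ≤ k) (hkl : k < l)
    (hΘ : ∀ n, 1 ≤ Θ n) (hΘ1 : k + l ≤ Θ 1) (hS : IsScale Θ k S) (hS' : IsScale Θ l S')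
    (hSn : ∀ n : ℤ, 0 ≤ n → n ≤ 3 → S n = n * k) (hSn' : ∀ n : ℤ, 0 ≤ n → n ≤ 3 → S' n = n * l) :
    IsLatticeEvolution k (pairState M Θ S S' c' b' 0 (l + h))
      (pairState M Θ S' S b c l (2 * k + h)) := by
  have hh0 := H.nonneg
  have hhk := H.le
  have s1 := hSn 1 (by norm_num) (by norm_num)
  have s2 := hSn 2 (by norm_num) (by norm_num)
  have s3 := hSn 3 (by norm_num) (by norm_num)
  have s1' := hSn' 1 (by norm_num) (by norm_num)
  have s2' := hSn' 2 (by norm_num) (by norm_num)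
  have s3' := hSn' 3 (by norm_num) (by norm_num)
  have s0 := hSn 0 (by norm_num) (by norm_num)
  -- Up to cell 1 the carrier is the one that moves `c'` freely from phase `0`; behind cell 1 it is
  -- the one that moves `c` freely from phase `k + h`. The two are joined by the collision in cell
  -- 1.
  let F : ℤ → ℕ → ℤ := fun n => if n ≤ 1 then c'.count (S n - 0 - (min k k : ℕ)) (S n - 0)
    else c.count (S n - (k + h) - (min k k : ℕ)) (S n - (k + h))
  obtain ⟨B, hB⟩ := hS.exists_forall_ge hΘ hk (k + h + k + k)
  refine isLatticeEvolution_of_count (F := F) ⟨0, fun n hn x _ => ?_⟩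
    ⟨max B 2, fun n hn x _ => ?_⟩ fun n => ?_
  · simp only [F, if_pos (show n ≤ 1 by omega)]
    have := hS.mono hΘ hk hn
    exact c'.count_of_le_zero (by omega) x
  · simp only [F, if_neg (show ¬ n ≤ 1 by omega)]
    have := hB n (by omega)
    exact c.count_of_length_le (by omega) x
  · rcases lt_trichotomy n 1 with hn | rfl | hn
    · have m1 := hS.mono hΘ hk (show n + 1 ≤ 1 by omega)
      have m2 := hS'.mono hΘ (hk.trans hkl.le) (show n + 1 ≤ 1 by omega)
      have m3 := hS.le_add n
      have hloc := combR_soliton hS c' k 0 n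
      have e1 : pairCount S S' c' b' 0 (l + h) n = c'.count (S n - 0) (S (n + 1) - 0) := by
        funext x
        rw [pairCount, b'.count_of_le_zero (by omega), add_zero]
      have e2 : pairCount S' S b c l (2 * k + h) n =
          c'.count (S n - (0 + (min k k : ℕ))) (S (n + 1) - (0 + (min k k : ℕ))) := by
        funext x
        rw [pairCount, b.count_of_le_zero (by omega), c.count_of_le_zero (by omega),
          c'.count_of_le_zero (by omega), add_zero]
      rw [e1, e2]
      simp only [F, if_pos (show n ≤ 1 by omega), if_pos (show n + 1 ≤ 1 by omega)]
      exact hloc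
    · have hloc := H.combR_eq hkl hΘ1
      have e1 : pairCount S S' c' b' 0 (l + h) 1 = b'.count (-h) (l - h) := by
        funext x
        rw [pairCount, c'.count_of_length_le (by omega), zero_add]
        exact b'.count_congr (by omega) (.inl (by norm_num; omega)) x
      have e2 : pairCount S' S b c l (2 * k + h) 1 = b.count 0 l := by
        funext x
        rw [pairCount, c.count_of_le_zero (by norm_num; omega), add_zero]
        exact b.count_congr (by omega) (.inl (by norm_num; omega)) x
      have e3 : F 1 = c'.count 0 k := by
        funext x
        simp only [F, if_pos (le_refl (1 : ℤ))]
        exact c'.count_congr (by omega) (by omega) x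
      have e4 : F (1 + 1) = c.count (-h) (k - h) := by
        funext x
        simp only [F, if_neg (show ¬ (1 : ℤ) + 1 ≤ 1 by omega)]
        norm_num only
        exact c.count_congr (by omega) (by omega) x
      rw [e1, e2, e3, e4]
      exact hloc
    · have hloc := combR_soliton hS c k (k + h) n
      have m1 := hS.mono hΘ hk (show 2 ≤ n by omega)
      have m2 := hS'.mono hΘ (hk.trans hkl.le) (show 2 ≤ n by omega)
      have e2 : pairCount S' S b c l (2 * k + h) n =
          c.count (S n - (k + h + (min k k : ℕ))) (S (n + 1) - (k + h + (min k k : ℕ))) := by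
        funext x
        rw [pairCount, b.count_of_length_le (by omega), zero_add]
        exact c.count_congr (by omega) (by omega) x
      -- Cell 2 contains the last `h` letters of `b'`, which by `min_eq` are the last `h` letters of
      -- `c`. For the carrier this is a soliton with label `c` alone.
      have e1 : ∀ x ≤ M, pairCount S S' c' b' 0 (l + h) n x =
          c.count (S n - (k + h)) (S (n + 1) - (k + h)) x := by
        intro x hx
        rw [pairCount, c'.count_of_length_le (by omega), zero_add]
        rcases (show n = 2 ∨ 3 ≤ n by omega) with rfl | hn3
        · have hm := H.min_eq x hx
          have := c.below_le x
          have := c.below_nonneg x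
          have := b'.below_le x
          have := b'.below_nonneg x
          norm_num only
          unfold count seg
          omega
        · have m1 := hS.mono hΘ hk hn3
          have m2 := hS'.mono hΘ (hk.trans hkl.le) hn3
          rw [b'.count_of_length_le (by omega), c.count_of_length_le (by omega)]
      rw [e2, ofCount_congr e1]
      simp only [F, if_neg (show ¬ n ≤ 1 by omega), if_neg (show ¬ n + 1 ≤ 1 by omega)]
      exact hloc

/-- Before the collision the solitons still move freely when the smaller one has reached the last
cell in front of the larger one. -/
theorem evolution_before (H : IsCollision c' b' b c h) (hk : 1 ≤ k) (hkl : k < l)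
    (hΘ : ∀ n, 1 ≤ Θ n) (hΘ1 : k + l ≤ Θ 1) (hS : IsScale Θ k S) (hS' : IsScale Θ l S')
    (hSn : ∀ n : ℤ, 0 ≤ n → n ≤ 3 → S n = n * k) (hSn' : ∀ n : ℤ, 0 ≤ n → n ≤ 3 → S' n = n * l)
    {κ : ℕ} {Y : ℤ} (hκ : k ≤ κ) (hκl : κ ≤ l) (hY : l ≤ Y)
    (hYκ : 2 * l + h ≤ Y + κ) :
    IsLatticeEvolution κ (pairState M Θ S S' c' b' 0 Y)
      (pairState M Θ S S' c' b' k (Y + κ)) := by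
  have hh0 := H.nonneg
  have s1 := hSn 1 (by norm_num) (by norm_num)
  have s2 := hSn 2 (by norm_num) (by norm_num)
  have s1' := hSn' 1 (by norm_num) (by norm_num)
  have s2' := hSn' 2 (by norm_num) (by norm_num)
  have hmk : min κ k = k := min_eq_right hκ
  have hml : min κ l = κ := min_eq_left hκl
  have hev := isLatticeEvolution_pair hΘ hk (hk.trans hkl.le) hS hS' c' b' κ 0 Y fun n => by
    rcases lt_trichotomy n 1 with hn | rfl | hn
    · have m2 := hS'.mono hΘ (hk.trans hkl.le) (show n + 1 ≤ 1 by omega)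
      exact pairLocal_of_left hS hS' c' b' κ (.inl (by omega))
    · have e1 : pairCount S S' c' b' 0 Y 1 = b'.count (l - Y) (2 * l - Y) := by
        funext x
        rw [pairCount, c'.count_of_length_le (by omega), zero_add]
        exact b'.count_congr (by omega) (.inl (by norm_num; omega)) x
      have e2 : pairCount S S' c' b' (0 + (min κ k : ℕ)) (Y + (min κ l : ℕ)) 1 = c'.count 0 k := by
        funext x
        rw [pairCount, b'.count_of_le_zero (by norm_num only; omega), add_zero]
        exact c'.count_congr (by omega) (.inl (by norm_num only; omega)) x
      have e3 : pairCarrier S S' c' b' κ 0 Y 1 = c'.count 0 k := by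
        funext x
        rw [pairCarrier, b'.count_of_le_zero (by omega), add_zero]
        exact c'.count_congr (by omega) (by omega) x
      have e4 : pairCarrier S S' c' b' κ 0 Y (1 + 1) = b'.count (l - Y) (2 * l - Y) := by
        funext x
        rw [pairCarrier, c'.count_of_length_le (by norm_num only; omega), zero_add]
        norm_num only
        exact b'.count_congr (by omega) (by omega) x
      rw [PairLocal, e1, e2, e3, e4]
      -- In cell 1 the whole smaller soliton sits in the carrier and an initial part of the larger
      -- one in the cell; `R` just exchanges them.
      refine combR_ofCount_swap (by omega) (c'.isBallCount_count (by omega) (by omega)) ?_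
        fun i hi => ?_
      · refine ⟨(b'.isBallCount_count (κ := l) (by omega) (by omega)).zero,
          (b'.isBallCount_count (κ := l) (by omega) (by omega)).mono, ?_⟩
        unfold count seg
        rw [below_self]
        omega
      · have := H.below_le_add hi
        have := c'.below_nonneg i
        have := b'.below_le (i + 1)
        rw [c'.count_full le_rfl le_rfl, c'.count_full le_rfl le_rfl, below_self]
        unfold count seg
        omega
    · have m1 := hS.mono hΘ hk (show 2 ≤ n by omega)
      exact pairLocal_of_right hS hS' c' b' κ (.inr (by omega))
  rwa [hmk, hml, zero_add] at hev

/-- After the collision the solitons still move freely when the larger one is in the last cell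
before the smaller one. -/
theorem evolution_after (H : IsCollision c' b' b c h) (hk : 1 ≤ k) (hkl : k < l)
    (hΘ : ∀ n, 1 ≤ Θ n) (hΘ2 : k + l ≤ Θ 2) (hS : IsScale Θ k S) (hS' : IsScale Θ l S')
    (hSn : ∀ n : ℤ, 0 ≤ n → n ≤ 3 → S n = n * k) (hSn' : ∀ n : ℤ, 0 ≤ n → n ≤ 3 → S' n = n * l)
    {κ : ℕ} {X : ℤ} (hκ : k ≤ κ) (hκl : κ ≤ l) (hX : X ≤ l) (hXκ : l ≤ X + κ) :
    IsLatticeEvolution κ (pairState M Θ S' S b c X (2 * k + h))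
      (pairState M Θ S' S b c (X + κ) (3 * k + h)) := by
  have hh0 := H.nonneg
  have hhk := H.le
  have s2 := hSn 2 (by norm_num) (by norm_num)
  have s3 := hSn 3 (by norm_num) (by norm_num)
  have s2' := hSn' 2 (by norm_num) (by norm_num)
  have s3' := hSn' 3 (by norm_num) (by norm_num)
  have hmk : min κ k = k := min_eq_right hκ
  have hml : min κ l = κ := min_eq_left hκl
  have hev := isLatticeEvolution_pair hΘ (hk.trans hkl.le) hk hS' hS b c κ X (2 * k + h) fun n => by
    rcases lt_trichotomy n 2 with hn | rfl | hn
    · have m2 := hS.mono hΘ hk (show n + 1 ≤ 2 by omega)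
      exact pairLocal_of_left hS' hS b c κ (.inl (by omega))
    · have e1 : pairCount S' S b c X (2 * k + h) 2 = c.count (-h) (k - h) := by
        funext x
        rw [pairCount, b.count_of_length_le (by omega), zero_add]
        exact c.count_congr (by omega) (.inl (by norm_num only; omega)) x
      have e2 : pairCount S' S b c (X + (min κ l : ℕ)) (2 * k + h + (min κ k : ℕ)) 2 =
          b.count (2 * l - X - κ) l := by
        funext x
        rw [pairCount, c.count_of_le_zero (by norm_num only; omega), add_zero]
        norm_num only
        exact b.count_congr (by omega) (by omega) x
      have e3 : pairCarrier S' S b c κ X (2 * k + h) 2 = b.count (2 * l - X - κ) l := by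
        funext x
        rw [pairCarrier, c.count_of_le_zero (by omega), add_zero]
        exact b.count_congr (by omega) (by omega) x
      have e4 : pairCarrier S' S b c κ X (2 * k + h) (2 + 1) = c.count (-h) (k - h) := by
        funext x
        norm_num only
        rw [pairCarrier, b.count_of_length_le (by omega), zero_add]
        exact c.count_congr (by omega) (by omega) x
      rw [PairLocal, e1, e2, e3, e4]
      refine combR_ofCount_swap (by omega) (b.isBallCount_count (by omega) (by omega))
        (c.isBallCount_count (by omega) (by omega)) fun i hi => ?_
      have := H.below_sub_le hi
      have := H.below_le_below hi.le
      have := c'.below_le i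
      have := c.below_le (i + 1)
      have := c.below_nonneg (i + 1)
      have := b.below_nonneg i
      unfold count seg
      rw [below_self]
      omega
    · have m1 := hS'.mono hΘ (hk.trans hkl.le) (show 3 ≤ n by omega)
      exact pairLocal_of_right hS' hS b c κ (.inr (by omega))
  rwa [hmk, hml, show (2 * k + h + k : ℤ) = 3 * k + h by ring] at hev

/-- The collision starts and ends with solitons too close to be apart. Comparing `T_l` with
`T_(l-1)`, which still act freely there, moves the larger soliton to phase `2 * l` before and to
phase `0` after the collision, where separation holds. -/
theorem related (H : IsCollision c' b' b c h) (hM : 1 ≤ M) (hk : 1 ≤ k) (hkl : k < l)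
    (hΘ : ∀ n, 1 ≤ Θ n) (hΘ1 : k + l ≤ Θ 1) (hΘ2 : k + l ≤ Θ 2) (hS : IsScale Θ k S)
    (hS' : IsScale Θ l S') (hSn : ∀ n : ℤ, 0 ≤ n → n ≤ 3 → S n = n * k)
    (hSn' : ∀ n : ℤ, 0 ≤ n → n ≤ 3 → S' n = n * l) :
    FiniteState.Related hΘ (pairFinite hΘ hk (hk.trans hkl.le) hS hS' c' b' 0 (2 * l))
      (pairFinite hΘ (hk.trans hkl.le) hk hS' hS b c 0 (2 * k + h)) := by
  have before : ∀ Y : ℤ, l + h ≤ Y → Y ≤ 2 * l → FiniteState.Related hΘ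
      (pairFinite hΘ hk (hk.trans hkl.le) hS hS' c' b' 0 (l + h))
      (pairFinite hΘ hk (hk.trans hkl.le) hS hS' c' b' 0 Y) := by
    intro Y hY
    induction Y, hY using Int.leInduction with
    | base => exact fun _ => .refl _ _
    | succ Y hY ih =>
      intro hY2
      refine (ih (by omega)).trans hM (.of_evolve l (l - 1) ?_)
      have hh0 := H.nonneg
      have e1 := FiniteState.evolve_eq hΘ
        (p := pairFinite hΘ hk (hk.trans hkl.le) hS hS' c' b' 0 Y)
        (q := pairFinite hΘ hk (hk.trans hkl.le) hS hS' c' b' k (Y + l))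
        (H.evolution_before hk hkl hΘ hΘ1 hS hS' hSn hSn' hkl.le le_rfl (by omega)
          (by omega))
      have e2 := FiniteState.evolve_eq hΘ
        (p := pairFinite hΘ hk (hk.trans hkl.le) hS hS' c' b' 0 (Y + 1))
        (q := pairFinite hΘ hk (hk.trans hkl.le) hS hS' c' b' k (Y + 1 + (l - 1 : ℕ)))
        (H.evolution_before hk hkl hΘ hΘ1 hS hS' hSn hSn' (by omega) (by omega) (by omega)
          (by omega))
      rw [e1, e2]
      congr 1
      omega
  have after : ∀ X : ℤ, X ≤ l → 0 ≤ X → FiniteState.Related hΘ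
      (pairFinite hΘ (hk.trans hkl.le) hk hS' hS b c l (2 * k + h))
      (pairFinite hΘ (hk.trans hkl.le) hk hS' hS b c X (2 * k + h)) := by
    intro X hX
    induction X, hX using Int.leInductionDown with
    | base => exact fun _ => .refl _ _
    | pred X hX ih =>
      intro hX0
      refine (ih (by omega)).trans hM (.of_evolve (l - 1) l ?_)
      have e1 := FiniteState.evolve_eq hΘ
        (p := pairFinite hΘ (hk.trans hkl.le) hk hS' hS b c X (2 * k + h))
        (q := pairFinite hΘ (hk.trans hkl.le) hk hS' hS b c (X + (l - 1 : ℕ)) (3 * k + h))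
        (H.evolution_after hk hkl hΘ hΘ2 hS hS' hSn hSn' (by omega) (by omega) (by omega)
          (by omega))
      have e2 := FiniteState.evolve_eq hΘ
        (p := pairFinite hΘ (hk.trans hkl.le) hk hS' hS b c (X - 1) (2 * k + h))
        (q := pairFinite hΘ (hk.trans hkl.le) hk hS' hS b c (X - 1 + l) (3 * k + h))
        (H.evolution_after hk hkl hΘ hΘ2 hS hS' hSn hSn' (by omega) (by omega) (by omega)
          (by omega))
      rw [e1, e2]
      congr 1
      omega
  have hmid : FiniteState.Related hΘ
      (pairFinite hΘ hk (hk.trans hkl.le) hS hS' c' b' 0 (l + h))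
      (pairFinite hΘ (hk.trans hkl.le) hk hS' hS b c l (2 * k + h)) :=
    ⟨[k], [], FiniteState.evolve_eq hΘ (q := pairFinite hΘ (hk.trans hkl.le) hk hS' hS b c l (2 * k + h))
      (H.evolution_collide hk hkl hΘ hΘ1 hS hS' hSn hSn')⟩
  have hhk := H.le
  exact ((before (2 * l) (by omega) le_rfl).symm.trans hM hmid).trans hM
    (after 0 (by omega) le_rfl)

end Crystal.IsCollision

/-! ### Transfer from the wide lattice to the homogeneous one -/

theorem Crystal.combR_mult_congr {N k l l' : ℕ} [NeZero N] (hl : l = l') (x : Crystal N k)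
    {y : Crystal N l} {y' : Crystal N l'} (h : ∀ i, y.mult i = y'.mult i) :
    (combR k l (x, y)).2 = (combR k l' (x, y')).2 ∧
      ∀ i, (combR k l (x, y)).1.mult i = (combR k l' (x, y')).1.mult i := by
  subst hl
  rw [Crystal.ext h]
  exact ⟨rfl, fun _ => rfl⟩

section

variable {M : ℕ} {Θ Θ' : ℤ → ℕ} {A : ℤ}

/-- The states `p` and `p'`, possibly on different lattices, have the same content in the cells from
`A` on and are empty elsewhere. -/
structure Agree (A : ℤ) (p : LatticeState M Θ) (p' : LatticeState M Θ') : Prop where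
  left : ∀ n < A, p n = vac (M + 1) (Θ n)
  left' : ∀ n < A, p' n = vac (M + 1) (Θ' n)
  mult : ∀ n ≥ A, ∀ i, (p n).mult i = (p' n).mult i

theorem Agree.eq {p : LatticeState M Θ} {p' q' : LatticeState M Θ'} (h : Agree A p p')
    (h' : Agree A p q') : p' = q' := by
  funext n
  rcases lt_or_ge n A with hn | hn
  · rw [h.left' n hn, h'.left' n hn]
  · exact Crystal.ext fun i => by rw [← h.mult n hn i, h'.mult n hn i]

theorem carrier_eq_vac {κ : ℕ} {p p' : LatticeState M Θ} {v : ℤ → Crystal (M + 1) κ}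
    (hv : {n | v n ≠ vac (M + 1) κ}.Finite)
    (h : ∀ n, combR κ (Θ n) (v n, p n) = (p' n, v (n + 1)))
    (hp : ∀ n < A, p n = vac (M + 1) (Θ n)) : ∀ n ≤ A, v n = vac (M + 1) κ := by
  obtain ⟨B, hB⟩ := hv.exists_forall_le_not.1
  simp only [Set.mem_ofPred_eq, not_not] at hB
  intro n hn
  rcases le_total n B with hnB | hnB
  · exact hB n hnB
  · induction n, hnB using Int.leInduction with
    | base => exact hB B le_rfl
    | succ n hnB ih =>
      have h1 := h n
      rw [ih (by omega), hp n (by omega), combR_vac] at h1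
      exact (Prod.ext_iff.1 h1).2.symm

/-- Both carriers reach cell `A` empty and meet the same cells from there on, so the different
capacities to the left of `A` have no influence. -/
theorem Agree.evolution {κ : ℕ} (hΘ : ∀ n ≥ A, Θ n = Θ' n) {p q : LatticeState M Θ}
    {p' q' : LatticeState M Θ'} (h : Agree A p p') (hq : IsLatticeEvolution κ p q)
    (hq' : IsLatticeEvolution κ p' q') : Agree A q q' := by
  obtain ⟨v, hv, hq⟩ := hq
  obtain ⟨v', hv', hq'⟩ := hq'
  have v0 := carrier_eq_vac hv hq h.left
  have v0' := carrier_eq_vac hv' hq' h.left'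
  have hvv : ∀ n ≥ A, v n = v' n := by
    intro n hn
    induction n, hn using Int.leInduction with
    | base => rw [v0 A le_rfl, v0' A le_rfl]
    | succ n hn ih =>
      have h1 := (combR_mult_congr (hΘ n hn) (v n) (h.mult n hn)).1
      rw [hq, ih, hq'] at h1
      exact h1
  refine ⟨fun n hn => ?_, fun n hn => ?_, fun n hn i => ?_⟩
  · have h1 := hq n
    rw [v0 n hn.le, h.left n hn, combR_vac] at h1
    exact (Prod.ext_iff.1 h1).1.symm
  · have h1 := hq' n
    rw [v0' n hn.le, h.left' n hn, combR_vac] at h1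
    exact (Prod.ext_iff.1 h1).1.symm
  · have h1 := (combR_mult_congr (hΘ n hn) (v n) (h.mult n hn)).2 i
    rw [hq, hvv n hn, hq'] at h1
    exact h1

theorem Agree.evolveList (hΘ : ∀ n ≥ A, Θ n = Θ' n) (h1 : ∀ n, 1 ≤ Θ n) (h1' : ∀ n, 1 ≤ Θ' n)
    (O : List ℕ) {p : FiniteState M Θ} {p' : FiniteState M Θ'} (h : Agree A p.1 p'.1) :
    Agree A (FiniteState.evolveList h1 O p).1 (FiniteState.evolveList h1' O p').1 := by
  induction O generalizing p p' with
  | nil => exact h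
  | cons κ O ih =>
    exact ih (h.evolution hΘ (FiniteState.isLatticeEvolution_evolve h1 κ p)
      (FiniteState.isLatticeEvolution_evolve h1' κ p'))

theorem Agree.related (hΘ : ∀ n ≥ A, Θ n = Θ' n) {h1 : ∀ n, 1 ≤ Θ n} {h1' : ∀ n, 1 ≤ Θ' n}
    {p q : FiniteState M Θ} {p' q' : FiniteState M Θ'} (hp : Agree A p.1 p'.1)
    (hq : Agree A q.1 q'.1) (h : FiniteState.Related h1 p q) : FiniteState.Related h1' p' q' := by
  obtain ⟨O, O', h⟩ := h
  refine ⟨O, O', Subtype.ext ((hp.evolveList hΘ h1 h1' O).eq ?_)⟩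
  rw [h]
  exact hq.evolveList hΘ h1 h1' O'

/-- The cells in front of position `3` have capacity `W`, the other ones capacity `θ`. -/
def wideLattice (W θ : ℕ) (n : ℤ) : ℕ := if n < 3 then W else θ

/-- The scale of a soliton on `wideLattice`. -/
def wideScale (θ i : ℕ) (n : ℤ) : ℤ := if n ≤ 3 then n * i else 3 * i + (n - 3) * (min θ i : ℕ)

theorem isScale_wide {W θ i : ℕ} (hW : i ≤ W) :
    IsScale (wideLattice W θ) i (wideScale θ i) := by
  intro n
  unfold wideLattice wideScale
  rcases lt_trichotomy n 2 with h | rfl | h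
  · rw [if_pos (by omega), if_pos (by omega), if_pos (by omega), min_eq_right hW]; ring
  · norm_num [hW]; ring
  · rw [if_neg (by omega), if_neg (show ¬ n < 3 by omega)]
    split_ifs with h3
    · obtain rfl : n = 3 := by omega
      ring
    · ring

/-- The scale of a soliton of amplitude `i` on the homogeneous lattice. -/
def scale (θ i : ℕ) (n : ℤ) : ℤ := n * (min θ i : ℕ)

theorem isScale_scale (θ i : ℕ) : IsScale (fun _ => θ) i (scale θ i) := fun n => by
  unfold scale; ring

/-- From cell 3 on the two scales differ by the constant `3 * i - 3 * min θ i`, so equal contents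
correspond to phases shifted by this constant. -/
theorem agree_pairState {W θ i j : ℕ} (hθ : 1 ≤ θ) (hi : 1 ≤ i) (hj : 1 ≤ j) (hW : i ≤ W)
    (hW' : j ≤ W) (b : Crystal M i) (c : Crystal M j) {X Y X' Y' : ℤ}
    (hX : 3 * (i : ℤ) ≤ X) (hY : 3 * (j : ℤ) ≤ Y)
    (hX' : X' = X - 3 * i + 3 * (min θ i : ℕ)) (hY' : Y' = Y - 3 * j + 3 * (min θ j : ℕ)) :
    Agree 3 (pairState M (wideLattice W θ) (wideScale θ i) (wideScale θ j) b c X Y)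
      (pairState M (fun _ => θ) (scale θ i) (scale θ j) b c X' Y') := by
  have h1 : ∀ n, 1 ≤ wideLattice W θ n := fun n => by unfold wideLattice; split_ifs <;> omega
  have e : ∀ i n, 3 ≤ n → wideScale θ i n = scale θ i n + 3 * i - 3 * (min θ i : ℕ) := by
    intro i n hn
    unfold wideScale scale
    split_ifs with h
    · obtain rfl : n = 3 := by omega
      ring
    · ring
  have w3 : ∀ i, wideScale θ i 3 = 3 * i := fun i => by norm_num [wideScale]
  have z3 : ∀ i, scale θ i 3 = 3 * (min θ i : ℕ) := fun i => rfl
  refine ⟨fun n hn => ofCount_eq_vac fun x _ => pairCount_eq_zero b c (.inl ?_) (.inl ?_) x,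
    fun n hn => ofCount_eq_vac fun x _ => pairCount_eq_zero b c (.inl ?_) (.inl ?_) x,
    fun n hn x => ?_⟩
  · have := (isScale_wide (θ := θ) hW).mono h1 hi (show n + 1 ≤ 3 by omega)
    rw [w3] at this; omega
  · have := (isScale_wide (θ := θ) hW').mono h1 hj (show n + 1 ≤ 3 by omega)
    rw [w3] at this; omega
  · have := (isScale_scale θ i).mono (fun _ => hθ) hi (show n + 1 ≤ 3 by omega)
    rw [z3] at this; omega
  · have := (isScale_scale θ j).mono (fun _ => hθ) hj (show n + 1 ≤ 3 by omega)
    rw [z3] at this; omega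
  · have hc : ∀ x, pairCount (wideScale θ i) (wideScale θ j) b c X Y n x =
        pairCount (scale θ i) (scale θ j) b c X' Y' n x := fun x => by
      have a1 := e i n hn
      have a2 := e i (n + 1) (by omega)
      have a3 := e j n hn
      have a4 := e j (n + 1) (by omega)
      unfold pairCount
      congr 1
      · exact b.count_congr (.inl (by omega)) (.inl (by omega)) x
      · exact c.count_congr (.inl (by omega)) (.inl (by omega)) x
    unfold pairState wideLattice
    rw [if_neg (by omega), ofCount_congr fun x _ => hc x]

/-- On the homogeneous lattice the states with two solitons apart are related to those with the
solitons in the opposite order and with labels transformed by the combinatorial `R` matrix. -/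
theorem related_scattered [NeZero M] {k l θ : ℕ} (hk : 1 ≤ k) (hkl : k < l) (hθ : 1 ≤ θ)
    {c' : Crystal M k} {b' b : Crystal M l} {c : Crystal M k} (hR : combR k l (c', b') = (b, c))
    {X Y X' Y' : ℤ} (h : IsApart (scale θ k) (scale θ l) k X Y)
    (h' : IsApart (scale θ l) (scale θ k) l X' Y') :
    FiniteState.Related (fun _ => hθ)
      (pairFinite (fun _ => hθ) hk (hk.trans hkl.le) (isScale_scale θ k) (isScale_scale θ l) c' b' X Y)
      (pairFinite (fun _ => hθ) (hk.trans hkl.le) hk (isScale_scale θ l) (isScale_scale θ k) b c X' Y') := by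
  have hM : 1 ≤ M := Nat.pos_of_ne_zero (NeZero.ne M)
  have hl : 1 ≤ l := hk.trans hkl.le
  obtain ⟨w, H⟩ := exists_isCollision hkl hR
  let W := k + l
  have h1 : ∀ n, 1 ≤ wideLattice W θ n := fun n => by unfold wideLattice; split_ifs <;> omega
  have sk := isScale_wide (θ := θ) (show k ≤ W by omega)
  have sl := isScale_wide (θ := θ) (show l ≤ W by omega)
  have hw : ∀ i, ∀ n : ℤ, 0 ≤ n → n ≤ 3 → wideScale θ i n = n * i := fun i n _ hn => if_pos hn
  have base := H.related hM hk hkl h1 (by simp [wideLattice, W]) (by simp [wideLattice, W]) sk sl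
    (hw k) (hw l)
  have w3 : ∀ i, wideScale θ i 3 = 3 * i := fun i => by norm_num [wideScale]
  have z3 : ∀ i, scale θ i 3 = 3 * (min θ i : ℕ) := fun i => rfl
  have tail : ∀ i j, 1 ≤ i → 1 ≤ j → i ≤ W → j ≤ W → ∃ Y : ℤ, 3 * (j : ℤ) ≤ Y ∧
      IsApart (wideScale θ i) (wideScale θ j) i (3 * i) Y ∧
      IsApart (scale θ i) (scale θ j) i (3 * (min θ i : ℕ)) (Y - 3 * j + 3 * (min θ j : ℕ)) := by
    intro i j hi hj hiW hjW
    -- Every cell advances a scale by at least one, so the margin `2 * i` is reached after `2 * i`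
    -- cells; `Y` is taken beyond that cell on both lattices.
    refine ⟨max (wideScale θ j (3 + 2 * i)) (scale θ j (3 + 2 * i) + 3 * j), ?_, ⟨3 + 2 * i, ?_, ?_⟩,
      ⟨3 + 2 * i, ?_, ?_⟩⟩
    · have := (isScale_wide (θ := θ) hjW).mono h1 hj (show 3 ≤ 3 + 2 * (i : ℤ) by omega)
      rw [w3] at this
      omega
    · have := (isScale_wide (θ := θ) hiW).add_le h1 hi (show 3 ≤ 3 + 2 * (i : ℤ) by omega)
      rw [w3] at this
      omega
    · omega
    · have := (isScale_scale θ i).add_le (fun _ => hθ) hi (show 3 ≤ 3 + 2 * (i : ℤ) by omega)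
      rw [z3] at this
      omega
    · omega
  obtain ⟨Y1, y1, a1, a1'⟩ := tail k l hk hl (by omega) (by omega)
  obtain ⟨Y2, y2, a2, a2'⟩ := tail l k hl hk (by omega) (by omega)
  have hh0 := H.nonneg
  have b1 : IsApart (wideScale θ k) (wideScale θ l) k 0 (2 * l) :=
    ⟨2, by rw [hw k 2 (by norm_num) (by norm_num)]; omega,
      by rw [hw l 2 (by norm_num) (by norm_num)]⟩
  have b2 : IsApart (wideScale θ l) (wideScale θ k) l 0 (2 * k + w) :=
    ⟨2, by rw [hw l 2 (by norm_num) (by norm_num)]; omega,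
      by rw [hw k 2 (by norm_num) (by norm_num)]; omega⟩
  -- On the wide lattice both ends of the collision are moved to states supported in the cells `≥
  -- 3`, to which the comparison of lattices applies.
  have base' := ((a1.related hM h1 hk hl sk sl hkl.ne c' b' b1).trans hM base).trans hM
    (b2.related hM h1 hl hk sl sk hkl.ne' b c a2)
  have mid := Agree.related (h1' := fun _ => hθ) (A := 3) (Θ' := fun _ => θ)
    (p' := pairFinite (fun _ => hθ) hk hl (isScale_scale θ k) (isScale_scale θ l) c' b' _ _)
    (q' := pairFinite (fun _ => hθ) hl hk (isScale_scale θ l) (isScale_scale θ k) b c _ _)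
    (fun n hn => if_neg (by omega))
    (agree_pairState hθ hk hl (by omega) (by omega) c' b' (X' := 3 * (min θ k : ℕ)) le_rfl y1
      (by ring) rfl)
    (agree_pairState hθ hl hk (by omega) (by omega) b c (X' := 3 * (min θ l : ℕ)) le_rfl y2
      (by ring) rfl) base'
  exact ((h.related hM (fun _ => hθ) hk hl (isScale_scale θ k) (isScale_scale θ l) hkl.ne c' b' a1').trans
    hM mid).trans hM
    (a2'.related hM (fun _ => hθ) hl hk (isScale_scale θ l) (isScale_scale θ k) hkl.ne' b c h')

end

/-! ### Separation in the course of time -/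

section

variable {M i j θ : ℕ}

/-- Two solitons at phases `X` and `Y`, the first one of amplitude `i`, are apart and at least `D`
cells from each other. -/
def HasGap (θ i j D : ℕ) (X Y : ℤ) : Prop :=
  ∃ n : ℤ, X + 2 * i ≤ scale θ i n ∧ scale θ j (n + D) ≤ Y

theorem scale_mono (θ i : ℕ) : Monotone (scale θ i) := fun _ _ h =>
  mul_le_mul_of_nonneg_right h (Int.natCast_nonneg _)

theorem HasGap.isApart {D : ℕ} {X Y : ℤ} (h : HasGap θ i j D X Y) :
    IsApart (scale θ i) (scale θ j) i X Y := by
  obtain ⟨n, h1, h2⟩ := h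
  exact ⟨n, h1, (scale_mono θ j (by omega)).trans h2⟩

theorem HasGap.mono {D : ℕ} {X Y X' Y' : ℤ} (h : HasGap θ i j D X Y) (hX : X' ≤ X) (hY : Y ≤ Y') :
    HasGap θ i j D X' Y' := by
  obtain ⟨n, h1, h2⟩ := h
  exact ⟨n, by omega, by omega⟩

/-- Phases on the two scales are compared after division by the advance per cell; the extra `1` in
`D + 1` pays for rounding up to a whole cell. -/
theorem hasGap_of_le (hθ : 1 ≤ θ) (hi : 1 ≤ i) {D : ℕ} {X Y : ℤ}
    (h : (min θ j : ℕ) * (X + 2 * i + (min θ i : ℕ) * (D + 1)) ≤ (min θ i : ℕ) * Y) :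
    HasGap θ i j D X Y := by
  have hw : (1 : ℤ) ≤ (min θ i : ℕ) := by omega
  set w : ℤ := Nat.cast (min θ i)
  have hw' : (0 : ℤ) ≤ (min θ j : ℕ) := Int.natCast_nonneg _
  set w' : ℤ := Nat.cast (min θ j)
  set n : ℤ := (X + 2 * i) / w
  have h1 : n * w ≤ X + 2 * i := Int.ediv_mul_le _ (by omega)
  have h2 : X + 2 * i < (n + 1) * w := Int.lt_ediv_add_one_mul_self _ (by omega)
  refine ⟨n + 1, h2.le, ?_⟩
  change (n + 1 + D) * w' ≤ Y
  have h3 : w * ((n + 1 + D) * w') ≤ w * Y :=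
    calc w * ((n + 1 + D) * w') = w' * (n * w + w * (D + 1)) := by ring
      _ ≤ w' * (X + 2 * i + w * (D + 1)) := by gcongr
      _ ≤ w * Y := h
  exact le_of_mul_le_mul_left h3 (by omega)

/-- A state related to one with two solitons in the order of increasing speed finally becomes such a
state, with an arbitrarily large distance of the solitons. -/
theorem eventually_pair (hM : 1 ≤ M) (hθ : 1 ≤ θ) (hi : 1 ≤ i) (hj : 1 ≤ j) {κ : ℕ}
    (hspeed : min θ j * min κ i < min θ i * min κ j) (b : Crystal M i) (c : Crystal M j)
    {q : FiniteState M fun _ => θ}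
    (hq : ∀ X Y, IsApart (scale θ i) (scale θ j) i X Y → FiniteState.Related (fun _ => hθ) q
      (pairFinite (fun _ => hθ) hi hj (isScale_scale θ i) (isScale_scale θ j) b c X Y)) (D : ℕ) :
    ∃ t₀ : ℕ, ∀ t ≥ t₀, ∃ X Y, HasGap θ i j D X Y ∧ (FiniteState.evolve (fun _ => hθ) κ)^[t] q =
      pairFinite (fun _ => hθ) hi hj (isScale_scale θ i) (isScale_scale θ j) b c X Y := by
  set hΘ : ∀ _ : ℤ, 1 ≤ θ := fun _ => hθ
  set P := pairFinite hΘ hi hj (isScale_scale θ i) (isScale_scale θ j) b c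
  have hsp : ((min θ j : ℕ) : ℤ) * (min κ i : ℕ) + 1 ≤ (min θ i : ℕ) * (min κ j : ℕ) := by
    exact_mod_cast hspeed
  set w : ℤ := Nat.cast (min θ i) with hw
  set w' : ℤ := Nat.cast (min θ j) with hw'
  have hw1 : 1 ≤ w := by omega
  have hw1' : 1 ≤ w' := by omega
  set u : ℤ := Nat.cast (min κ i) with hu
  set u' : ℤ := Nat.cast (min κ j) with hu'
  -- Chosen so that the pair at phases `0` and `Y₀` satisfies the criterion for a gap; it then
  -- persists, since the second soliton is faster.
  set Y₀ : ℤ := w' * (2 * i + w) with hY₀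
  have gap : ∀ (E : ℕ) (X Y : ℤ), w' * (X + 2 * i + w * (E + 1)) ≤ w * Y → HasGap θ i j E X Y :=
    fun E X Y h => hasGap_of_le hθ hi h
  have apart : ∀ t : ℕ, IsApart (scale θ i) (scale θ j) i (t * u) (Y₀ + t * u') := by
    intro t
    refine (gap 0 _ _ ?_).isApart
    have h1 : (0 : ℤ) ≤ t * (w * u' - w' * u) := mul_nonneg (by omega) (by omega)
    have h2 : (0 : ℤ) ≤ (w - 1) * Y₀ := mul_nonneg (by omega) (by positivity)
    simp only [hY₀] at h2 ⊢
    push_cast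
    linarith
  obtain ⟨O, O', hO⟩ := hq 0 Y₀ (by simpa using apart 0)
  change FiniteState.evolveList hΘ O q = FiniteState.evolveList hΘ O' (P 0 Y₀) at hO
  have iter : ∀ t : ℕ, (FiniteState.evolve hΘ κ)^[t] (P 0 Y₀) = P (t * u) (Y₀ + t * u') := by
    intro t
    induction t with
    | zero => simp
    | succ t ih =>
      rw [Function.iterate_succ_apply', ih]
      refine ((apart t).evolve hΘ hi hj (isScale_scale θ i) (isScale_scale θ j) b c κ).trans ?_
      change P _ _ = P _ _
      congr 1 <;> rw [Nat.cast_succ] <;> ring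
  have hs := shift_nonneg i O
  have hs' := shift_nonneg j O
  have hr := shift_nonneg i O'
  have hr' := shift_nonneg j O'
  -- The normalised distance grows by at least one per step, so after `K` steps it outweighs the
  -- displacements by `O` and `O'` together with the required gap.
  set K : ℤ := w' * (shift i O' + 2 * i + w * (D + 1)) - w * (Y₀ - shift j O) with hK
  refine ⟨K.toNat, fun t ht => ⟨t * u + shift i O' - shift i O, Y₀ + t * u' + shift j O' - shift j O, ?_⟩⟩
  have hg : HasGap θ i j D (t * u + shift i O') (Y₀ + t * u' - shift j O) := by
    refine gap _ _ _ ?_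
    have h1 : (0 : ℤ) ≤ t * (w * u' - w' * u - 1) := mul_nonneg (by omega) (by omega)
    have h2 : K ≤ t := by omega
    simp only [hK] at h2
    linarith
  -- Both states are compared after applying `O`. This commutes with the time evolution, turns `q`
  -- into `O'` of the free pair, and the resulting displacements agree; injectivity cancels `O`.
  refine ⟨hg.mono (by omega) (by omega), FiniteState.evolveList_injective hΘ O ?_⟩
  rw [FiniteState.evolveList_iterate hΘ hM, hO, ← FiniteState.evolveList_iterate hΘ hM, iter]
  have e1 := IsApart.evolveList hΘ hi hj (isScale_scale θ i) (isScale_scale θ j) b c O'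
    (X := t * u) (Y := Y₀ + t * u') (hg.isApart.mono le_rfl (by omega))
  have e2 := IsApart.evolveList hΘ hi hj (isScale_scale θ i) (isScale_scale θ j) b c O
    (X := t * u + shift i O' - shift i O) (Y := Y₀ + t * u' + shift j O' - shift j O)
    (hg.isApart.mono (by omega) (by omega))
  refine e1.trans (Eq.trans ?_ e2.symm)
  change P _ _ = P _ _
  congr 1 <;> ring

end

/-! ### From words at positions to phases -/

theorem List.getElem?_flatMap_replicate {M : ℕ} (f : Fin M → ℕ) (m : ℕ) (i : Fin M) :
    ((List.finRange M).flatMap fun i => List.replicate (f i) i)[m]? = some i ↔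
      (∑ j, if j < i then f j else 0) ≤ m ∧ m < (∑ j, if j < i then f j else 0) + f i := by
  induction M generalizing m with
  | zero => exact i.elim0
  | succ M ih =>
    have hrec : ((List.finRange (M + 1)).flatMap fun i => List.replicate (f i) i) =
        List.replicate (f 0) 0 ++
          ((List.finRange M).flatMap fun i => List.replicate (f i.succ) i).map Fin.succ := by
      rw [List.finRange_succ, List.flatMap_cons, List.flatMap_map, List.map_flatMap]
      simp
    rw [hrec, List.getElem?_append, List.length_replicate]
    split_ifs with h
    · rw [List.getElem?_replicate, if_pos h]
      refine Fin.cases ?_ (fun i => ?_) i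
      · simp [h]
      · rw [Fin.sum_univ_succ, if_pos (Fin.succ_pos i)]
        simp only [Option.some.injEq, (Fin.succ_ne_zero i).symm, false_iff]
        omega
    · rw [List.getElem?_map]
      refine Fin.cases ?_ (fun i => ?_) i
      · simp [h, Option.map_eq_some_iff, Fin.succ_ne_zero]
      · rw [Fin.sum_univ_succ, if_pos (Fin.succ_pos i)]
        have := ih (fun i => f i.succ) (m - f 0) i
        simp only [Fin.succ_lt_succ_iff]
        rw [Option.map_eq_some_iff]
        constructor
        · rintro ⟨a, ha, hai⟩
          rw [Fin.succ_inj.1 hai] at ha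
          have := this.1 ha
          omega
        · intro h
          exact ⟨i, this.2 (by omega), rfl⟩

namespace Crystal

variable {M i j k θ : ℕ}

theorem below_eq_sum (b : Crystal M k) (i : Fin M) :
    b.below i = ((∑ j, if j < i then b.mult j else 0 : ℕ) : ℤ) := by
  rw [below, Finset.sum_filter]
  push_cast
  rfl

theorem length_word (b : Crystal M k) : b.word.length = k := by
  rw [word, List.length_map, List.length_reverse, List.length_flatMap]
  simp only [List.length_replicate]
  rw [← List.ofFn_eq_map, List.sum_ofFn, b.sum_mult]

/-- The word is weakly decreasing, so the letters of index less than `x` occupy its last `b.below x`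
places. -/
theorem getElem?_word (b : Crystal M k) (m : ℕ) (x : Fin M) :
    b.word[m]? = some x.succ ↔ k - b.below (x + 1) ≤ m ∧ m < k - b.below x := by
  have hlen := b.length_word
  have h1 := b.below_le (x + 1)
  have h2 := b.below_nonneg x
  have h3 := b.below_succ x
  rcases lt_or_ge m k with hm | hm
  · have hlen' : ((List.finRange M).flatMap fun i => List.replicate (b.mult i) i).length = k := by
      rw [word, List.length_map, List.length_reverse] at hlen
      exact hlen
    rw [word, List.getElem?_map, List.getElem?_reverse (by rw [hlen']; exact hm), hlen',
      Option.map_eq_some_iff]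
    have key := List.getElem?_flatMap_replicate b.mult (k - 1 - m) x
    have h4 := b.below_eq_sum x
    constructor
    · rintro ⟨a, ha, hax⟩
      rw [Fin.succ_inj.1 hax] at ha
      have := key.1 ha
      omega
    · intro h
      exact ⟨x, key.2 (by omega), rfl⟩
  · rw [List.getElem?_eq_none (by omega)]
    simp only [reduceCtorEq, false_iff]
    omega

theorem getD_word (b : Crystal M k) (m : ℕ) (x : Fin M) :
    b.word.getD m 0 = x.succ ↔ k - b.below (x + 1) ≤ m ∧ m < k - b.below x := by
  rw [← getElem?_word, List.getD_eq_getElem?_getD]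
  cases b.word[m]? with
  | none => simp [(Fin.succ_ne_zero x).symm]
  | some y => simp

theorem letterAt_word (b : Crystal M k) (a y : ℤ) (x : Fin M) :
    letterAt a b.word y = x.succ ↔ a + (k - b.below (x + 1)) ≤ y ∧ y < a + (k - b.below x) := by
  have h1 := b.below_le (x + 1)
  unfold letterAt
  split_ifs with h
  · rw [getD_word]; omega
  · simp only [(Fin.succ_ne_zero x).symm, false_iff]; omega

theorem letterAt_word_append (b : Crystal M i) (c : Crystal M j) (a : ℤ) (L : ℕ) (y : ℤ)
    (x : Fin M) :
    letterAt a (b.word ++ List.replicate L 0 ++ c.word) y = x.succ ↔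
      (a + (i - b.below (x + 1)) ≤ y ∧ y < a + (i - b.below x)) ∨
      (a + i + L + (j - c.below (x + 1)) ≤ y ∧ y < a + i + L + (j - c.below x)) := by
  have h1 := b.below_le (x + 1)
  have h2 := c.below_le (x + 1)
  have h3 := b.below_nonneg x
  have h4 := c.below_nonneg x
  unfold letterAt
  split_ifs with h
  · rcases lt_or_ge (y - a).toNat i with hm | hm
    · rw [List.append_assoc, List.getD_append _ _ _ _ (by rw [length_word]; exact hm), getD_word]
      omega
    · rcases lt_or_ge (y - a).toNat (i + L) with hm2 | hm2
      · rw [List.getD_append _ _ _ _ (by simp [length_word, hm2]),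
          List.getD_append_right _ _ _ _ (by rw [length_word]; exact hm), length_word,
          List.getD_replicate _ (by omega)]
        simp only [(Fin.succ_ne_zero x).symm, false_iff]
        omega
      · rw [List.getD_append_right _ _ _ _ (by simp [length_word, hm2]), getD_word]
        simp only [List.length_append, length_word, List.length_replicate]
        omega
  · simp only [(Fin.succ_ne_zero x).symm, false_iff]; omega

theorem card_filter_interval (θ : ℕ) (z u v : ℤ) :
    (((Finset.univ.filter fun j : Fin θ => u ≤ z + (j : ℕ) ∧ z + (j : ℕ) < v).card : ℕ) : ℤ) =
      max 0 (min (z + θ) v - max z u) := by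
  have h1 : (Finset.univ.filter fun j : Fin θ => u ≤ z + (j : ℕ) ∧ z + (j : ℕ) < v).card =
      (Finset.Ico (max z u - z).toNat (min (z + θ) v - z).toNat).card := by
    refine Finset.card_bij (fun j _ => j.1) (fun j hj => ?_) (fun a _ b _ h => Fin.ext h)
      fun m hm => ?_
    · simp only [Finset.mem_filter, Finset.mem_univ, true_and, Finset.mem_Ico] at hj ⊢
      have := j.2
      omega
    · simp only [Finset.mem_Ico] at hm
      exact ⟨⟨m, by omega⟩, by simp only [Finset.mem_filter, Finset.mem_univ, true_and]; omega, rfl⟩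
  rw [h1, Nat.card_Ico]
  omega

theorem mult_groupCells (w : ℤ → Fin (M + 1)) (n : ℤ) (x : Fin (M + 1)) :
    (groupCells θ w n).mult x =
      (Finset.univ.filter fun j : Fin θ => w (n * θ + (j : ℕ)) = x).card := rfl

theorem count_sub_count (b : Crystal M k) (a : ℤ) (n : ℤ) (x : ℕ) :
    max 0 (min (n * θ + θ) (a + (k - b.below x)) - max (n * θ) (a + (k - b.below (x + 1)))) =
      b.count (n * θ - a) ((n + 1) * θ - a) (x + 1) - b.count (n * θ - a) ((n + 1) * θ - a) x := by
  have h1 := b.below_le (x + 1)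
  have h2 := b.below_nonneg x
  have h3 := b.below_mono (Nat.le_succ x)
  have h4 : (n + 1) * θ = n * θ + θ := by ring
  unfold count seg
  rw [h4]
  simp only [Nat.succ_eq_add_one] at h3
  omega

theorem isBallCount_cell (b : Crystal M k) (a n : ℤ) :
    IsBallCount M θ (b.count (n * θ - a) ((n + 1) * θ - a)) :=
  b.isBallCount_count (by linarith [Int.natCast_nonneg θ]) (.inl (by linarith))

theorem isBallCount_pair (b : Crystal M i) (c : Crystal M j) (a : ℤ) (L : ℕ) (n : ℤ) :
    IsBallCount M θ (pairCount (· * (θ : ℤ)) (· * (θ : ℤ)) b c a (a + i + L) n) where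
  zero := by
    simp only [pairCount, (isBallCount_cell b a n).zero, (isBallCount_cell c (a + i + L) n).zero,
      add_zero]
  mono x hx := by
    have h1 := (isBallCount_cell (θ := θ) b a n).mono x hx
    have h2 := (isBallCount_cell (θ := θ) c (a + i + L) n).mono x hx
    simp only [pairCount]
    omega
  le := by
    have h4 : (n + 1) * (θ : ℤ) = n * θ + θ := by ring
    simp only [pairCount, count, below_self, h4]
    unfold seg
    omega

theorem oneSoliton_apply (b : Crystal M k) (a n : ℤ) :
    oneSoliton θ a b n = ofCount θ (b.count (n * θ - a) ((n + 1) * θ - a)) := by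
  refine ext_succ fun x => ?_
  have h1 := (isBallCount_cell (θ := θ) b a n).mult_succ x
  have h2 := card_filter_interval θ (n * θ) (a + (k - b.below (x + 1))) (a + (k - b.below x))
  rw [count_sub_count] at h2
  rw [oneSoliton, mult_groupCells]
  simp only [letterAt_word]
  omega

/-- Here the scale is the position `n * θ` itself; it is replaced by the soliton scales in
`twoSoliton_eq_phase`. -/
theorem twoSoliton_eq (b : Crystal M i) (c : Crystal M j) (a : ℤ) (L : ℕ) :
    twoSoliton θ a L b c =
      pairState M (fun _ => θ) (· * (θ : ℤ)) (· * (θ : ℤ)) b c a (a + i + L) := by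
  funext n
  refine ext_succ fun x => ?_
  have h1 := (isBallCount_pair (θ := θ) b c a L n).mult_succ x
  have h2 := card_filter_interval θ (n * θ) (a + (i - b.below (x + 1))) (a + (i - b.below x))
  have h3 := card_filter_interval θ (n * θ) (a + i + L + (j - c.below (x + 1)))
    (a + i + L + (j - c.below x))
  rw [count_sub_count] at h2 h3
  rw [twoSoliton, mult_groupCells, pairState]
  simp only [letterAt_word_append]
  rw [Finset.filter_or, Finset.card_union_of_disjoint]
  · simp only [pairCount] at h1 ⊢
    omega
  · refine Finset.disjoint_filter.2 fun y _ h h' => ?_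
    have := b.below_nonneg x
    have := c.below_le (x + 1)
    omega

end Crystal

section

variable {M i j k θ : ℕ}

/-- The phase of a soliton of amplitude `i` that starts at the position `a`. -/
def phase (θ i : ℕ) (a : ℤ) : ℤ :=
  if θ ≤ i then a else (a / θ + 1) * i - min (i : ℤ) ((a / θ + 1) * θ - a)

theorem phase_of_le (h : θ ≤ i) (a : ℤ) : phase θ i a = a := if_pos h

theorem ediv_bounds (hθ : 1 ≤ θ) (a : ℤ) : a / θ * θ ≤ a ∧ a < (a / θ + 1) * θ :=
  ⟨Int.ediv_mul_le _ (by omega), Int.lt_ediv_add_one_mul_self _ (by omega)⟩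

theorem scale_of_le (h : θ ≤ i) (n : ℤ) : scale θ i n = n * θ := by
  rw [scale, min_eq_left h]

theorem scale_of_ge (h : i ≤ θ) (n : ℤ) : scale θ i n = n * i := by
  rw [scale, min_eq_right h]

/-- For `θ ≤ i` phase and position coincide. For `i < θ` the word meets at most two cells, and the
phase records the cell of its first letter and the number of letters in that cell. -/
theorem count_phase (hθ : 1 ≤ θ) (b : Crystal M i) (a n : ℤ) :
    b.count (n * θ - a) ((n + 1) * θ - a) =
      b.count (scale θ i n - phase θ i a) (scale θ i (n + 1) - phase θ i a) := by
  funext x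
  rcases le_or_gt θ i with h | h
  · rw [phase_of_le h, scale_of_le h, scale_of_le h]
  · obtain ⟨h1, h2⟩ := ediv_bounds hθ a
    rw [phase, if_neg (by omega), scale_of_ge h.le, scale_of_ge h.le]
    set m := a / (θ : ℤ)
    have e1 : (m + 1) * (θ : ℤ) = m * θ + θ := by ring
    have e2 : (m + 1) * (i : ℤ) = m * i + i := by ring
    have e3 : (n + 1) * (θ : ℤ) = n * θ + θ := by ring
    have e4 : (n + 1) * (i : ℤ) = n * i + i := by ring
    rcases (show n < m ∨ n = m ∨ n = m + 1 ∨ m + 2 ≤ n by omega) with hn | rfl | rfl | hn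
    · have m1 : (n + 1) * (θ : ℤ) ≤ m * θ := by gcongr; omega
      have m2 : (n + 1) * (i : ℤ) ≤ m * i := by gcongr; omega
      rw [b.count_of_le_zero (by omega), b.count_of_le_zero (by omega)]
    · exact b.count_congr (by omega) (by omega) x
    · rcases le_or_gt (i : ℤ) (m * θ + θ - a) with hr | hr
      · rw [b.count_of_length_le (by omega), b.count_of_length_le (by omega)]
      · exact b.count_congr (by omega) (by omega) x
    · have m1 : (m + 2) * (θ : ℤ) ≤ n * θ := by gcongr
      have m2 : (m + 2) * (i : ℤ) ≤ n * i := by gcongr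
      have e5 : (m + 2) * (θ : ℤ) = m * θ + 2 * θ := by ring
      have e6 : (m + 2) * (i : ℤ) = m * i + 2 * i := by ring
      rw [b.count_of_length_le (by omega), b.count_of_length_le (by omega)]

theorem scale_le_phase (hθ : 1 ≤ θ) {a n : ℤ} (h : n * θ ≤ a) : scale θ i n ≤ phase θ i a := by
  rcases le_or_gt θ i with hi | hi
  · rwa [phase_of_le hi, scale_of_le hi]
  · have h1 : n ≤ a / θ := (Int.le_ediv_iff_mul_le (by omega)).2 h
    rw [phase, if_neg (by omega), scale_of_ge hi.le]
    have h2 : n * (i : ℤ) ≤ a / θ * i := by gcongr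
    have h3 : (a / θ + 1) * (i : ℤ) = a / θ * i + i := by ring
    omega

theorem phase_add_le (hθ : 1 ≤ θ) (hi : 1 ≤ i) {a n : ℤ} (h : a + i ≤ n * θ) :
    phase θ i a + i ≤ scale θ i n := by
  rcases le_or_gt θ i with hiθ | hiθ
  · rwa [phase_of_le hiθ, scale_of_le hiθ]
  · obtain ⟨h1, h2⟩ := ediv_bounds hθ a
    rw [phase, if_neg (by omega), scale_of_ge hiθ.le]
    set m := a / (θ : ℤ)
    have e1 : (m + 1) * (θ : ℤ) = m * θ + θ := by ring
    have e2 : (m + 1) * (i : ℤ) = m * i + i := by ring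
    have hn : m + 1 ≤ n := by
      by_contra hc
      have : n * (θ : ℤ) ≤ m * θ := by gcongr; omega
      omega
    have h3 : (m + 1) * (i : ℤ) ≤ n * i := by gcongr
    rcases le_or_gt (i : ℤ) (m * θ + θ - a) with hr | hr
    · omega
    · have hn2 : m + 2 ≤ n := by
        by_contra hc
        have : n * (θ : ℤ) ≤ (m + 1) * θ := by gcongr; omega
        omega
      have h4 : (m + 2) * (i : ℤ) ≤ n * i := by gcongr
      have e6 : (m + 2) * (i : ℤ) = m * i + 2 * i := by ring
      omega

theorem exists_phase (hθ : 1 ≤ θ) (hi : 1 ≤ i) (X : ℤ) : ∃ a, phase θ i a = X ∧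
    (∀ n, scale θ i n ≤ X → n * θ ≤ a) ∧ ∀ n, X + i ≤ scale θ i n → a + i ≤ n * θ := by
  rcases le_or_gt θ i with hiθ | hiθ
  · exact ⟨X, phase_of_le hiθ X, fun n h => by rwa [scale_of_le hiθ] at h,
      fun n h => by rwa [scale_of_le hiθ] at h⟩
  · obtain ⟨h1, h2⟩ := ediv_bounds hi X
    set m := X / (i : ℤ)
    have e1 : (m + 1) * (θ : ℤ) = m * θ + θ := by ring
    have e2 : (m + 1) * (i : ℤ) = m * i + i := by ring
    have hm : ((m + 1) * θ - ((m + 1) * i - X)) / (θ : ℤ) = m := by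
      rw [Int.ediv_eq_iff_of_pos (by omega)]
      constructor <;> linarith
    -- The soliton begins in cell `m`, the quotient of `X` by `i`, and ends or crosses at the right
    -- boundary of this cell with `(m + 1) * i - X` letters in it.
    refine ⟨(m + 1) * θ - ((m + 1) * i - X), ?_, fun n h => ?_, fun n h => ?_⟩
    · rw [phase, if_neg (by omega), hm]
      omega
    · rw [scale_of_ge hiθ.le] at h
      have hn : n ≤ m := by
        by_contra hc
        have : (m + 1) * (i : ℤ) ≤ n * i := by gcongr; omega
        omega
      have : n * (θ : ℤ) ≤ m * θ := by gcongr
      omega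
    · rw [scale_of_ge hiθ.le] at h
      have hn : m + 1 ≤ n := by
        by_contra hc
        have : n * (i : ℤ) ≤ m * i := by gcongr; omega
        omega
      have h3 : (m + 1) * (θ : ℤ) ≤ n * θ := by gcongr
      by_cases hX : X ≤ m * i
      · omega
      · have hn2 : m + 2 ≤ n := by
          by_contra hc
          have : n * (i : ℤ) ≤ (m + 1) * i := by gcongr; omega
          omega
        have h4 : (m + 2) * (θ : ℤ) ≤ n * θ := by gcongr
        have e6 : (m + 2) * (θ : ℤ) = m * θ + 2 * θ := by ring
        omega

theorem twoSoliton_eq_phase (hθ : 1 ≤ θ) (b : Crystal M i) (c : Crystal M j) (a : ℤ) (L : ℕ) :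
    twoSoliton θ a L b c = pairState M (fun _ => θ) (scale θ i) (scale θ j) b c (phase θ i a)
      (phase θ j (a + i + L)) := by
  rw [twoSoliton_eq]
  funext n
  unfold pairState
  congr 1
  funext x
  unfold pairCount
  rw [count_phase hθ, count_phase hθ]

theorem separatedBy_iff (hθ : 1 ≤ θ) {D : ℕ} {a : ℤ} {L : ℕ} :
    SeparatedBy D θ i a L ↔ ∃ n : ℤ, a + i ≤ n * θ ∧ (n + D - 1) * θ ≤ a + i + L := by
  have hθ' : (0 : ℤ) < θ := by omega
  unfold SeparatedBy
  constructor
  · intro h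
    refine ⟨(a + i - 1) / θ + 1, ?_, ?_⟩
    · have := (ediv_bounds hθ (a + i - 1)).2
      omega
    · rw [← Int.le_ediv_iff_mul_le hθ']
      linarith
  · rintro ⟨n, h1, h2⟩
    have h3 := (Int.le_ediv_iff_mul_le hθ').2 h2
    have h4 : (a + i - 1) / (θ : ℤ) < n := (Int.ediv_lt_iff_lt_mul hθ').2 (by omega)
    omega

/-- A translation changes the position relative to the cell boundaries, which can cost one cell of
separation. -/
theorem SeparatedBy.translate (hθ : 1 ≤ θ) {D : ℕ} {a : ℤ} {L : ℕ}
    (h : SeparatedBy (D + 1) θ i a L) (a' : ℤ) : SeparatedBy D θ i a' L := by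
  obtain ⟨n, h1, h2⟩ := (separatedBy_iff hθ).1 h
  obtain ⟨h3, h4⟩ := ediv_bounds hθ (a' + i - 1)
  refine (separatedBy_iff hθ).2 ⟨(a' + i - 1) / θ + 1, by omega, ?_⟩
  push_cast at h2
  have e1 : (n + (D + 1) - 1) * (θ : ℤ) = n * θ + D * θ := by ring
  have e2 : ((a' + i - 1) / θ + 1 + D - 1) * (θ : ℤ) = (a' + i - 1) / θ * θ + D * θ := by ring
  omega

/-- The first `i` of the margin `2 * i` is the word itself; the other one comes from the `D - 1 ≥ i`
further cells, each of which advances the scale by at least one. -/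
theorem SeparatedBy.isApart (hθ : 1 ≤ θ) (hi : 1 ≤ i) {D : ℕ} (hD : i < D) {a : ℤ} {L : ℕ}
    (h : SeparatedBy D θ i a L) :
    IsApart (scale θ i) (scale θ j) i (phase θ i a) (phase θ j (a + i + L)) := by
  obtain ⟨n, h1, h2⟩ := (separatedBy_iff hθ).1 h
  refine ⟨n + D - 1, ?_, scale_le_phase hθ h2⟩
  have h3 := phase_add_le hθ hi h1
  have h4 := (isScale_scale θ i).add_le (fun _ => hθ) hi (show n ≤ n + D - 1 by omega)
  omega

theorem HasGap.isAsymptotic (hθ : 1 ≤ θ) (hi : 1 ≤ i) (hj : 1 ≤ j) {D : ℕ} {X Y : ℤ}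
    (h : HasGap θ i j D X Y) (b : Crystal M i) (c : Crystal M j) :
    IsAsymptotic D (b, c) (pairState M (fun _ => θ) (scale θ i) (scale θ j) b c X Y) := by
  obtain ⟨n, h1, h2⟩ := h
  obtain ⟨a, rfl, -, ha⟩ := exists_phase hθ hi X
  obtain ⟨a', rfl, ha', -⟩ := exists_phase hθ hj Y
  have h3 := ha n (by omega)
  have h4 := ha' _ h2
  have h5 : n * (θ : ℤ) ≤ (n + D) * θ := by gcongr; omega
  have h6 : (n + D - 1) * (θ : ℤ) ≤ (n + D) * θ := by gcongr; omega
  have e : a + i + ((a' - a - i).toNat : ℤ) = a' := by omega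
  refine ⟨a, (a' - a - i).toNat, (separatedBy_iff hθ).2 ⟨n, h3, by omega⟩, ?_⟩
  rw [twoSoliton_eq_phase hθ, e]

theorem exists_isAsymptotic (hθ : 1 ≤ θ) (D : ℕ) (bc : Crystal M i × Crystal M j) :
    ∃ p : BoxState M θ, IsAsymptotic D bc p := by
  obtain ⟨h1, h2⟩ := ediv_bounds hθ (i : ℤ)
  refine ⟨_, 0, (D + 1) * θ, (separatedBy_iff hθ).2 ⟨i / θ + 1, by omega, ?_⟩, rfl⟩
  push_cast
  linarith

theorem below_injective {b b' : Crystal M k} (h : ∀ x ≤ M, b.below x = b'.below x) : b = b' := by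
  refine Crystal.ext fun x => ?_
  have h1 := b.below_succ x
  have h2 := b'.below_succ x
  have h3 := h x x.2.le
  have h4 := h (x + 1) x.2
  omega

/-- The labels of two solitons that do not share a cell are determined by the state. -/
theorem IsAsymptotic.unique (hθ : 1 ≤ θ) (hi : 1 ≤ i) {bc bc' : Crystal M i × Crystal M j} {p : BoxState M θ}
    (h : IsAsymptotic 1 bc p) (h' : IsAsymptotic 1 bc' p) : bc = bc' := by
  have key : ∀ (b b' : Crystal M i) (c c' : Crystal M j) (a a' : ℤ) (L L' : ℕ) (n n' : ℤ),
      a + i ≤ n * θ → n * θ ≤ a + i + L → a' + i ≤ n' * θ → n' * θ ≤ a' + i + L' → n ≤ n' →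
      twoSoliton θ a L b c = twoSoliton θ a' L' b' c' → b = b' ∧ c = c' := by
    intro b b' c c' a a' L L' n n' h1 h2 h3 h4 hnn heq
    rw [twoSoliton_eq, twoSoliton_eq] at heq
    have hcell : ∀ m, ∀ x ≤ M, pairCount (· * (θ : ℤ)) (· * (θ : ℤ)) b c a (a + i + L) m x =
        pairCount (· * (θ : ℤ)) (· * (θ : ℤ)) b' c' a' (a' + i + L') m x := by
      intro m x
      have B := isBallCount_pair (θ := θ) b c a L m
      have B' := isBallCount_pair (θ := θ) b' c' a' L' m
      induction x with
      | zero => intro _; rw [B.zero, B'.zero]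
      | succ x ih =>
        intro hx
        have e1 := B.mult_succ ⟨x, hx⟩
        have e2 := B'.mult_succ ⟨x, hx⟩
        have e3 : (ofCount θ (pairCount (· * (θ : ℤ)) (· * (θ : ℤ)) b c a (a + i + L) m) :
            Crystal (M + 1) θ) =
          ofCount θ (pairCount (· * (θ : ℤ)) (· * (θ : ℤ)) b' c' a' (a' + i + L') m) :=
          congrFun heq m
        rw [e3] at e1
        have := ih (by omega)
        dsimp only at e1 e2
        omega
    -- The cell `u` lies to the left of both states, so that the contents can be summed from there.
    set u : ℤ := min 0 (min a a') with hu
    have hu1 : u * θ ≤ u := by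
      have : u * (θ - 1) ≤ 0 := mul_nonpos_of_nonpos_of_nonneg (by omega) (by omega)
      linarith
    have htot : ∀ m, u ≤ m → ∀ x ≤ M,
        b.count (u * θ - a) (m * θ - a) x + c.count (u * θ - (a + i + L)) (m * θ - (a + i + L)) x =
        b'.count (u * θ - a') (m * θ - a') x +
          c'.count (u * θ - (a' + i + L')) (m * θ - (a' + i + L')) x := by
      intro m hm x hx
      induction m, hm using Int.leInduction with
      | base =>
        rw [b.count_of_le_zero (by omega), c.count_of_le_zero (by omega),
          b'.count_of_le_zero (by omega), c'.count_of_le_zero (by omega)]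
      | succ m hm ih =>
        have hc := hcell m x hx
        have g1 : u * (θ : ℤ) ≤ m * θ := by gcongr
        have g2 : m * (θ : ℤ) ≤ (m + 1) * θ := by gcongr; omega
        simp only [pairCount] at hc
        unfold count at hc ih ⊢
        rw [← seg_add (b.below_nonneg x) (show u * θ - a ≤ m * θ - a by omega)
            (show m * θ - a ≤ (m + 1) * θ - a by omega),
          ← seg_add (c.below_nonneg x) (show u * θ - (a + i + L) ≤ m * θ - (a + i + L) by omega)
            (show m * θ - (a + i + L) ≤ (m + 1) * θ - (a + i + L) by omega),
          ← seg_add (b'.below_nonneg x) (show u * θ - a' ≤ m * θ - a' by omega)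
            (show m * θ - a' ≤ (m + 1) * θ - a' by omega),
          ← seg_add (c'.below_nonneg x)
            (show u * θ - (a' + i + L') ≤ m * θ - (a' + i + L') by omega)
            (show m * θ - (a' + i + L') ≤ (m + 1) * θ - (a' + i + L') by omega)]
        omega
    have hun : u ≤ n' := by
      by_contra hc
      have : n' * (θ : ℤ) ≤ u * θ := by gcongr; omega
      omega
    have gn : n * (θ : ℤ) ≤ n' * θ := by gcongr
    have hb : ∀ x ≤ M, b.below x + c.count (u * θ - (a + i + L)) (n' * θ - (a + i + L)) x =
        b'.below x := by
      intro x hx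
      have h5 := htot n' hun x hx
      rwa [b.count_full (by omega) (by omega), b'.count_full (by omega) (by omega),
        c'.count_of_le_zero (by omega), add_zero] at h5
    -- The cells before `n'` contain all of `b` and all of `b'`; as these have the same amplitude,
    -- no letter of `c` can be among them.
    have hzero : ∀ x ≤ M, c.count (u * θ - (a + i + L)) (n' * θ - (a + i + L)) x = 0 := by
      intro x hx
      have h5 := hb M le_rfl
      rw [below_self, below_self] at h5
      have h6 : c.count (u * θ - (a + i + L)) (n' * θ - (a + i + L)) x ≤
        c.count (u * θ - (a + i + L)) (n' * θ - (a + i + L)) M := seg_mono (c.below_mono hx)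
      have h7 : 0 ≤ c.count (u * θ - (a + i + L)) (n' * θ - (a + i + L)) x := seg_nonneg _ _ _ _
      omega
    have hbb : b = b' := below_injective fun x hx => by
      rw [← hb x hx, hzero x hx, add_zero]
    refine ⟨hbb, below_injective fun x hx => ?_⟩
    set v : ℤ := max 0 (max (a + i + L + j) (a' + i + L' + j)) with hv
    have hv1 : v ≤ v * θ := by
      have : 0 ≤ v * (θ - 1) := mul_nonneg (by omega) (by omega)
      linarith
    have h5 := htot v (by omega) x hx
    rw [b.count_full (by omega) (by omega), b'.count_full (by omega) (by omega),
      c.count_full (by omega) (by omega), c'.count_full (by omega) (by omega), hbb] at h5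
    omega
  obtain ⟨a, L, hs, hp⟩ := h
  obtain ⟨a', L', hs', hp'⟩ := h'
  obtain ⟨n, h1, h2⟩ := (separatedBy_iff hθ).1 hs
  obtain ⟨n', h1', h2'⟩ := (separatedBy_iff hθ).1 hs'
  have g1 : (n + (1 : ℕ) - 1) * (θ : ℤ) = n * θ := by push_cast; ring
  have g2 : (n' + (1 : ℕ) - 1) * (θ : ℤ) = n' * θ := by push_cast; ring
  rcases le_total n n' with hn | hn
  · obtain ⟨e1, e2⟩ := key bc.1 bc'.1 bc.2 bc'.2 a a' L L' n n' h1 (by omega) h1' (by omega) hn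
      (hp.symm.trans hp')
    exact Prod.ext e1 e2
  · obtain ⟨e1, e2⟩ := key bc'.1 bc.1 bc'.2 bc.2 a' a L' L n' n h1' (by omega) h1 (by omega) hn
      (hp'.symm.trans hp)
    exact Prod.ext e1.symm e2.symm

theorem IsScatteringMatrix.unique (hθ : 1 ≤ θ) (hj : 1 ≤ j) {κ D : ℕ}
    {S S' : Crystal M i × Crystal M j → Crystal M j × Crystal M i}
    (h : IsScatteringMatrix θ κ D S) (h' : IsScatteringMatrix θ κ D S') : S = S' := by
  funext bc
  obtain ⟨p, hp⟩ := exists_isAsymptotic hθ D bc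
  obtain ⟨t, ht⟩ := h bc p hp 1
  obtain ⟨t', ht'⟩ := h' bc p hp 1
  exact (ht (max t t') (le_max_left _ _)).unique hθ hj (ht' (max t t') (le_max_right _ _))

/-- The scattering of solitons that finally separate. -/
theorem isScatteringMatrix_of_related (hM : 1 ≤ M) (hθ : 1 ≤ θ) (hi : 1 ≤ i) (hj : 1 ≤ j) {κ D : ℕ}
    (hD : i < D) (hspeed : min θ i * min κ j < min θ j * min κ i)
    {S : Crystal M i × Crystal M j → Crystal M j × Crystal M i}
    (hS : ∀ bc X Y X' Y', IsApart (scale θ i) (scale θ j) i X Y →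
      IsApart (scale θ j) (scale θ i) j X' Y' → FiniteState.Related (fun _ => hθ)
        (pairFinite (fun _ => hθ) hi hj (isScale_scale θ i) (isScale_scale θ j) bc.1 bc.2 X Y)
        (pairFinite (fun _ => hθ) hj hi (isScale_scale θ j) (isScale_scale θ i) (S bc).1 (S bc).2
          X' Y')) : IsScatteringMatrix θ κ D S := by
  rintro bc p ⟨a, L, hs, rfl⟩ D'
  have hap := hs.isApart (j := j) hθ hi hD
  obtain ⟨t₀, ht₀⟩ := eventually_pair hM hθ hj hi hspeed (S bc).1 (S bc).2
    (fun X' Y' h' => hS bc _ _ X' Y' hap h') D'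
  refine ⟨t₀, fun t ht => ?_⟩
  obtain ⟨X, Y, hg, he⟩ := ht₀ t ht
  have := timeEvolution_iterate hθ κ t (pairFinite (fun _ => hθ) hi hj (isScale_scale θ i)
    (isScale_scale θ j) bc.1 bc.2 (phase θ i a) (phase θ j (a + i + L)))
  rw [he] at this
  rw [twoSoliton_eq_phase hθ]
  exact this ▸ hg.isAsymptotic hθ hj hi (S bc).1 (S bc).2

end

/-! ### Solitons of equal velocity -/

section

variable {M i j k θ κ : ℕ}

theorem isLatticeEvolution_single {Θ : ℤ → ℕ} {S : ℤ → ℤ} (hΘ : ∀ n, 1 ≤ Θ n) (hi : 1 ≤ i)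
    (hS : IsScale Θ i S) (b : Crystal M i) (κ : ℕ) (X : ℤ) :
    IsLatticeEvolution (M := M) κ (fun n => ofCount (Θ n) (b.count (S n - X) (S (n + 1) - X)))
      fun n => ofCount (Θ n)
        (b.count (S n - (X + (min κ i : ℕ))) (S (n + 1) - (X + (min κ i : ℕ)))) := by
  obtain ⟨A, hA⟩ := hS.exists_forall_le hΘ hi X
  obtain ⟨B, hB⟩ := hS.exists_forall_ge hΘ hi (X + 2 * i)
  refine isLatticeEvolution_of_count
    (F := fun n => b.count (S n - X - (min κ i : ℕ)) (S n - X))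
    ⟨A, fun n hn x _ => b.count_of_le_zero (by have := hA n hn; omega) x⟩
    ⟨B, fun n hn x _ => b.count_of_length_le (by have := hB n hn; omega) x⟩
    fun n => combR_soliton hS b κ X n

theorem timeEvolution_oneSoliton (hθ : 1 ≤ θ) (hi : 1 ≤ i) {v : ℤ}
    (hv : ∀ a, phase θ i (a + v) = phase θ i a + (min κ i : ℕ)) (b : Crystal M i) (a : ℤ) :
    timeEvolution κ (oneSoliton θ a b) = oneSoliton θ (a + v) b := by
  refine timeEvolution_eq ?_
  have e : ∀ a, oneSoliton θ a b = fun n =>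
      ofCount θ (b.count (scale θ i n - phase θ i a) (scale θ i (n + 1) - phase θ i a)) := fun a => by
    funext n
    rw [oneSoliton_apply, count_phase hθ]
  rw [e, e, hv]
  exact isLatticeEvolution_single (fun _ => hθ) hi (isScale_scale θ i) b κ _

theorem timeEvolution_twoSoliton (hθ : 1 ≤ θ) (hi : 1 ≤ i) (hj : 1 ≤ j) {v : ℤ}
    (hv : ∀ a, phase θ i (a + v) = phase θ i a + (min κ i : ℕ))
    (hv' : ∀ a, phase θ j (a + v) = phase θ j a + (min κ j : ℕ)) {D : ℕ} (hD : i < D)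
    (b : Crystal M i) (c : Crystal M j) {a : ℤ} {L : ℕ} (hs : SeparatedBy D θ i a L) :
    timeEvolution κ (twoSoliton θ a L b c) = twoSoliton θ (a + v) L b c := by
  refine timeEvolution_eq ?_
  have e : a + v + i + L = a + i + L + v := by ring
  rw [twoSoliton_eq_phase hθ, twoSoliton_eq_phase hθ, hv, e, hv']
  exact isLatticeEvolution_pair (fun _ => hθ) hi hj (isScale_scale θ i) (isScale_scale θ j) b c κ _ _
    ((hs.isApart hθ hi hD).pairLocal (fun _ => hθ) hi hj (isScale_scale θ i) (isScale_scale θ j)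
      b c κ)

theorem noScattering (hθ : 1 ≤ θ) (hi : 1 ≤ i) (hj : 1 ≤ j) {v : ℤ}
    (hv : ∀ a, phase θ i (a + v) = phase θ i a + (min κ i : ℕ))
    (hv' : ∀ a, phase θ j (a + v) = phase θ j a + (min κ j : ℕ)) {D : ℕ} (hD : i < D) :
    NoScattering M θ κ (D + 1) i j v := by
  intro b c a L hs t
  induction t with
  | zero => simp
  | succ t ih =>
    rw [Function.iterate_succ_apply', ih,
      timeEvolution_twoSoliton hθ hi hj hv hv' hD b c (hs.translate hθ _)]
    congr 1
    push_cast
    ring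

theorem phase_add_cell (hθ : 1 ≤ θ) (a : ℤ) :
    phase θ i (a + θ) = phase θ i a + (min θ i : ℕ) := by
  rcases le_or_gt θ i with h | h
  · rw [phase_of_le h, phase_of_le h, min_eq_left h]
  · rw [phase, phase, if_neg (by omega), if_neg (by omega), min_eq_right h.le,
      Int.add_ediv_of_dvd_right (dvd_refl _), Int.ediv_self (by omega),
      show (a / θ + 1 + 1) * (θ : ℤ) - (a + θ) = (a / θ + 1) * θ - a by ring]
    ring

theorem hasVelocity_cell (hθ : 1 ≤ θ) (hi : 1 ≤ i) (h : min κ i = min θ i) :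
    HasVelocity M θ κ i θ := by
  rintro b a x ⟨n, h1, h2, rfl⟩
  rw [timeEvolution_oneSoliton hθ hi (v := θ) (fun a => by rw [h, phase_add_cell hθ])]
  have e : ∀ m, oneSoliton θ (a + θ) b (m + 1) = oneSoliton θ a b m := fun m => by
    rw [oneSoliton_apply, oneSoliton_apply]
    congr 2 <;> ring
  refine ⟨n + 1, fun m hm => ?_, by rwa [e], by rw [e]; ring⟩
  rw [← sub_add_cancel m 1, e, h1 _ (by omega)]

theorem IsCoordinate.unique {p : BoxState M θ} {x x' : ℤ} (h : IsCoordinate p x)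
    (h' : IsCoordinate p x') : x = x' := by
  obtain ⟨n, h1, h2, rfl⟩ := h
  obtain ⟨n', h1', h2', rfl⟩ := h'
  rcases lt_trichotomy n n' with hn | rfl | hn
  · exact absurd (h1' n hn) h2
  · rfl
  · exact absurd (h1 n' hn) h2'

/-- For `θ ≤ i` the word fills its first cell up to the right boundary, so the coordinate is the
starting position. For `i < θ` this can fail, and `hasVelocity_cell` uses the translation by a whole
cell instead. -/
theorem isCoordinate_oneSoliton (hθ : 1 ≤ θ) (hi : θ ≤ i) (b : Crystal M i) (a : ℤ) :
    IsCoordinate (oneSoliton θ a b) a := by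
  obtain ⟨h1, h2⟩ := ediv_bounds hθ a
  set n := a / (θ : ℤ)
  have e1 : (n + 1) * (θ : ℤ) = n * θ + θ := by ring
  have hm : ((oneSoliton θ a b n).mult 0 : ℤ) = θ - ((n + 1) * θ - a) := by
    rw [oneSoliton_apply, (isBallCount_cell b a n).mult_zero, count, below_self]
    unfold seg
    omega
  refine ⟨n, fun m hm => ?_, fun hvac => ?_, by omega⟩
  · have h3 : (m + 1) * (θ : ℤ) ≤ n * θ := by gcongr; omega
    rw [oneSoliton_apply]
    exact ofCount_eq_vac fun x _ => b.count_of_le_zero (by omega) x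
  · rw [hvac, mult_vac_zero] at hm
    omega

theorem hasVelocity_carrier (hθ : 1 ≤ θ) (hi : 1 ≤ i) (h : θ ≤ i) (h' : κ ≤ i) :
    HasVelocity M θ κ i κ := by
  intro b a x hx
  rw [timeEvolution_oneSoliton hθ hi (v := κ)
    (fun a => by rw [phase_of_le h, phase_of_le h, min_eq_left h']),
    hx.unique (isCoordinate_oneSoliton hθ h b a)]
  exact isCoordinate_oneSoliton hθ h b _

theorem mul_min_lt {m a n : ℕ} (h : max m a < n) (hm : 1 ≤ m) (ha : 1 ≤ a) :
    a * m < min a m * n := by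
  have h1 : a * m = min a m * max a m := (min_mul_max a m).symm
  rw [h1]
  exact Nat.mul_lt_mul_of_pos_left (by omega) (by omega)

end

theorem theorem3p8 (l : ℕ) :
    ∃ D : ℕ, ∀ (M : ℕ) [NeZero M] (k θ κ : ℕ), 1 ≤ k → k < l → 1 ≤ θ → 1 ≤ κ →
      (max k θ < min l κ →
        ∀ S : Crystal M l × Crystal M k → Crystal M k × Crystal M l,
          IsScatteringMatrix θ κ D S ↔ S = Crystal.combR l k) ∧
      (max k κ < min l θ →
        ∀ S : Crystal M k × Crystal M l → Crystal M l × Crystal M k,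
          IsScatteringMatrix θ κ D S ↔ S = Crystal.combR k l) ∧
      (¬ max k θ < min l κ → ¬ max k κ < min l θ →
        ∃ v : ℤ, 0 < v ∧ HasVelocity M θ κ l v ∧ HasVelocity M θ κ k v ∧
          NoScattering M θ κ D l k v ∧ NoScattering M θ κ D k l v) := by
  -- Being apart needs a separation larger than the amplitude, hence `l + 1`; one more cell is
  -- reserved for translations in case (III).
  refine ⟨l + 2, fun M _ k θ κ hk hkl hθ hκ => ⟨fun h S => ?_, fun h S => ?_, fun h h' => ?_⟩⟩
  · have hM : 1 ≤ M := Nat.pos_of_ne_zero (NeZero.ne M)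
    have hR : IsScatteringMatrix θ κ (l + 2) (combR (N := M) l k) := by
      refine isScatteringMatrix_of_related hM hθ (hk.trans hkl.le) hk (by omega) ?_
        fun bc X Y X' Y' ha ha' => ?_
      -- The larger soliton is faster: its advance in cells per step is `min κ l / θ`, that of the
      -- smaller one is `k / min θ k`.
      · have := mul_min_lt h hk hθ
        rwa [min_eq_left (show θ ≤ l by omega), min_eq_right (show k ≤ κ by omega), min_comm κ l]
      · exact (related_scattered hk hkl hθ (combR_combR bc) ha' ha).symm
    exact ⟨fun hS => hS.unique hθ hk hR, fun hS => hS ▸ hR⟩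
  · have hM : 1 ≤ M := Nat.pos_of_ne_zero (NeZero.ne M)
    have hR : IsScatteringMatrix θ κ (l + 2) (combR (N := M) k l) := by
      refine isScatteringMatrix_of_related hM hθ hk (hk.trans hkl.le) (by omega) ?_
        fun bc X Y X' Y' ha ha' => ?_
      · have := mul_min_lt h hk hκ
        rwa [min_eq_right (show k ≤ θ by omega), min_eq_left (show κ ≤ l by omega), mul_comm,
          min_comm θ l, mul_comm (min l θ)]
      · exact related_scattered hk hkl hθ rfl ha ha'
    exact ⟨fun hS => hS.unique hθ (hk.trans hkl.le) hR, fun hS => hS ▸ hR⟩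
  · have hl := hk.trans hkl.le
    -- If `θ` and `κ` are at most `k`, both solitons move by `κ` positions. Otherwise the failure of
    -- both inequalities forces `min κ i = min θ i` for both amplitudes, and both solitons move by
    -- exactly one cell.
    by_cases hc : θ ≤ k ∧ κ ≤ k
    · have e : ∀ i, k ≤ i → ∀ a, phase θ i (a + κ) = phase θ i a + (min κ i : ℕ) := fun i hi a => by
        rw [phase_of_le (by omega), phase_of_le (by omega), min_eq_left (by omega)]
      exact ⟨κ, by omega, hasVelocity_carrier hθ hl (by omega) (by omega),
        hasVelocity_carrier hθ hk hc.1 hc.2,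
        noScattering hθ hl hk (e l hkl.le) (e k le_rfl) (Nat.lt_succ_self l),
        noScattering hθ hk hl (e k le_rfl) (e l hkl.le) (by omega)⟩
    · have e : ∀ i, i = k ∨ i = l → min κ i = min θ i := fun i hi => by omega
      have e' : ∀ i, i = k ∨ i = l → ∀ a, phase θ i (a + θ) = phase θ i a + (min κ i : ℕ) :=
        fun i hi a => by rw [e i hi, phase_add_cell hθ]
      exact ⟨θ, by omega, hasVelocity_cell hθ hl (e l (.inr rfl)),
        hasVelocity_cell hθ hk (e k (.inl rfl)),
        noScattering hθ hl hk (e' l (.inr rfl)) (e' k (.inl rfl)) (Nat.lt_succ_self l),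
        noScattering hθ hk hl (e' k (.inl rfl)) (e' l (.inr rfl)) (by omega)⟩
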